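/- Let $p$ be an odd prime, $q = 3^p$ and $G = \mathrm{PSL}(2,q)$. For $x \in G$ let $\mathrm{Sol}_G(x) = \{y \in G : \langle x, y\rangle \text{ is soluble}\}$. Write $C_n$ for the cyclic group of order $n$, $D_n$ for the dihedral group of order $n$, and $A_4$ for the alternating group of degree $4$. Then there is a faithful action of $C_{(q-1)/2}$ on $C_3^p$, with semidirect product $B = C_3^p \rtimes C_{(q-1)/2}$, such that every maximal subgroup of $G$ is isomorphic to one of $B$, $D_{q-1}$, $D_{q+1}$, $A_4$, and such that the following holds for every $x \in G$ with $x \neq 1$. The order $|x|$ is $2$, or is $3$, or is different from $2$ and divides $q-1$, or is different from $2$ and divides $q+1$; the set $\mathrm{Sol}_G(x)$ is the union of the maximal subgroups of $G$ containing $x$; and: 1. If $|x| = 2$, then the numbers of maximal subgroups of $G$ that contain $x$ and are isomorphic to $B$, $D_{q-1}$, $D_{q+1}$, $A_4$ are respectively $0$, $(q+1)/2$, $(q+3)/2$, $(q+1)/4$; any two distinct maximal subgroups containing $x$ intersect in a subgroup isomorphic to $C_2$ or to $C_2^2$, and both possibilities occur; and $|\mathrm{Sol}_G(x)| = q(q+1)$.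 2. If $|x| = 3$, then these numbers are respectively $1$, $0$, $0$, $q/3$; any two distinct maximal subgroups containing $x$ intersect in a subgroup isomorphic to $C_3$; and $|\mathrm{Sol}_G(x)| = q(q+5)/2$. 3. If $|x|$ divides $q-1$ and $|x| \neq 2$, then these numbers are respectively $2$, $1$, $0$, $0$; any two distinct maximal subgroups containing $x$ intersect in a subgroup isomorphic to $C_{(q-1)/2}$; and $|\mathrm{Sol}_G(x)| = q(q-1)$. 4. If $|x|$ divides $q+1$ and $|x| \neq 2$, then these numbers are respectively $0$, $0$, $1$, $0$, so that $x$ lies in only one maximal subgroup of $G$; and $|\mathrm{Sol}_G(x)| = q+1$. -/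

import Mathlib

/-- The solubilizer `Sol_G(x) = {y ∈ G | ⟨x, y⟩ is soluble}`. -/
def solubilizer {G : Type*} [Group G] (x : G) : Set G :=
  {y : G | Group.IsSolvable (Subgroup.closure ({x, y} : Set G))}

/-- The set of maximal subgroups of `G` that contain `x`. -/
def maximalOver {G : Type*} [Group G] (x : G) : Set (Subgroup G) :=
  {M : Subgroup G | IsCoatom M ∧ x ∈ M}

/-- The number of maximal subgroups of `G` that contain `x` and are isomorphic to `H`. -/
noncomputable def maximalCount {G : Type*} [Group G] (x : G) (H : Type) [Group H] : ℕ :=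
  {M : Subgroup G | M ∈ maximalOver x ∧ Nonempty (M ≃* H)}.ncard

/-- The cyclic group `C_n` (for `n ≥ 1`), written multiplicatively. -/
abbrev Cyc (n : ℕ) : Type := Multiplicative (ZMod n)

/-- The elementary abelian group `C_r ^ k`, written multiplicatively. -/
abbrev ElemAb (r k : ℕ) : Type := Multiplicative (Fin k → ZMod r)

/-! Write q = 8k + 3, with 3 ∣ k. Every element of G = PSL(2, q) is conjugate into U (unipotent,
order q), S (split torus, cyclic of odd order 4k + 1) or T (nonsplit torus, cyclic of order 4k + 2),
and the centralizer of a nontrivial element is the corresponding conjugate of U, S or T, except that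
an involution has the normalizer of T. These facts, together with a few on generation and conjugacy,
are collected in `PSLTwoData`, verified by 2 × 2 matrices in `pslTwoData`, and everything else is
deduced from them.

Subgroups are classified by fusion arguments. Sylow 2-subgroups are four-groups, as |G| is 4 times
an odd number. If 3 does not divide |H|, Burnside's transfer theorem gives H a normal 2-complement;
a group of odd order prime to 3 lies in a torus, so H normalizes a torus or is a 2-group. If 3
divides |H| and H lies in no Borel subgroup, then, since p is prime and there is no field strictly
between F_3 and F_q, H meets a suitable Borel only in its unipotent radical. Burnside's theorem at
the prime 3 then gives a normal 3-complement, which must be a four-group. Hence a proper subgroup is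
conjugate into one of B, N(S), N(T), A = N(V) ≅ A₄ (`exists_conj_mem`); no order of one divides that
of another, so these are the classes of maximal subgroups.

Each representative X is self-normalizing, so x lies in |x^G ∩ X| · |C(x)| / |X| conjugates of X
(`ncard_conjugates_over`). All four are soluble and G is not, so the solubilizer is the union of the
maximal subgroups over x. Its size is found by removing a set E containing all pairwise
intersections, outside which the maximal subgroups are disjoint: ⟨x⟩ if |x| = 3, C(x) if x is split,
and {y : y² = 1} if x is an involution. -/

/-! ### Counting and recognition lemmas for finite groups. -/

section FiniteGroups

open Pointwise

theorem Set.ncard_eq_mul_of_fibers {α β : Type*} [Finite α] (f : α → β) {s : Set α} {t : Set β}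
    {n : ℕ} (hf : Set.MapsTo f s t) (ht : t.Finite)
    (h : ∀ b ∈ t, {a | a ∈ s ∧ f a = b}.ncard = n) : s.ncard = t.ncard * n := by
  classical
  have hs : s.Finite := s.toFinite
  rw [Set.ncard_eq_toFinset_card s hs, Set.ncard_eq_toFinset_card t ht,
    Finset.card_eq_sum_card_fiberwise (f := f) (t := ht.toFinset) (by simpa using hf)]
  rw [Finset.sum_const_nat (m := n)]
  intro b hb
  rw [← h b (by simpa using hb), Set.ncard_eq_toFinset_card _ (Set.toFinite _)]
  congr 1
  ext a
  simp

theorem Set.ncard_mul_right {G : Type*} [Group G] (s : Set G) (g : G) :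
    ((· * g) '' s).ncard = s.ncard :=
  Set.ncard_image_of_injective _ (mul_left_injective g)

theorem Set.ncard_mul_left {G : Type*} [Group G] (s : Set G) (g : G) :
    ((g * ·) '' s).ncard = s.ncard :=
  Set.ncard_image_of_injective _ (mul_right_injective g)

theorem Subgroup.ncard_coe {G : Type*} [Group G] (H : Subgroup G) :
    (H : Set G).ncard = Nat.card H := rfl

theorem Subgroup.mem_conj_smul {G : Type*} [Group G] {g x : G} {H : Subgroup G} :
    x ∈ MulAut.conj g • H ↔ g⁻¹ * x * g ∈ H := by
  rw [Subgroup.mem_pointwise_smul_iff_inv_smul_mem, MulAut.smul_def, ← map_inv, MulAut.conj_apply,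
    inv_inv]

theorem Subgroup.card_conj_smul {G : Type*} [Group G] (g : G) (H : Subgroup G) :
    Nat.card ↥(MulAut.conj g • H) = Nat.card H :=
  (Nat.card_congr (Subgroup.equivSMul (MulAut.conj g) H).toEquiv).symm

theorem Subgroup.conj_smul_le {G : Type*} [Group G] {g : G} {H K : Subgroup G} :
    MulAut.conj g • H ≤ K ↔ ∀ x ∈ H, g * x * g⁻¹ ∈ K := by
  constructor
  · intro h x hx
    exact h (by rw [mem_conj_smul]; simpa [mul_assoc] using hx)
  · intro h x hx
    rw [mem_conj_smul] at hx
    simpa [mul_assoc] using h _ hx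

/-- Counting the elements that conjugate `x` into `X`. -/
theorem ncard_conj_mem {G : Type*} [Group G] [Finite G] (X : Set G) (x : G) :
    {g : G | g⁻¹ * x * g ∈ X}.ncard =
      {y | y ∈ X ∧ IsConj x y}.ncard * Nat.card (Subgroup.centralizer {x}) := by
  refine Set.ncard_eq_mul_of_fibers (fun g => g⁻¹ * x * g) ?_ (Set.toFinite _) ?_
  · intro g hg
    exact ⟨hg, isConj_iff.2 ⟨g⁻¹, by simp⟩⟩
  · rintro y ⟨hy, hc⟩
    obtain ⟨c, rfl⟩ := isConj_iff.1 hc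
    -- The fibre over c x c⁻¹ is the coset C(x) c⁻¹.
    rw [← Subgroup.ncard_coe, ← Set.ncard_mul_right (Subgroup.centralizer {x} : Set G) c⁻¹]
    congr 1
    ext g
    simp only [Set.mem_ofPred_eq, Set.mem_image, SetLike.mem_coe,
      Subgroup.mem_centralizer_singleton_iff]
    constructor
    · rintro ⟨-, h⟩
      refine ⟨g * c, ?_, by group⟩
      have : x * g = g * (c * x * c⁻¹) := by rw [← h]; group
      calc g * c * x = g * (c * x * c⁻¹) * c := by group
        _ = x * (g * c) := by rw [← this, mul_assoc]
    · rintro ⟨d, hd, rfl⟩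
      have : (d * c⁻¹)⁻¹ * x * (d * c⁻¹) = c * x * c⁻¹ := by
        calc (d * c⁻¹)⁻¹ * x * (d * c⁻¹) = c * d⁻¹ * (x * d) * c⁻¹ := by group
          _ = c * x * c⁻¹ := by rw [← hd]; group
      exact ⟨by rw [this]; exact hy, this⟩

/-- Counting the conjugates of a self-normalizing subgroup that contain a given element. -/
theorem ncard_conjugates_over {G : Type*} [Group G] [Finite G] (X : Subgroup G)
    (hX : ∀ g, (∀ x ∈ X, g * x * g⁻¹ ∈ X) → g ∈ X) (x : G) :
    {M : Subgroup G | x ∈ M ∧ ∃ g : G, M = MulAut.conj g • X}.ncard * Nat.card X =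
      {y | y ∈ X ∧ IsConj x y}.ncard * Nat.card (Subgroup.centralizer {x}) := by
  have h := ncard_conj_mem (X : Set G) x
  simp only [SetLike.mem_coe] at h
  rw [← h]
  symm
  -- The same set of g is counted again, now by the conjugate g X g⁻¹; since X is self-normalizing,
  -- the fibres are the cosets g X.
  refine Set.ncard_eq_mul_of_fibers (fun g => MulAut.conj g • X) ?_ (Set.toFinite _) ?_
  · intro g hg
    exact ⟨Subgroup.mem_conj_smul.2 hg, g, rfl⟩
  · rintro M ⟨hx, g, rfl⟩
    rw [← Subgroup.ncard_coe, ← Set.ncard_mul_left (X : Set G) g]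
    congr 1
    ext k
    simp only [Set.mem_ofPred_eq, Set.mem_image, SetLike.mem_coe]
    constructor
    · rintro ⟨-, h⟩
      refine ⟨g⁻¹ * k, hX _ fun z hz => ?_, by group⟩
      have : k * z * k⁻¹ ∈ MulAut.conj k • X :=
        Subgroup.mem_conj_smul.2 (by simpa [mul_assoc] using hz)
      rw [h, Subgroup.mem_conj_smul] at this
      simpa [mul_assoc] using this
    · rintro ⟨d, hd, rfl⟩
      have : MulAut.conj (g * d) • X = MulAut.conj g • X := by
        rw [map_mul, mul_smul]
        congr 1
        ext z
        rw [Subgroup.mem_conj_smul]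
        constructor
        · intro h; simpa [mul_assoc] using X.mul_mem (X.mul_mem hd h) (X.inv_mem hd)
        · intro h; exact X.mul_mem (X.mul_mem (X.inv_mem hd) h) hd
      refine ⟨?_, this⟩
      rw [← Subgroup.mem_conj_smul, this]
      exact hx

/-- A group of order `2 * n` with a cyclic subgroup of order `n` outside of which all elements are
involutions is dihedral. -/
theorem nonempty_mulEquiv_dihedralGroup {G : Type*} [Group G] [Finite G] {C : Subgroup G} {n : ℕ}
    (hn : n ≠ 0) (hC : IsCyclic C) (hcard : Nat.card C = n) (hG : Nat.card G = 2 * n)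
    (h : ∀ g, g ∉ C → g * g = 1) : Nonempty (G ≃* DihedralGroup n) := by
  have : NeZero n := ⟨hn⟩
  obtain ⟨w, hw⟩ : ∃ w, w ∉ C := by
    by_contra! hw
    have : C = ⊤ := by ext; simp [hw]
    rw [this, Subgroup.card_top, hG] at hcard
    omega
  let e : Multiplicative (ZMod n) ≃* C := mulEquivOfCyclicCardEq (by simp [hcard])
  have hinv (c : C) : (c : G) * w = w * (c : G)⁻¹ := by
    have h1 : w * c ∉ C := fun hc => hw (by simpa using C.mul_mem hc (C.inv_mem c.2))
    have h2 := h _ h1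
    have h3 := h _ hw
    calc (c : G) * w = w⁻¹ * (w * c * (w * c)) * (c : G)⁻¹ := by group
      _ = w⁻¹ * (c : G)⁻¹ := by rw [h2]; group
      _ = w * (c : G)⁻¹ := by rw [inv_eq_of_mul_eq_one_left h3]
  let ψ (i : ZMod n) : C := e (Multiplicative.ofAdd i)
  have ψadd (i j) : ψ (i + j) = ψ i * ψ j := by simp [ψ, ofAdd_add]
  have ψneg (i) : ψ (-i) = (ψ i)⁻¹ := by simp [ψ]
  have ψsub (i j) : ψ (j - i) = (ψ i)⁻¹ * ψ j := by rw [sub_eq_neg_add, ψadd, ψneg]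
  have hww := h w hw
  let f : DihedralGroup n →* G :=
    { toFun := fun d => match d with
        | .r i => ψ i
        | .sr i => w * ψ i
      map_one' := by
        change ((ψ 0 : C) : G) = 1
        simp [ψ]
      map_mul' := by
        rintro (i | i) (j | j)
        · rw [DihedralGroup.r_mul_r]; simp [ψadd]
        · rw [DihedralGroup.r_mul_sr]; simp [ψsub, ← mul_assoc, hinv]
        · rw [DihedralGroup.sr_mul_r]; simp [ψadd, mul_assoc]
        · rw [DihedralGroup.sr_mul_sr]
          simp only [ψsub, Subgroup.coe_mul, InvMemClass.coe_inv]
          rw [mul_assoc w, ← mul_assoc _ w, hinv, mul_assoc w, ← mul_assoc w w, hww, one_mul] }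
  have hf : Function.Injective f := by
    rw [injective_iff_map_eq_one]
    rintro (i | i) hi
    · change ((ψ i : C) : G) = 1 at hi
      have : ψ i = 1 := by ext; exact hi
      have : Multiplicative.ofAdd i = 1 := by simpa [ψ] using this
      rw [DihedralGroup.one_def, show i = 0 from this]
    · change w * (ψ i : C) = 1 at hi
      exact absurd (by rw [eq_inv_of_mul_eq_one_left hi]; exact C.inv_mem (ψ i).2) hw
  have hb : Function.Bijective f := by
    rw [Nat.bijective_iff_injective_and_card]
    exact ⟨hf, by rw [DihedralGroup.nat_card, hG]⟩
  exact ⟨(MulEquiv.ofBijective f hb).symm⟩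

/-- A group of order `12` with a core-free subgroup of order `3` is isomorphic to `A₄`. -/
theorem nonempty_mulEquiv_alternatingGroup_four {G : Type*} [Group G] [Finite G]
    (hG : Nat.card G = 12) {P : Subgroup G} (hP : Nat.card P = 3) (hcore : P.normalCore = ⊥) :
    Nonempty (G ≃* alternatingGroup (Fin 4)) := by
  have hidx : Nat.card (G ⧸ P) = 4 := by
    have := P.card_mul_index
    rw [hP, hG, Subgroup.index] at this
    omega
  let e : (G ⧸ P) ≃ Fin 4 := Nat.equivFinOfCardPos (by omega) |>.trans (finCongr hidx)
  -- The action on the four cosets of P has the core of P as kernel, so G has index 2 in S₄.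
  let f : G →* Equiv.Perm (Fin 4) :=
    e.permCongrHom.toMonoidHom.comp (MulAction.toPermHom G (G ⧸ P))
  have hf : Function.Injective f := by
    refine e.permCongrHom.injective.comp ?_
    rw [← MonoidHom.ker_eq_bot_iff, ← Subgroup.normalCore_eq_ker, hcore]
  have h12 : Nat.card f.range = 12 := by
    rw [← hG]
    exact (Nat.card_congr (MonoidHom.ofInjective hf).toEquiv).symm
  have hr : f.range = alternatingGroup (Fin 4) := by
    apply Equiv.Perm.eq_alternatingGroup_of_index_eq_two
    have := f.range.card_mul_index
    rw [h12, Nat.card_perm, Nat.card_fin] at this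
    have h24 : (4).factorial = 24 := rfl
    omega
  exact ⟨(MonoidHom.ofInjective hf).trans (MulEquiv.subgroupCongr hr)⟩

/-- A finite group of odd order in which the centralizers of nontrivial elements are
self-normalizing trivial-intersection subgroups is commutative. -/
theorem commute_of_centralizers_selfNormalizing {M : Type*} [Group M] [Finite M]
    (hodd : Odd (Nat.card M))
    (h : ∀ x : M, x ≠ 1 → ∀ c, c ≠ 1 → c * x = x * c → ∀ g,
      g * c * g⁻¹ * x = x * (g * c * g⁻¹) → g * x = x * g) (x y : M) : x * y = y * x := by
  rcases eq_or_ne x 1 with rfl | hx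
  · simp
  let Y (x : M) : Set M := {y | y ≠ 1 ∧ ∃ g, g⁻¹ * y * g ∈ Subgroup.centralizer {x}}
  -- Pairs (g, c) with 1 ≠ c ∈ C(x) are counted by the element g c g⁻¹; the hypothesis makes each
  -- fibre a coset of C(x) in the first coordinate.
  have hfib (x : M) (hx : x ≠ 1) : Nat.card M * (Nat.card (Subgroup.centralizer {x}) - 1) =
      (Y x).ncard * Nat.card (Subgroup.centralizer {x}) := by
    set C := Subgroup.centralizer {x}
    have h1 : ((C : Set M) \ {1}).ncard = Nat.card C - 1 := by
      rw [Set.ncard_sdiff_singleton_of_mem (by simp), Subgroup.ncard_coe]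
    rw [← h1, ← Set.ncard_univ, ← Set.ncard_prod]
    refine Set.ncard_eq_mul_of_fibers (fun p => p.1 * p.2 * p.1⁻¹) ?_ (Set.toFinite _) ?_
    · rintro ⟨g, c⟩ ⟨-, hc, hc1⟩
      refine ⟨?_, g, by simpa [mul_assoc] using hc⟩
      simpa using hc1
    · rintro y ⟨hy1, g, hg⟩
      rw [← Subgroup.ncard_coe]
      refine (Set.ncard_image_of_injective (C : Set M)
        (f := fun c => (g * c, (g * c)⁻¹ * y * (g * c))) ?_).symm ▸ ?_
      · intro a b hab
        simpa using congrArg Prod.fst hab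
      congr 1
      ext ⟨k, c⟩
      simp only [Set.mem_ofPred_eq, Set.mem_prod, Set.mem_univ, true_and, Set.mem_sdiff,
        SetLike.mem_coe, Set.mem_singleton_iff, Set.mem_image, Prod.mk.injEq]
      constructor
      · rintro ⟨⟨hc, hc1⟩, hk⟩
        have hy : y = k * c * k⁻¹ := hk.symm
        refine ⟨g⁻¹ * k, ?_, by group, by rw [hy]; group⟩
        rw [Subgroup.mem_centralizer_singleton_iff] at hc ⊢
        refine h x hx c hc1 hc _ ?_
        rw [Subgroup.mem_centralizer_singleton_iff, hy] at hg
        have : g⁻¹ * k * c * (g⁻¹ * k)⁻¹ = g⁻¹ * (k * c * k⁻¹) * g := by group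
        rw [this, hg]
      · rintro ⟨d, hd, rfl, rfl⟩
        refine ⟨⟨?_, ?_⟩, by group⟩
        · have : (g * d)⁻¹ * y * (g * d) = d⁻¹ * (g⁻¹ * y * g) * d := by group
          rw [this]
          exact C.mul_mem (C.mul_mem (C.inv_mem hd) hg) hd
        · intro h1
          apply hy1
          have : y = (g * d) * ((g * d)⁻¹ * y * (g * d)) * (g * d)⁻¹ := by group
          rw [this, h1]; group
  have hthree (x : M) (hx : x ≠ 1) : 3 ≤ Nat.card (Subgroup.centralizer {x}) := by
    have hdvd := Subgroup.card_subgroup_dvd_card (Subgroup.centralizer {x})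
    have hc : Odd (Nat.card (Subgroup.centralizer {x})) := hodd.of_dvd_nat hdvd
    have : 1 < Nat.card (Subgroup.centralizer {x}) := by
      rw [Subgroup.one_lt_card_iff_ne_bot]
      intro hb
      have : x ∈ Subgroup.centralizer {x} := Subgroup.mem_centralizer_singleton_iff.2 rfl
      rw [hb] at this
      exact hx (by simpa using this)
    obtain ⟨k, hk⟩ := hc
    omega
  -- |Y x| = |M| (1 - 1/|C(x)|) and |C(x)| ≥ 3 by oddness, so two disjoint sets of this kind do not
  -- fit into M.
  have hlarge (x : M) (hx : x ≠ 1) : 2 * Nat.card M ≤ 3 * (Y x).ncard := by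
    have h1 := hfib x hx
    have h3 := hthree x hx
    obtain ⟨c, hc⟩ : ∃ c, Nat.card (Subgroup.centralizer {x}) = c + 3 :=
      ⟨_, (Nat.sub_add_cancel h3).symm⟩
    rw [hc, show c + 3 - 1 = c + 2 by omega] at h1
    nlinarith
  have hcover : Y x = {1}ᶜ := by
    refine Set.Subset.antisymm (fun y hy => hy.1) fun z hz => ?_
    by_contra hzx
    have hdisj : Disjoint (Y x) (Y z) := by
      rw [Set.disjoint_left]
      rintro v ⟨hv, g, hg⟩ ⟨-, k, hk⟩
      apply hzx
      rw [Subgroup.mem_centralizer_singleton_iff] at hg hk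
      refine ⟨hz, k⁻¹ * g, ?_⟩
      rw [Subgroup.mem_centralizer_singleton_iff]
      have hg1 : g⁻¹ * v * g ≠ 1 := by simpa [mul_assoc, mul_eq_one_iff_eq_inv] using hv
      have hk1 : k * z * k⁻¹ ≠ 1 := by simpa [mul_assoc, mul_eq_one_iff_eq_inv] using hz
      have hxz (t : M) (ht : t * v = v * t) : g⁻¹ * t * g * x = x * (g⁻¹ * t * g) := by
        refine h x hx _ hg1 hg _ ?_
        convert hg using 2
        all_goals
          calc g⁻¹ * t * g * (g⁻¹ * v * g) * (g⁻¹ * t * g)⁻¹ = g⁻¹ * (t * v) * t⁻¹ * g := by group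
            _ = g⁻¹ * v * g := by rw [ht]; group
      have := hxz (k * z * k⁻¹) (by
        calc k * z * k⁻¹ * v = k * (z * (k⁻¹ * v * k)) * k⁻¹ := by group
          _ = k * (k⁻¹ * v * k * z) * k⁻¹ := by rw [hk]
          _ = v * (k * z * k⁻¹) := by group)
      convert this using 2 <;> group
    have h1 := hlarge x hx
    have h2 := hlarge z hz
    have h3 : (Y x ∪ Y z).ncard ≤ ({1}ᶜ : Set M).ncard :=
      Set.ncard_le_ncard (Set.union_subset (fun y hy => hy.1) fun y hy => hy.1) (Set.toFinite _)
    rw [Set.ncard_union_eq hdisj (Set.toFinite _) (Set.toFinite _), Set.ncard_compl,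
      Set.ncard_singleton] at h3
    have := Nat.card_pos (α := M)
    omega
  -- Now Y x is everything but 1, and |M| (|C| - 1) = (|M| - 1) |C| gives |M| = |C|.
  have h1 := hfib x hx
  rw [hcover, Set.ncard_compl, Set.ncard_singleton] at h1
  have hM := Nat.card_pos (α := M)
  have h3 := hthree x hx
  have htop : Subgroup.centralizer {x} = (⊤ : Subgroup M) := by
    apply Subgroup.eq_top_of_card_eq
    obtain ⟨m, hm⟩ : ∃ m, Nat.card M = m + 1 := ⟨_, (Nat.sub_add_cancel hM).symm⟩
    obtain ⟨c, hc⟩ : ∃ c, Nat.card (Subgroup.centralizer {x}) = c + 1 :=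
      ⟨_, (Nat.sub_add_cancel (by omega)).symm⟩
    rw [hm, hc, Nat.add_sub_cancel, Nat.add_sub_cancel] at h1
    rw [hm, hc]
    nlinarith
  have : y ∈ Subgroup.centralizer {x} := by rw [htop]; trivial
  exact (Subgroup.mem_centralizer_singleton_iff.1 this).symm

/-- Burnside's normal complement, described by the orders of its elements. -/
theorem Sylow.exists_complement {N : Type*} [Group N] [Finite N] {p : ℕ} [Fact p.Prime]
    (P : Sylow p N) (hP : Subgroup.normalizer (P : Set N) ≤ Subgroup.centralizer (P : Set N)) :
    ∃ K : Subgroup N, (∀ x, x ∈ K ↔ ¬ p ∣ orderOf x) ∧ Nat.card K * Nat.card P = Nat.card N := by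
  have hp : p.Prime := Fact.out
  refine ⟨(MonoidHom.transferSylow P hP).ker, fun x => ⟨fun hx hd => ?_, fun hx => ?_⟩, ?_⟩
  · refine MonoidHom.not_dvd_card_ker_transferSylow P hP (hd.trans ?_)
    have := orderOf_dvd_natCard (⟨x, hx⟩ : (MonoidHom.transferSylow P hP).ker)
    rwa [Subgroup.orderOf_mk] at this
  · rw [MonoidHom.mem_ker, ← orderOf_eq_one_iff]
    obtain ⟨k, hk⟩ := P.isPGroup'.exists_card_eq
    have h1 : orderOf (MonoidHom.transferSylow P hP x) ∣ p ^ k := hk ▸ orderOf_dvd_natCard _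
    have h2 : orderOf (MonoidHom.transferSylow P hP x) ∣ orderOf x := orderOf_map_dvd _ x
    exact Nat.eq_one_of_dvd_coprimes ((Nat.Prime.coprime_pow_of_not_dvd hp hx)) h2 h1
  · exact (MonoidHom.ker_transferSylow_isComplement' P hP).card_mul_card

end FiniteGroups

/-! ### Normal 2-complements. -/

section OddComplement

/-- Automorphisms act faithfully on the nonidentity elements. -/
theorem card_mulAut_dvd {P : Type*} [Group P] [Finite P] :
    Nat.card (MulAut P) ∣ (Nat.card P - 1).factorial := by
  let e : MulAut P →* Equiv.Perm {v : P // v ≠ 1} :=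
    { toFun := fun σ =>
        Equiv.Perm.subtypePerm (p := fun v => v ≠ 1) (MulEquiv.toEquiv σ) (by simp)
      map_one' := rfl
      map_mul' := fun _ _ => rfl }
  have he : Function.Injective e := by
    intro σ τ h
    ext v
    by_cases hv : v = 1
    · simp [hv]
    · exact congrArg (fun π => ((π ⟨v, hv⟩ : {v : P // v ≠ 1}) : P)) h
  refine (Subgroup.card_dvd_of_injective e he).trans ?_
  have : Nat.card {v : P // v ≠ 1} = ({1}ᶜ : Set P).ncard := rfl
  rw [Nat.card_perm, this, Set.ncard_compl, Set.ncard_singleton]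

/-- A group of order prime to `3` whose Sylow `2`-subgroups have order at most `4` has a normal
`2`-complement, formed by the elements of odd order. -/
theorem exists_odd_complement {N : Type*} [Group N] [Finite N] (h3 : ¬ 3 ∣ Nat.card N)
    (h8 : ¬ 8 ∣ Nat.card N) : ∃ K : Subgroup N, (∀ x, x ∈ K ↔ Odd (orderOf x)) ∧
      ∃ d : ℕ, (d = 1 ∨ d = 2 ∨ d = 4) ∧ Nat.card K * d = Nat.card N := by
  have : Fact (Nat.Prime 2) := ⟨Nat.prime_two⟩
  obtain ⟨P⟩ : Nonempty (Sylow 2 N) := inferInstance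
  obtain ⟨k, hk⟩ := P.isPGroup'.exists_card_eq
  have hPN : Nat.card P ∣ Nat.card N := Subgroup.card_subgroup_dvd_card _
  have hk2 : k ≤ 2 := by
    by_contra! h
    exact h8 ((show 8 = 2 ^ 3 from rfl) ▸ (pow_dvd_pow 2 h).trans (hk ▸ hPN))
  have hd : Nat.card P = 1 ∨ Nat.card P = 2 ∨ Nat.card P = 4 := by
    rw [hk]
    interval_cases k <;> simp
  have hcomm (a b : P) : a * b = b * a := by
    rcases hd with h | h | h
    · have := (Nat.card_eq_one_iff_unique.1 h).1
      exact Subsingleton.elim _ _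
    · have := isCyclic_of_prime_card (p := 2) h
      exact (IsCyclic.commGroup (α := P)).mul_comm a b
    · have := IsPGroup.isMulCommutative_of_card_eq_prime_sq (p := 2) (G := P) h
      exact this.is_comm.comm a b
  -- N(P)/C(P) embeds in Aut P, whose order divides 3! = 6. Its order is odd because the abelian
  -- Sylow subgroup P lies in C(P), and prime to 3 by hypothesis, so it is trivial.
  have hP : Subgroup.normalizer (P : Set N) ≤ Subgroup.centralizer (P : Set N) := by
    set f := (P : Subgroup N).normalizerMonoidHom
    have hker := (P : Subgroup N).normalizerMonoidHom_ker
    have hle : (P : Subgroup N) ≤ Subgroup.centralizer (P : Set N) := fun a ha =>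
      Subgroup.mem_centralizer_iff.2 fun b hb => congrArg Subtype.val (hcomm ⟨b, hb⟩ ⟨a, ha⟩)
    suffices h1 : f.ker.index = 1 by
      rw [Subgroup.index_eq_one, hker, Subgroup.subgroupOf_eq_top] at h1
      exact h1
    have hodd : ¬ 2 ∣ f.ker.index := fun h => by
      have h1 : f.ker.index ∣ (P : Subgroup N).relIndex (Subgroup.normalizer (P : Set N)) := by
        refine Subgroup.index_dvd_of_le ?_
        rw [hker]
        exact Subgroup.comap_mono hle
      have h2 : (P : Subgroup N).relIndex (Subgroup.normalizer (P : Set N)) ∣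
          (P : Subgroup N).index :=
        ⟨_, (Subgroup.relIndex_mul_index Subgroup.le_normalizer).symm⟩
      exact P.not_dvd_index ((h.trans h1).trans h2)
    have hthree : ¬ 3 ∣ f.ker.index := fun h =>
      h3 ((h.trans (Subgroup.index_dvd_card _)).trans (Subgroup.card_subgroup_dvd_card _))
    have hsix : f.ker.index ∣ 6 := by
      rw [Subgroup.index_ker]
      exact (Subgroup.card_subgroup_dvd_card _).trans
        (card_mulAut_dvd.trans (Nat.factorial_dvd_factorial (show Nat.card P - 1 ≤ 3 by omega)))
    have hle6 := Nat.le_of_dvd (by norm_num) hsix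
    generalize f.ker.index = r at *
    interval_cases r <;> revert hodd hthree hsix <;> decide
  obtain ⟨K, hK, hcard⟩ := P.exists_complement hP
  refine ⟨K, fun x => ?_, _, hd, hcard⟩
  rw [hK, ← Nat.not_even_iff_odd, even_iff_two_dvd]

end OddComplement

/-! ### The abstract local data of PSL(2, q). -/

section Structure

/-- The local structure of `PSL(2, q)` for `q = 3 ^ p = 8 * k + 3`, `p` an odd prime: a Borel subgroup `B`
with unipotent radical `U`, a split torus `S` and a nonsplit torus `T` with their normalizers `NS`
and `NT`, the standard Weyl element `w`, and a four-group `{1, i, j, i * j}` with an element `u` of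
order `3` normalizing it. -/
structure PSLTwoData (G : Type*) [Group G] (q k : ℕ) where
  (B U S NS T NT : Subgroup G)
  (w i j u : G)
  three_le : 3 ≤ k
  q_eq : q = 8 * k + 3
  q_pow : ∃ n, q = 3 ^ n
  card : Nat.card G = q * (4 * k + 1) * (8 * k + 4)
  card_B : Nat.card B = q * (4 * k + 1)
  card_U : Nat.card U = q
  card_S : Nat.card S = 4 * k + 1
  card_NS : Nat.card NS = 8 * k + 2
  card_T : Nat.card T = 4 * k + 2
  card_NT : Nat.card NT = 8 * k + 4
  cyclic_S : IsCyclic S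
  cyclic_T : IsCyclic T
  pow_three : ∀ x ∈ U, x ^ 3 = 1
  U_le : U ≤ B
  S_le : S ≤ B
  S_le_NS : S ≤ NS
  T_le : T ≤ NT
  cover : ∀ x : G, ∃ g, g * x * g⁻¹ ∈ U ∨ g * x * g⁻¹ ∈ S ∨ g * x * g⁻¹ ∈ T
  comm_U : ∀ x ∈ U, x ≠ 1 → ∀ y, y * x = x * y ↔ y ∈ U
  comm_S : ∀ x ∈ S, x ≠ 1 → ∀ y, y * x = x * y ↔ y ∈ S
  comm_T : ∀ x ∈ T, x ^ 2 ≠ 1 → ∀ y, y * x = x * y ↔ y ∈ T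
  conj_U : ∀ b ∈ B, ∀ x ∈ U, b * x * b⁻¹ ∈ U
  conj_U_iff : ∀ x ∈ U, x ≠ 1 → ∀ g, g * x * g⁻¹ ∈ U → g ∈ B
  conj_S_iff : ∀ x ∈ S, x ≠ 1 → ∀ g, g * x * g⁻¹ ∈ S → g ∈ NS
  conj_T_iff : ∀ x ∈ T, x ≠ 1 → ∀ g, g * x * g⁻¹ ∈ T → g ∈ NT
  sq_NS : ∀ g ∈ NS, g ∉ S → g * g = 1
  sq_NT : ∀ g ∈ NT, g ∉ T → g * g = 1
  trans_U : ∀ x ∈ U, ∀ y ∈ U, x ≠ 1 → y ≠ 1 → ∃ b, b * x * b⁻¹ = y ∨ b * x * b⁻¹ = y⁻¹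
  w_mem : w ∈ NS
  w_notMem : w ∉ B
  conj_SB : ∀ x ∈ S, x ≠ 1 → ∀ g, g⁻¹ * x * g ∈ B → g ∈ B ∨ w⁻¹ * g ∈ B
  gen : ∀ H : Subgroup G, U ≤ H → ∀ h ∈ H, h ∉ B → H = ⊤
  -- Irreducible action on the unipotent radical: this is where the absence of intermediate fields,
  -- i.e. the primality of p, enters the classification.
  irred : ∀ P : Subgroup G, P ≤ U → P ≠ ⊥ → ∀ b ∈ B, b ∉ U → (∀ x ∈ P, b * x * b⁻¹ ∈ P) → U ≤ P
  i_sq : i * i = 1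
  j_sq : j * j = 1
  i_ne : i ≠ 1
  j_ne : j ≠ 1
  i_ne_j : i ≠ j
  ij_comm : i * j = j * i
  u_cube : u ^ 3 = 1
  conj_i : u * i * u⁻¹ = j
  conj_j : u * j * u⁻¹ = i * j

end Structure

/-! ### Classification of the proper subgroups up to conjugacy. -/

section Classification

open Pointwise

theorem orderOf_conj {G : Type*} [Group G] (g x : G) : orderOf (g * x * g⁻¹) = orderOf x :=
  (MulAut.conj g).orderOf_eq x

theorem conj_eq_one {G : Type*} [Group G] {g x : G} : g * x * g⁻¹ = 1 ↔ x = 1 := by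
  rw [← MulAut.conj_apply, EmbeddingLike.map_eq_one_iff]

theorem conj_commute {G : Type*} [Group G] {x y : G} (g : G) :
    (g * y * g⁻¹) * (g * x * g⁻¹) = (g * x * g⁻¹) * (g * y * g⁻¹) ↔ y * x = x * y := by
  simp only [← MulAut.conj_apply, ← map_mul, EmbeddingLike.apply_eq_iff_eq]

theorem Subgroup.not_dvd_card_of_conj_mem {G : Type*} [Group G] {n : ℕ} {H N : Subgroup G} {g : G}
    (h : ∀ x ∈ H, g * x * g⁻¹ ∈ N) (hN : ¬ n ∣ Nat.card N) : ¬ n ∣ Nat.card H := by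
  intro h3
  refine hN (h3.trans ?_)
  rw [← Subgroup.card_conj_smul g]
  exact Subgroup.card_dvd_of_le (Subgroup.conj_smul_le.2 h)

theorem isPGroup_two_of_card {G : Type*} [Group G] {Q : Subgroup G} {d : ℕ} (hd : d = 1 ∨ d = 2 ∨ d = 4)
    (hQ : Nat.card Q = d) : IsPGroup 2 Q := by
  rcases hd with rfl | rfl | rfl
  · exact IsPGroup.of_card (n := 0) hQ
  · exact IsPGroup.of_card (n := 1) hQ
  · exact IsPGroup.of_card (n := 2) hQ

namespace PSLTwoData

variable {G : Type*} [Group G] {q k : ℕ} (D : PSLTwoData G q k)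

include D

theorem finite : Finite G := by
  have h := D.card
  have := D.q_eq
  refine Nat.finite_of_card_ne_zero ?_
  rw [h]
  subst this
  positivity

/-- Consequently 4k + 1 and 4k + 2 are prime to 3, so elements of order 3 are never conjugate into a
torus. -/
theorem three_dvd : 3 ∣ k := by
  obtain ⟨n, hn⟩ := D.q_pow
  have := D.q_eq
  have := D.three_le
  have : n ≠ 0 := by rintro rfl; simp at hn; omega
  have : 3 ∣ q := hn ▸ dvd_pow_self 3 this
  omega

theorem card' : Nat.card G = 4 * (q * (4 * k + 1) * (2 * k + 1)) := by
  rw [D.card]; ring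

theorem odd_q : Odd q := by
  rw [D.q_eq]; exact ⟨4 * k + 1, by ring⟩

theorem not_eight_dvd_card : ¬ 8 ∣ Nat.card G := by
  rw [D.card', show 8 = 4 * 2 from rfl, Nat.mul_dvd_mul_iff_left (by norm_num)]
  refine (Odd.not_two_dvd_nat ?_)
  exact (D.odd_q.mul ⟨2 * k, by ring⟩).mul ⟨k, by ring⟩

theorem orderOf_of_mem_U {x : G} (hx : x ∈ D.U) (h1 : x ≠ 1) : orderOf x = 3 :=
  orderOf_eq_prime (D.pow_three x hx) h1

theorem orderOf_dvd_of_mem_S {x : G} (hx : x ∈ D.S) : orderOf x ∣ 4 * k + 1 := by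
  rw [← D.card_S]
  simpa using orderOf_dvd_natCard (⟨x, hx⟩ : D.S)

theorem orderOf_dvd_of_mem_T {x : G} (hx : x ∈ D.T) : orderOf x ∣ 4 * k + 2 := by
  rw [← D.card_T]
  simpa using orderOf_dvd_natCard (⟨x, hx⟩ : D.T)

theorem exists_conj_mem_U {x : G} (hx : orderOf x = 3) : ∃ g, g * x * g⁻¹ ∈ D.U := by
  obtain ⟨g, h | h | h⟩ := D.cover x
  · exact ⟨g, h⟩
  · have := D.orderOf_dvd_of_mem_S h
    rw [orderOf_conj, hx] at this
    have := D.three_dvd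
    omega
  · have := D.orderOf_dvd_of_mem_T h
    rw [orderOf_conj, hx] at this
    have := D.three_dvd
    omega

/-- The four-group `{1, i, j, i * j}`. -/
def V : Subgroup G where
  carrier := {1, D.i, D.j, D.i * D.j}
  one_mem' := by simp
  mul_mem' := by
    have hi := D.i_sq
    have hj := D.j_sq
    have hc := D.ij_comm
    have h1 : D.i * (D.i * D.j) = D.j := by rw [← mul_assoc, hi, one_mul]
    have h2 : D.j * (D.i * D.j) = D.i := by rw [hc, ← mul_assoc, hj, one_mul]
    have h3 : D.i * D.j * D.i = D.j := by rw [hc, mul_assoc, hi, mul_one]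
    have h4 : D.i * D.j * D.j = D.i := by rw [mul_assoc, hj, mul_one]
    have h5 : D.i * D.j * (D.i * D.j) = 1 := by rw [← mul_assoc, h3, hj]
    rintro a b (rfl | rfl | rfl | rfl) (rfl | rfl | rfl | rfl) <;>
      simp [hi, hj, h1, h2, h3, h4, h5, hc.symm]
  inv_mem' := by
    have hi := D.i_sq
    have hj := D.j_sq
    have hc := D.ij_comm
    rintro a (rfl | rfl | rfl | rfl)
    · simp
    · simp [inv_eq_of_mul_eq_one_left hi]
    · simp [inv_eq_of_mul_eq_one_left hj]
    · rw [mul_inv_rev, inv_eq_of_mul_eq_one_left hi, inv_eq_of_mul_eq_one_left hj]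
      simp [hc]

theorem mem_V {x : G} : x ∈ D.V ↔ x = 1 ∨ x = D.i ∨ x = D.j ∨ x = D.i * D.j := Iff.rfl

theorem ij_ne_one : D.i * D.j ≠ 1 := fun h => D.i_ne_j (by
  rw [eq_inv_of_mul_eq_one_left h, inv_eq_of_mul_eq_one_left D.j_sq])

theorem card_V : Nat.card D.V = 4 := by
  classical
  have : (D.V : Set G) = (({1, D.i, D.j, D.i * D.j} : Finset G) : Set G) := by
    ext; simp [mem_V]
  rw [← Subgroup.ncard_coe, this, Set.ncard_coe_finset]
  have h1 := D.i_ne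
  have h2 := D.j_ne
  have h3 := D.i_ne_j
  have h4 := D.ij_ne_one
  rw [Finset.card_insert_of_notMem, Finset.card_insert_of_notMem, Finset.card_insert_of_notMem,
    Finset.card_singleton]
  all_goals simp [h1.symm, h2.symm, h3, h4.symm, h1, h2]

theorem mul_self_of_mem_V {x : G} (hx : x ∈ D.V) : x * x = 1 := by
  have hi := D.i_sq
  have hj := D.j_sq
  rcases hx with rfl | rfl | rfl | rfl
  · simp
  · exact hi
  · exact hj
  · rw [mul_assoc, ← mul_assoc D.j, ← D.ij_comm, mul_assoc, hj, mul_one, hi]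

theorem commute_of_mem_V {x y : G} (hx : x ∈ D.V) (hy : y ∈ D.V) : x * y = y * x := by
  rw [mul_eq_one_iff_eq_inv.1 (D.mul_self_of_mem_V (D.V.mul_mem hx hy)), mul_inv_rev,
    ← mul_eq_one_iff_eq_inv.1 (D.mul_self_of_mem_V hx),
    ← mul_eq_one_iff_eq_inv.1 (D.mul_self_of_mem_V hy)]

/-- Every `2`-subgroup is contained in a conjugate of `V`. -/
theorem exists_conj_mem_V {Q : Subgroup G} (hQ : IsPGroup 2 Q) :
    ∃ g, ∀ x ∈ Q, g * x * g⁻¹ ∈ D.V := by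
  have := D.finite
  have : Fact (Nat.Prime 2) := ⟨Nat.prime_two⟩
  obtain ⟨P, hP⟩ := (IsPGroup.of_card (p := 2) (n := 2) D.card_V).exists_le_sylow
  -- V is itself a Sylow 2-subgroup, since 8 does not divide |G|; the claim is then Sylow conjugacy.
  have hPV : (P : Subgroup G) = D.V := by
    symm
    apply Subgroup.eq_of_le_of_card_ge hP
    rw [D.card_V]
    obtain ⟨m, hm⟩ := P.isPGroup'.exists_card_eq
    rw [hm]
    have : m ≤ 2 := by
      by_contra! h
      exact D.not_eight_dvd_card ((pow_dvd_pow 2 h).trans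
        (hm ▸ Subgroup.card_subgroup_dvd_card (P : Subgroup G)))
    exact Nat.pow_le_pow_right (by norm_num) this
  obtain ⟨R, hR⟩ := hQ.exists_le_sylow
  obtain ⟨g, hg⟩ := MulAction.exists_smul_eq G R P
  refine ⟨g, fun x hx => ?_⟩
  rw [← hPV, ← hg, Sylow.coe_subgroup_smul]
  exact Subgroup.smul_mem_pointwise_smul x (MulAut.conj g) _ (hR hx)

/-- The normalizer of the four-group `V`. -/
def A : Subgroup G := Subgroup.normalizer (D.V : Set G)

theorem mem_A_of_forall {g : G} (h : ∀ x ∈ D.V, g * x * g⁻¹ ∈ D.V) : g ∈ D.A := by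
  have := D.finite
  rw [A, Subgroup.mem_normalizer_iff]
  have h1 : MulAut.conj g • D.V = D.V :=
    Subgroup.eq_of_le_of_card_ge (Subgroup.conj_smul_le.2 h) (Subgroup.card_conj_smul _ _).ge
  intro x
  nth_rw 2 [← h1]
  rw [Subgroup.mem_conj_smul]
  simp [mul_assoc]

/-- In G, the centralizer of each nontrivial element of K is a conjugate torus. Elements normalizing
a torus but outside it are involutions, and K has none, so centralizers in K satisfy
`commute_of_centralizers_selfNormalizing`. Thus K is abelian and lies in the centralizer of any of
its nontrivial elements. -/
theorem odd_subgroup {K : Subgroup G} (hodd : Odd (Nat.card K)) (h3 : ¬ 3 ∣ Nat.card K) :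
    ∃ g, (∀ x ∈ K, g * x * g⁻¹ ∈ D.S) ∨ (∀ x ∈ K, g * x * g⁻¹ ∈ D.T) := by
  have := D.finite
  have hord {x : G} (hx : x ∈ K) : orderOf x ∣ Nat.card K := by
    simpa using orderOf_dvd_natCard (⟨x, hx⟩ : K)
  have hsq {x : G} (hx : x ∈ K) (h : x * x = 1) : x = 1 := by
    have h2 : orderOf x ∣ 2 := orderOf_dvd_of_pow_eq_one (by rw [pow_two, h])
    rw [← orderOf_eq_one_iff]
    refine Nat.eq_one_of_dvd_coprimes (hodd.coprime_two_left) h2 (hord hx)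
  have key {x : G} (hx : x ∈ K) (h1 : x ≠ 1) : ∃ g,
      ((g * x * g⁻¹ ∈ D.S) ∧ ∀ y, y * x = x * y ↔ g * y * g⁻¹ ∈ D.S) ∨
      ((g * x * g⁻¹ ∈ D.T) ∧ ∀ y, y * x = x * y ↔ g * y * g⁻¹ ∈ D.T) := by
    obtain ⟨g, h | h | h⟩ := D.cover x
    · have := D.orderOf_of_mem_U h (by rwa [Ne, conj_eq_one])
      rw [orderOf_conj] at this
      exact absurd (this ▸ hord hx) h3
    · refine ⟨g, .inl ⟨h, fun y => ?_⟩⟩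
      rw [← D.comm_S _ h (by rwa [Ne, conj_eq_one]), conj_commute]
    · refine ⟨g, .inr ⟨h, fun y => ?_⟩⟩
      rw [← D.comm_T _ h, conj_commute]
      rw [conj_pow, Ne, conj_eq_one, pow_two]
      exact fun h2 => h1 (hsq hx h2)
  rcases eq_or_ne K ⊥ with rfl | hK
  · exact ⟨1, .inl (by simp)⟩
  obtain ⟨x, hx, hx1⟩ := K.bot_or_exists_ne_one.resolve_left hK
  have hcomm : ∀ a b : K, a * b = b * a := by
    refine commute_of_centralizers_selfNormalizing hodd ?_
    rintro ⟨x, hx⟩ hx1 ⟨c, hc⟩ hc1 hcx ⟨g, hg⟩ hgc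
    simp only [ne_eq, Subgroup.mk_eq_one] at hx1 hc1
    have hcx' : c * x = x * c := congrArg Subtype.val hcx
    have hgc' : g * c * g⁻¹ * x = x * (g * c * g⁻¹) := congrArg Subtype.val hgc
    ext
    change g * x = x * g
    by_cases hg1 : g = 1
    · simp [hg1]
    obtain ⟨t, ⟨h, hiff⟩ | ⟨h, hiff⟩⟩ := key hx hx1
    · rw [hiff] at hcx' hgc' ⊢
      have h1 := D.conj_S_iff _ hcx' (by rwa [Ne, conj_eq_one]) (t * g * t⁻¹)
        (by convert hgc' using 1; group)
      by_contra h2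
      have := D.sq_NS _ h1 h2
      rw [← pow_two, conj_pow, conj_eq_one, pow_two] at this
      exact hg1 (hsq hg this)
    · rw [hiff] at hcx' hgc' ⊢
      have h1 := D.conj_T_iff _ hcx' (by rwa [Ne, conj_eq_one]) (t * g * t⁻¹)
        (by convert hgc' using 1; group)
      by_contra h2
      have := D.sq_NT _ h1 h2
      rw [← pow_two, conj_pow, conj_eq_one, pow_two] at this
      exact hg1 (hsq hg this)
  have hcomm' (y) (hy : y ∈ K) : y * x = x * y :=
    congrArg Subtype.val (hcomm ⟨y, hy⟩ ⟨x, hx⟩)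
  obtain ⟨g, ⟨h, hiff⟩ | ⟨h, hiff⟩⟩ := key hx hx1
  · exact ⟨g, .inl fun y hy => (hiff y).1 (hcomm' y hy)⟩
  · exact ⟨g, .inr fun y hy => (hiff y).1 (hcomm' y hy)⟩

/-- Every subgroup of order prime to `3` either is a `2`-group or normalizes a nontrivial odd
subgroup of a torus. -/
theorem exists_odd_normal {N : Subgroup G} (h3 : ¬ 3 ∣ Nat.card N) :
    ∃ K : Subgroup G, (∀ x, x ∈ K ↔ x ∈ N ∧ Odd (orderOf x)) ∧ Odd (Nat.card K) ∧
      ∃ d : ℕ, (d = 1 ∨ d = 2 ∨ d = 4) ∧ Nat.card K * d = Nat.card N := by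
  have := D.finite
  obtain ⟨K, hK, d, hd, hcard⟩ := exists_odd_complement h3 fun h =>
    D.not_eight_dvd_card (h.trans (Subgroup.card_subgroup_dvd_card N))
  have hc : Nat.card (K.map N.subtype) = Nat.card K :=
    Subgroup.card_map_of_injective N.subtype_injective
  refine ⟨K.map N.subtype, fun x => ?_, ?_, d, hd, by rw [hc, hcard]⟩
  · simp only [Subgroup.mem_map, Subgroup.subtype_apply, Subtype.exists, exists_and_right,
      exists_eq_right, hK, Subgroup.orderOf_mk]
    exact ⟨fun ⟨a, b⟩ => ⟨a, b⟩, fun ⟨a, b⟩ => ⟨a, b⟩⟩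
  · rw [hc, ← Nat.not_even_iff_odd, even_iff_two_dvd]
    intro h
    have : Fact (Nat.Prime 2) := ⟨Nat.prime_two⟩
    obtain ⟨x, hx⟩ := exists_prime_orderOf_dvd_card' (G := K) 2 h
    have h1 := (hK x).1 x.2
    rw [Subgroup.orderOf_coe, hx] at h1
    exact absurd h1 (by decide)

/-- A subgroup normalizing a nontrivial odd subgroup of order prime to `3` normalizes a torus. -/
theorem exists_conj_mem_of_normalizes {H K : Subgroup G} (hodd : Odd (Nat.card K))
    (h3 : ¬ 3 ∣ Nat.card K) (hK : K ≠ ⊥) (hH : ∀ h ∈ H, ∀ x ∈ K, h * x * h⁻¹ ∈ K) :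
    ∃ g, (∀ x ∈ H, g * x * g⁻¹ ∈ D.NS) ∨ (∀ x ∈ H, g * x * g⁻¹ ∈ D.NT) := by
  obtain ⟨x, hx, hx1⟩ := K.bot_or_exists_ne_one.resolve_left hK
  obtain ⟨g, h | h⟩ := D.odd_subgroup hodd h3
  · refine ⟨g, .inl fun y hy => D.conj_S_iff _ (h x hx) (by rwa [Ne, conj_eq_one]) _ ?_⟩
    convert h _ (hH y hy x hx) using 1
    group
  · refine ⟨g, .inr fun y hy => D.conj_T_iff _ (h x hx) (by rwa [Ne, conj_eq_one]) _ ?_⟩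
    convert h _ (hH y hy x hx) using 1
    group

theorem not_three_dvd_NS : ¬ 3 ∣ Nat.card D.NS := by
  have := D.three_dvd
  rw [D.card_NS]; omega

theorem not_three_dvd_NT : ¬ 3 ∣ Nat.card D.NT := by
  have := D.three_dvd
  rw [D.card_NT]; omega

/-- The elements of odd order form a normal subgroup K of H. If K is trivial, H is a 2-group and
lies in a conjugate of V; otherwise H normalizes K, hence a torus. -/
theorem exists_conj_mem_of_not_three_dvd {H : Subgroup G} (h3 : ¬ 3 ∣ Nat.card H) :
    ∃ g, (∀ x ∈ H, g * x * g⁻¹ ∈ D.NS) ∨ (∀ x ∈ H, g * x * g⁻¹ ∈ D.NT) ∨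
      (∀ x ∈ H, g * x * g⁻¹ ∈ D.A) := by
  have := D.finite
  obtain ⟨K, hK, hodd, d, hd, hcard⟩ := D.exists_odd_normal h3
  by_cases hb : K = ⊥
  · subst hb
    rw [Subgroup.card_bot, one_mul] at hcard
    obtain ⟨g, hg⟩ := D.exists_conj_mem_V (isPGroup_two_of_card hd hcard.symm)
    exact ⟨g, .inr (.inr fun x hx => Subgroup.le_normalizer (hg x hx))⟩
  · obtain ⟨g, hg⟩ := D.exists_conj_mem_of_normalizes (H := H) hodd
      (fun h => h3 (h.trans ⟨d, hcard.symm⟩)) hb fun h hh x hx => by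
        rw [hK] at hx ⊢
        exact ⟨H.mul_mem (H.mul_mem hh hx.1) (H.inv_mem hh), by rw [orderOf_conj]; exact hx.2⟩
    exact ⟨g, hg.imp id .inl⟩

/-- The main case. H ∩ U is a Sylow 3-subgroup of H contained in the centre of its normalizer, so H
has a normal 3-complement N; this turns out to be a four-group normalized by H. -/
theorem exists_conj_mem_of_mem_U {H : Subgroup G} (hH : H ≠ ⊤) {x : G} (hx : x ∈ H)
    (hxU : x ∈ D.U) (hx1 : x ≠ 1) (hHB : ¬ H ≤ D.B) : ∃ g, ∀ x ∈ H, g * x * g⁻¹ ∈ D.A := by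
  have := D.finite
  have : Fact (Nat.Prime 3) := ⟨Nat.prime_three⟩
  obtain ⟨h, hh, hhB⟩ := Set.not_subset.1 hHB
  -- An element of H ∩ B outside U would normalize H ∩ U ≠ 1, so `irred` would give U ≤ H; together
  -- with h ∉ B this generates G.
  have hHU : ∀ b ∈ H, b ∈ D.B → b ∈ D.U := by
    intro b hb hbB
    by_contra hbU
    refine hH (D.gen H ?_ h hh hhB)
    refine (D.irred (H ⊓ D.U) inf_le_right ?_ b hbB hbU ?_).trans inf_le_left
    · intro h1
      have : x ∈ H ⊓ D.U := ⟨hx, hxU⟩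
      rw [h1] at this
      exact hx1 (by simpa using this)
    · rintro y ⟨hy, hyU⟩
      exact ⟨H.mul_mem (H.mul_mem hb hy) (H.inv_mem hb), D.conj_U b hbB y hyU⟩
  let P : Subgroup H := D.U.subgroupOf H
  have hPmem (y : H) : y ∈ P ↔ (y : G) ∈ D.U := Iff.rfl
  have hP3 : IsPGroup 3 P := fun y => ⟨1, by
    ext; simpa using D.pow_three y.1.1 y.2⟩
  obtain ⟨Q, hQ⟩ := hP3.exists_le_sylow
  have hxQ : (⟨x, hx⟩ : H) ∈ Q := hQ hxU
  -- A nontrivial central element z of Q commutes with x, so z ∈ U; all of Q commutes with z, so Q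
  -- lies in U.
  have hQP : (Q : Subgroup H) = P := by
    refine le_antisymm (fun y hy => ?_) hQ
    have : Nontrivial Q := ⟨⟨⟨x, hx⟩, hxQ⟩, 1, fun h => hx1 (by simpa using congrArg (fun a : Q => ((a : H) : G)) h)⟩
    obtain ⟨⟨z, hz⟩, hz1⟩ := (nontrivial_iff_exists_ne 1).1 Q.isPGroup'.center_nontrivial
    rw [Subgroup.mem_center_iff] at hz
    have hz1' : ((z : H) : G) ≠ 1 := by
      intro h
      apply hz1
      ext
      simpa using h
    have hcomm (y : H) (hy : y ∈ Q) : (y : G) * ((z : H) : G) = ((z : H) : G) * y :=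
      congrArg (fun a : Q => ((a : H) : G)) (hz ⟨y, hy⟩)
    have hzU : ((z : H) : G) ∈ D.U :=
      (D.comm_U x hxU hx1 _).1 (hcomm ⟨x, hx⟩ hxQ).symm
    exact (D.comm_U _ hzU hz1' _).1 (hcomm y hy)
  -- The normalizer lies in B by `conj_U_iff`, hence in U by `hHU`, and U is abelian.
  have hnorm : Subgroup.normalizer (Q : Set H) ≤ Subgroup.centralizer (Q : Set H) := by
    intro y hy
    have h1 := (Subgroup.mem_normalizer_iff.1 hy ⟨x, hx⟩).1 hxQ
    rw [hQP] at h1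
    have hyU : (y : G) ∈ D.U := hHU y y.2 (D.conj_U_iff x hxU hx1 _ h1)
    rw [Subgroup.mem_centralizer_iff]
    intro v hv
    by_cases hy1 : y = 1
    · simp [hy1]
    have hvU : (v : G) ∈ D.U := by
      have : v ∈ (Q : Subgroup H) := hv
      rw [hQP] at this
      exact this
    ext
    exact (D.comm_U y hyU (by simpa using hy1) v).2 hvU
  obtain ⟨N, hN, hcard⟩ := Q.exists_complement hnorm
  have hN3 : ¬ 3 ∣ Nat.card N := by
    intro h
    obtain ⟨y, hy⟩ := exists_prime_orderOf_dvd_card' (G := N) 3 h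
    have := (hN y).1 y.2
    rw [Subgroup.orderOf_coe, hy] at this
    exact this dvd_rfl
  set N' : Subgroup G := N.map H.subtype with hN'
  have hcN' : Nat.card N' = Nat.card N := Subgroup.card_map_of_injective H.subtype_injective
  have hmem (y : G) : y ∈ N' ↔ y ∈ H ∧ ¬ 3 ∣ orderOf y := by
    simp only [hN', Subgroup.mem_map, Subgroup.subtype_apply, Subtype.exists, exists_and_right,
      exists_eq_right, hN, Subgroup.orderOf_mk]
    exact ⟨fun ⟨a, b⟩ => ⟨a, b⟩, fun ⟨a, b⟩ => ⟨a, b⟩⟩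
  have hnormal : ∀ h ∈ H, ∀ y ∈ N', h * y * h⁻¹ ∈ N' := by
    intro h hh y hy
    rw [hmem] at hy ⊢
    exact ⟨H.mul_mem (H.mul_mem hh hy.1) (H.inv_mem hh), by rw [orderOf_conj]; exact hy.2⟩
  obtain ⟨K, hK, hodd, d, hd, hcK⟩ := D.exists_odd_normal (N := N') (by rwa [hcN'])
  -- Otherwise H normalizes a torus, and 3 would divide the order of `NS` or `NT`.
  have hKbot : K = ⊥ := by
    by_contra hb
    obtain ⟨g, hg⟩ := D.exists_conj_mem_of_normalizes (H := H) hodd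
      (fun h => hN3 (hcN' ▸ h.trans ⟨d, hcK.symm⟩)) hb fun h hh x hx => by
        rw [hK] at hx ⊢
        exact ⟨hnormal h hh x hx.1, by rw [orderOf_conj]; exact hx.2⟩
    have h3 : 3 ∣ Nat.card H := by
      rw [← D.orderOf_of_mem_U hxU hx1]
      simpa using orderOf_dvd_natCard (⟨x, hx⟩ : H)
    rcases hg with hg | hg
    · exact Subgroup.not_dvd_card_of_conj_mem hg D.not_three_dvd_NS h3
    · exact Subgroup.not_dvd_card_of_conj_mem hg D.not_three_dvd_NT h3
  rw [hKbot, Subgroup.card_bot, one_mul] at hcK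
  obtain ⟨g, hg⟩ := D.exists_conj_mem_V (isPGroup_two_of_card hd hcK.symm)
  -- If |N| = 1, then H lies in U. If |N| = 2, then x centralizes an involution, against C(x) = U.
  -- If |N| = 4, then N is conjugate to V and H normalizes it.
  rcases hd with rfl | rfl | rfl
  · exfalso
    have htop : P = ⊤ := by
      rw [← hQP]
      apply Subgroup.eq_top_of_card_eq
      rw [← hcard, ← hcN', ← hcK, one_mul]
    refine hhB (D.U_le ?_)
    have : (⟨h, hh⟩ : H) ∈ P := by rw [htop]; trivial
    exact this
  · exfalso
    obtain ⟨y, hy⟩ := exists_prime_orderOf_dvd_card' (G := N') 2 (hcK ▸ dvd_rfl)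
    have hyN := y.2
    have hyo : orderOf (y : G) = 2 := by rw [Subgroup.orderOf_coe, hy]
    have hy1 : (y : G) ≠ 1 := by intro h; rw [h] at hyo; simp at hyo
    have hconj : x * y * x⁻¹ = y := by
      have h2 : Nat.card N' = 2 := hcK.symm
      rw [Nat.card_eq_two_iff' 1] at h2
      obtain ⟨v, -, hv⟩ := h2
      have e1 := hv y (by simpa using hy1)
      have e2 := hv ⟨x * y * x⁻¹, hnormal x hx _ hyN⟩ fun h =>
        hy1 (conj_eq_one.1 (congrArg Subtype.val h))
      exact congrArg Subtype.val (e2.trans e1.symm)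
    have hyU := (D.comm_U x hxU hx1 y).1 (by
      nth_rw 1 [← hconj]; group)
    have := D.orderOf_of_mem_U hyU hy1
    omega
  · refine ⟨g, fun y hy => D.mem_A_of_forall ?_⟩
    have heq : MulAut.conj g • N' = D.V := by
      apply Subgroup.eq_of_le_of_card_ge (Subgroup.conj_smul_le.2 hg)
      rw [Subgroup.card_conj_smul, ← hcK, D.card_V]
    intro v hv
    rw [← heq, Subgroup.mem_conj_smul] at hv
    have := hg _ (hnormal y hy _ hv)
    convert this using 1
    group

/-- **Classification of the subgroups of `PSL(2, 3 ^ p)`**. -/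
theorem exists_conj_mem {H : Subgroup G} (hH : H ≠ ⊤) :
    ∃ g, (∀ x ∈ H, g * x * g⁻¹ ∈ D.B) ∨ (∀ x ∈ H, g * x * g⁻¹ ∈ D.NS) ∨
      (∀ x ∈ H, g * x * g⁻¹ ∈ D.NT) ∨ (∀ x ∈ H, g * x * g⁻¹ ∈ D.A) := by
  have := D.finite
  by_cases h3 : 3 ∣ Nat.card H
  · have : Fact (Nat.Prime 3) := ⟨Nat.prime_three⟩
    obtain ⟨⟨x, hx⟩, hxo⟩ := exists_prime_orderOf_dvd_card' (G := H) 3 h3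
    rw [Subgroup.orderOf_mk] at hxo
    obtain ⟨g, hg⟩ := D.exists_conj_mem_U hxo
    by_cases hB : MulAut.conj g • H ≤ D.B
    · exact ⟨g, .inl (Subgroup.conj_smul_le.1 hB)⟩
    · have htop : MulAut.conj g • H ≠ ⊤ := by
        intro h
        apply hH
        apply Subgroup.eq_top_of_card_eq
        rw [← Subgroup.card_conj_smul g, h, Subgroup.card_top]
      have hxg : g * x * g⁻¹ ∈ MulAut.conj g • H := Subgroup.conj_smul_le.1 le_rfl x hx
      obtain ⟨t, ht⟩ := D.exists_conj_mem_of_mem_U htop hxg hg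
        (by rw [Ne, conj_eq_one]; rintro rfl; simp at hxo) hB
      refine ⟨t * g, .inr (.inr (.inr fun y hy => ?_))⟩
      convert ht _ (Subgroup.conj_smul_le.1 le_rfl y hy) using 1
      group
  · obtain ⟨g, hg⟩ := D.exists_conj_mem_of_not_three_dvd h3
    exact ⟨g, .inr hg⟩

end PSLTwoData

end Classification

/-! ### The four classes of maximal subgroups. -/

section MaximalSubgroups

open Pointwise

theorem mul_mem_of_card_eq_two_mul {G : Type*} [Group G] {C N : Subgroup G} [Finite N] (h : C ≤ N)
    (hcard : Nat.card N = 2 * Nat.card C) {a b : G} (ha : a ∈ N) (hb : b ∈ N) :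
    a * b ∈ C ↔ (a ∈ C ↔ b ∈ C) := by
  have hidx : (C.subgroupOf N).index = 2 := by
    have h1 := (C.subgroupOf N).card_mul_index
    rw [Nat.card_congr (Subgroup.subgroupOfEquivOfLe h).toEquiv, hcard, mul_comm 2] at h1
    have : Finite C := Finite.of_injective _ (Subgroup.inclusion_injective h)
    exact Nat.eq_of_mul_eq_mul_left Nat.card_pos h1
  simpa [Subgroup.mem_subgroupOf] using
    Subgroup.mul_mem_iff_of_index_two hidx (a := ⟨a, ha⟩) (b := ⟨b, hb⟩)

theorem IsCyclic.eq_of_mul_self_eq_one {G : Type*} [Group G] [Finite G] {C : Subgroup G}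
    (hC : IsCyclic C) {a b : G} (ha : a ∈ C) (hb : b ∈ C) (ha2 : a * a = 1) (hb2 : b * b = 1)
    (ha1 : a ≠ 1) (hb1 : b ≠ 1) : a = b := by
  classical
  have := Fintype.ofFinite C
  by_contra hab
  have h := IsCyclic.card_pow_eq_one_le (α := C) (n := 2) (by norm_num)
  have hsub : ({1, ⟨a, ha⟩, ⟨b, hb⟩} : Finset C) ⊆ Finset.univ.filter fun c : C => c ^ 2 = 1 := by
    intro c hc
    simp only [Finset.mem_insert, Finset.mem_singleton] at hc
    rcases hc with rfl | rfl | rfl <;> simp [pow_two, ha2, hb2]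
  have := (Finset.card_le_card hsub).trans h
  rw [Finset.card_insert_of_notMem, Finset.card_insert_of_notMem, Finset.card_singleton] at this
  · omega
  · simpa using hab
  · simp [← Subtype.coe_inj, ha1.symm, hb1.symm]

theorem orderOf_eq_two_iff_mul_self {G : Type*} [Group G] {x : G} :
    orderOf x = 2 ↔ x * x = 1 ∧ x ≠ 1 := by
  rw [orderOf_eq_prime_iff, pow_two]

namespace PSLTwoData

variable {G : Type*} [Group G] {q k : ℕ} (D : PSLTwoData G q k)

include D

theorem mul_mem_T {a b : G} (ha : a ∈ D.NT) (hb : b ∈ D.NT) : a * b ∈ D.T ↔ (a ∈ D.T ↔ b ∈ D.T) :=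
  have := D.finite
  mul_mem_of_card_eq_two_mul D.T_le (by rw [D.card_NT, D.card_T]; ring) ha hb

theorem mul_mem_S {a b : G} (ha : a ∈ D.NS) (hb : b ∈ D.NS) : a * b ∈ D.S ↔ (a ∈ D.S ↔ b ∈ D.S) :=
  have := D.finite
  mul_mem_of_card_eq_two_mul D.S_le_NS (by rw [D.card_NS, D.card_S]; ring) ha hb

theorem mul_comm_S {a b : G} (ha : a ∈ D.S) (hb : b ∈ D.S) : a * b = b * a := by
  have := D.cyclic_S
  exact congrArg Subtype.val ((IsCyclic.commGroup (α := D.S)).mul_comm ⟨a, ha⟩ ⟨b, hb⟩)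

theorem mul_comm_T {a b : G} (ha : a ∈ D.T) (hb : b ∈ D.T) : a * b = b * a := by
  have := D.cyclic_T
  exact congrArg Subtype.val ((IsCyclic.commGroup (α := D.T)).mul_comm ⟨a, ha⟩ ⟨b, hb⟩)

/-- Both a and a b lie outside S and so square to 1. -/
theorem conj_eq_inv_S {a b : G} (ha : a ∈ D.NS) (haS : a ∉ D.S) (hb : b ∈ D.S) :
    a * b * a⁻¹ = b⁻¹ := by
  have h1 := D.sq_NS _ (D.NS.mul_mem ha (D.S_le_NS hb)) (by
    rw [D.mul_mem_S ha (D.S_le_NS hb)]; tauto)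
  rw [← mul_eq_one_iff_eq_inv.1 (D.sq_NS a ha haS), ← mul_eq_one_iff_eq_inv, ← h1]
  group

theorem conj_eq_inv_T {a b : G} (ha : a ∈ D.NT) (haT : a ∉ D.T) (hb : b ∈ D.T) :
    a * b * a⁻¹ = b⁻¹ := by
  have h1 := D.sq_NT _ (D.NT.mul_mem ha (D.T_le hb)) (by
    rw [D.mul_mem_T ha (D.T_le hb)]; tauto)
  rw [← mul_eq_one_iff_eq_inv.1 (D.sq_NT a ha haT), ← mul_eq_one_iff_eq_inv, ← h1]
  group

theorem w_notMem_S : D.w ∉ D.S := fun h => D.w_notMem (D.S_le h)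

theorem exists_conj_mem_T {x : G} (hx : orderOf x = 2) : ∃ g, g * x * g⁻¹ ∈ D.T := by
  obtain ⟨g, h | h | h⟩ := D.cover x
  · have h1 := D.orderOf_of_mem_U h (by rw [Ne, conj_eq_one]; rintro rfl; simp at hx)
    rw [orderOf_conj] at h1
    omega
  · have := D.orderOf_dvd_of_mem_S h
    rw [orderOf_conj, hx] at this
    omega
  · exact ⟨g, h⟩

theorem orderOf_i : orderOf D.i = 2 := orderOf_eq_two_iff_mul_self.2 ⟨D.i_sq, D.i_ne⟩

theorem u_ne_one : D.u ≠ 1 := by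
  intro h
  have := D.conj_i
  rw [h] at this
  exact D.i_ne_j (by simpa using this)

theorem orderOf_u : orderOf D.u = 3 := orderOf_eq_prime D.u_cube D.u_ne_one

theorem i_mem_V : D.i ∈ D.V := by simp [mem_V]

theorem j_mem_V : D.j ∈ D.V := by simp [mem_V]

theorem u_mem_A : D.u ∈ D.A := by
  refine D.mem_A_of_forall ?_
  have h3 : D.u * (D.i * D.j) * D.u⁻¹ = D.i := by
    have : D.u * (D.i * D.j) * D.u⁻¹ = (D.u * D.i * D.u⁻¹) * (D.u * D.j * D.u⁻¹) := by group
    rw [this, D.conj_i, D.conj_j, D.ij_comm, ← mul_assoc, D.j_sq, one_mul]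
  rintro x (rfl | rfl | rfl | rfl)
  · simp
  · simp [D.conj_i, D.j_mem_V]
  · simp [mem_V, D.conj_j]
  · simp [mem_V, h3]

theorem V_le_A : D.V ≤ D.A := Subgroup.le_normalizer

/-- The four-group `V` is its own centralizer. -/
theorem mem_V_of_commute {x : G} (hi : x * D.i = D.i * x) (hj : x * D.j = D.j * x) : x ∈ D.V := by
  have := D.finite
  obtain ⟨g, hg⟩ := D.exists_conj_mem_T D.orderOf_i
  set c : G → G := fun y => g * y * g⁻¹ with hc
  have cmul (a b) : c (a * b) = c a * c b := by simp [hc, mul_assoc]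
  have cinj {a b} (h : c a = c b) : a = b := by simpa [hc] using h
  have c1 : c 1 = 1 := by simp [hc]
  have hgi : c D.i ≠ 1 := fun h => D.i_ne (cinj (h.trans c1.symm))
  have hi2 : c D.i * c D.i = 1 := by rw [← cmul, D.i_sq, c1]
  -- After conjugating i into T by c, the centralizer of i lands in `NT`, while j lands outside T,
  -- because the cyclic group T has only one involution.
  have hNT {y : G} (hy : y * D.i = D.i * y) : c y ∈ D.NT := by
    refine D.conj_T_iff _ hg hgi _ ?_
    have : c y * c D.i * (c y)⁻¹ = c D.i := by
      rw [← cmul, hy, cmul]; group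
    change c y * c D.i * (c y)⁻¹ ∈ D.T
    rw [this]
    exact hg
  have huniq {y : G} (hy : c y ∈ D.T) (hy2 : y * y = 1) : y = 1 ∨ y = D.i := by
    by_cases h1 : y = 1
    · exact .inl h1
    · exact .inr (cinj (D.cyclic_T.eq_of_mul_self_eq_one hy hg (by rw [← cmul, hy2, c1]) hi2
        (fun h => h1 (cinj (h.trans c1.symm))) hgi))
  have hjT : c D.j ∉ D.T := fun h => by
    rcases huniq h D.j_sq with h | h
    · exact D.j_ne h
    · exact D.i_ne_j h.symm
  have hjNT : c D.j ∈ D.NT := hNT D.ij_comm.symm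
  -- The product y j is outside T, so (y j)² = 1; as y and j commute, y² = 1.
  have key {y : G} (hy : y * D.i = D.i * y) (hyj : y * D.j = D.j * y) (hyT : c y ∈ D.T) :
      y = 1 ∨ y = D.i := by
    refine huniq hyT ?_
    have h1 := D.sq_NT (c (y * D.j)) (by rw [cmul]; exact D.NT.mul_mem (hNT hy) hjNT)
      (by rw [cmul, D.mul_mem_T (hNT hy) hjNT]; tauto)
    rw [← cmul, ← c1] at h1
    have h2 := cinj h1
    calc y * y = y * (y * D.j) * D.j := by rw [mul_assoc y, mul_assoc y, D.j_sq, mul_one]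
      _ = y * D.j * (y * D.j) := by
         rw [mul_assoc y D.j (y * D.j), ← mul_assoc D.j y, ← hyj]; simp only [mul_assoc]
      _ = 1 := h2
  rw [mem_V]
  by_cases hxT : c x ∈ D.T
  · rcases key hi hj hxT with h | h
    · exact .inl h
    · exact .inr (.inl h)
  -- T has index 2 in `NT`, so x j lies in T when x does not.
  · have h1 := key (y := x * D.j) (by rw [mul_assoc, ← D.ij_comm, ← mul_assoc, hi, mul_assoc])
      (by rw [hj, mul_assoc, hj]) (by rw [cmul, D.mul_mem_T (hNT hi) hjNT]; tauto)
    have hx : x = x * D.j * D.j := by rw [mul_assoc, D.j_sq, mul_one]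
    rcases h1 with h | h
    · rw [h, one_mul] at hx; exact .inr (.inr (.inl hx))
    · rw [h] at hx; exact .inr (.inr (.inr hx))

/-- V is self-centralizing and |Aut V| divides 6, so |A| divides 24; it is divisible by |V| = 4 and
by |u| = 3, but not by 8. -/
theorem card_A : Nat.card D.A = 12 := by
  have := D.finite
  have h4 : 4 ∣ Nat.card D.A := D.card_V ▸ Subgroup.card_dvd_of_le D.V_le_A
  have h3 : 3 ∣ Nat.card D.A := by
    rw [← D.orderOf_u]
    simpa using orderOf_dvd_natCard (⟨D.u, D.u_mem_A⟩ : D.A)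
  have h24 : Nat.card D.A ∣ 24 := by
    rw [show Nat.card D.A = _ from D.V.normalizerMonoidHom.ker.card_mul_index.symm]
    refine mul_dvd_mul (b := 4) (d := 6) ?_ ?_
    · rw [← D.card_V, Subgroup.normalizerMonoidHom_ker]
      have : (Subgroup.centralizer (D.V : Set G)).subgroupOf D.A ≤ D.V.subgroupOf D.A := by
        intro x hx
        rw [Subgroup.mem_subgroupOf, Subgroup.mem_centralizer_iff] at hx
        exact D.mem_V_of_commute (hx _ D.i_mem_V).symm (hx _ D.j_mem_V).symm
      exact (Subgroup.card_dvd_of_le this).trans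
        (Nat.card_congr (Subgroup.subgroupOfEquivOfLe D.V_le_A).toEquiv).dvd
    · rw [Subgroup.index_ker]
      refine (Subgroup.card_subgroup_dvd_card _).trans (card_mulAut_dvd.trans ?_)
      rw [D.card_V]
      rfl
  have h8 : ¬ 8 ∣ Nat.card D.A := fun h =>
    D.not_eight_dvd_card (h.trans (Subgroup.card_subgroup_dvd_card _))
  have hle := Nat.le_of_dvd (by norm_num) h24
  generalize Nat.card D.A = n at *
  omega

/-- V is normal of index 3 in A, so x = x³ ∈ V. -/
theorem mem_V_of_mem_A {x : G} (hx : x ∈ D.A) (h2 : x * x = 1) : x ∈ D.V := by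
  have := D.finite
  by_contra hxV
  have hidx : (D.V.subgroupOf D.A).index = 3 := by
    have h1 := (D.V.subgroupOf D.A).card_mul_index
    rw [Nat.card_congr (Subgroup.subgroupOfEquivOfLe D.V_le_A).toEquiv, D.card_V, D.card_A] at h1
    omega
  have : (D.V.subgroupOf D.A).Normal := Subgroup.normal_in_normalizer
  have h3 := (D.V.subgroupOf D.A).pow_index_mem ⟨x, hx⟩
  rw [hidx, Subgroup.mem_subgroupOf] at h3
  apply hxV
  convert h3 using 1
  simp [pow_succ, h2]

/-- With k = 3m the tori have orders 12m + 1 and 12m + 2, so an element of a torus whose order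
divides 12 has order 1 or 2. -/
theorem orderOf_of_mem_A {x : G} (hx : x ∈ D.A) (hxV : x ∉ D.V) : orderOf x = 3 := by
  have := D.finite
  have h12 : orderOf x ∣ 12 := by
    rw [← D.card_A]
    simpa using orderOf_dvd_natCard (⟨x, hx⟩ : D.A)
  have hx1 : x ≠ 1 := by rintro rfl; exact hxV D.V.one_mem
  have h3 := D.three_dvd
  obtain ⟨g, h | h | h⟩ := D.cover x
  · simpa [orderOf_conj] using D.orderOf_of_mem_U h (by rwa [Ne, conj_eq_one])
  · exfalso
    have h1 := D.orderOf_dvd_of_mem_S h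
    rw [orderOf_conj] at h1
    obtain ⟨m, rfl⟩ := h3
    rw [show 4 * (3 * m) + 1 = 12 * m + 1 by ring] at h1
    exact hx1 (orderOf_eq_one_iff.1 (Nat.dvd_one.1 ((Nat.dvd_add_right (h12.mul_right m)).1 h1)))
  · exfalso
    have h1 := D.orderOf_dvd_of_mem_T h
    rw [orderOf_conj] at h1
    obtain ⟨m, rfl⟩ := h3
    have h2 : orderOf x ∣ 2 := by
      rw [show 4 * (3 * m) + 2 = 12 * m + 2 by ring] at h1
      exact (Nat.dvd_add_right (h12.mul_right m)).1 h1
    refine hxV (D.mem_V_of_mem_A hx ?_)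
    rw [← pow_two]
    exact orderOf_dvd_iff_pow_eq_one.1 h2

/-- U is normal in B of index 4k + 1 ≡ 1 mod 3, so x = x^(4k+1) ∈ U. -/
theorem mem_U_of_mem_B {x : G} (hx : x ∈ D.B) (h3 : x ^ 3 = 1) : x ∈ D.U := by
  have := D.finite
  have hidx : (D.U.subgroupOf D.B).index = 4 * k + 1 := by
    have h1 := (D.U.subgroupOf D.B).card_mul_index
    rw [Nat.card_congr (Subgroup.subgroupOfEquivOfLe D.U_le).toEquiv, D.card_B, D.card_U] at h1
    exact Nat.eq_of_mul_eq_mul_left (by rw [D.q_eq]; omega) h1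
  have : (D.U.subgroupOf D.B).Normal := ⟨fun y hy g => D.conj_U g g.2 y hy⟩
  have h := (D.U.subgroupOf D.B).pow_index_mem ⟨x, hx⟩
  rw [hidx, Subgroup.mem_subgroupOf] at h
  obtain ⟨m, hm⟩ := D.three_dvd
  convert h using 1
  change x = x ^ (4 * k + 1)
  rw [hm, show 4 * (3 * m) + 1 = 3 * (4 * m) + 1 by ring, pow_succ, pow_mul, h3, one_pow, one_mul]

/-- Representatives of the conjugacy classes of maximal subgroups. -/
def maxl : Fin 4 → Subgroup G := ![D.B, D.NS, D.NT, D.A]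

theorem card_maxl : ∀ a, Nat.card (D.maxl a) =
    (![q * (4 * k + 1), 8 * k + 2, 8 * k + 4, 12] : Fin 4 → ℕ) a
  | 0 => D.card_B
  | 1 => D.card_NS
  | 2 => D.card_NT
  | 3 => D.card_A

theorem maxl_ne_top (a : Fin 4) : D.maxl a ≠ ⊤ := by
  intro h
  have h1 := D.card_maxl a
  rw [h, Subgroup.card_top, D.card, D.q_eq] at h1
  have h3 := D.three_le
  have hB : 8 * k + 4 < (8 * k + 3) * (4 * k + 1) := by nlinarith
  have hG : (8 * k + 3) * (4 * k + 1) * 2 ≤ (8 * k + 3) * (4 * k + 1) * (8 * k + 4) :=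
    Nat.mul_le_mul_left _ (by omega)
  fin_cases a <;> simp at h1 <;> omega

/-- This excludes containments between conjugates of different classes, and lets the order of a
maximal subgroup determine its class. -/
theorem eq_of_card_dvd {a b : Fin 4} (h : Nat.card (D.maxl a) ∣ Nat.card (D.maxl b)) : a = b := by
  have := D.finite
  have hle := Nat.le_of_dvd Nat.card_pos h
  have h3 := D.three_le
  obtain ⟨m, hm⟩ := D.three_dvd
  rw [D.card_maxl, D.card_maxl] at h hle
  have hB : 8 * k + 4 < q * (4 * k + 1) := by rw [D.q_eq]; nlinarith
  have hodd : ¬ 2 ∣ q * (4 * k + 1) :=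
    (D.odd_q.mul (⟨2 * k, by ring⟩ : Odd (4 * k + 1))).not_two_dvd_nat
  fin_cases a <;> fin_cases b <;> simp at h hle ⊢ <;> try omega
  · exact hodd (dvd_trans ⟨4 * k + 1, by ring⟩ h)
  · have := (Nat.dvd_add_right (dvd_refl (8 * k + 2))).1 (show 8 * k + 2 ∣ 8 * k + 2 + 2 from h)
    have := Nat.le_of_dvd (by norm_num) this
    omega
  · exact hodd (dvd_trans ⟨4 * k + 2, by ring⟩ h)

theorem exists_le_maxl {H : Subgroup G} (hH : H ≠ ⊤) : ∃ (a : Fin 4) (g : G),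
    H ≤ MulAut.conj g • D.maxl a := by
  obtain ⟨g, h⟩ := D.exists_conj_mem hH
  have key (X : Subgroup G) (h : ∀ x ∈ H, g * x * g⁻¹ ∈ X) : H ≤ MulAut.conj g⁻¹ • X := by
    intro x hx
    rw [Subgroup.mem_conj_smul, inv_inv]
    exact h x hx
  rcases h with h | h | h | h
  · exact ⟨0, g⁻¹, key _ h⟩
  · exact ⟨1, g⁻¹, key _ h⟩
  · exact ⟨2, g⁻¹, key _ h⟩
  · exact ⟨3, g⁻¹, key _ h⟩

theorem conj_maxl_ne_top (g : G) (a : Fin 4) : MulAut.conj g • D.maxl a ≠ ⊤ := by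
  have := D.finite
  intro h
  apply D.maxl_ne_top a
  apply Subgroup.eq_top_of_card_eq
  rw [← Subgroup.card_conj_smul g, h, Subgroup.card_top]

/-- A proper overgroup of a conjugate would lie in another conjugate of a representative;
divisibility of orders forces the same class, hence equality. -/
theorem isCoatom_iff {M : Subgroup G} : IsCoatom M ↔ ∃ (a : Fin 4) (g : G), M = MulAut.conj g • D.maxl a := by
  have := D.finite
  constructor
  · intro hM
    obtain ⟨a, g, h⟩ := D.exists_le_maxl hM.1
    exact ⟨a, g, ((hM.le_iff.1 h).resolve_left (D.conj_maxl_ne_top g a)).symm⟩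
  · rintro ⟨a, g, rfl⟩
    refine ⟨D.conj_maxl_ne_top g a, fun H hH => ?_⟩
    by_contra hne
    obtain ⟨b, t, h⟩ := D.exists_le_maxl hne
    have hlt := hH.trans_le h
    have hab : a = b := by
      apply D.eq_of_card_dvd
      rw [← Subgroup.card_conj_smul g, ← Subgroup.card_conj_smul t (D.maxl b)]
      exact Subgroup.card_dvd_of_le hlt.le
    subst hab
    refine hlt.ne (Subgroup.eq_of_le_of_card_ge hlt.le ?_)
    rw [Subgroup.card_conj_smul, Subgroup.card_conj_smul]

/-- The self-normalizing hypothesis of `ncard_conjugates_over`. Orders of elements show that g sends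
a suitable nontrivial element of U, S or T back into that subgroup, or V into itself, and the fusion
axioms or the definition of A apply. -/
theorem mem_maxl_of_normalizes : ∀ (a : Fin 4) (g : G), (∀ x ∈ D.maxl a, g * x * g⁻¹ ∈ D.maxl a) →
    g ∈ D.maxl a
  | 0, g, h => by
    have := D.finite
    have hU : D.U ≠ ⊥ := by
      rw [← Subgroup.one_lt_card_iff_ne_bot, D.card_U, D.q_eq]; omega
    obtain ⟨x, hx, hx1⟩ := D.U.bot_or_exists_ne_one.resolve_left hU
    refine D.conj_U_iff x hx hx1 g (D.mem_U_of_mem_B (h x (D.U_le hx)) ?_)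
    rw [conj_pow, D.pow_three x hx]; simp
  | 1, g, h => by
    have := D.finite
    have hS : D.S ≠ ⊥ := by
      have := D.three_le
      rw [← Subgroup.one_lt_card_iff_ne_bot, D.card_S]; omega
    obtain ⟨x, hx, hx1⟩ := D.S.bot_or_exists_ne_one.resolve_left hS
    refine D.conj_S_iff x hx hx1 g ?_
    by_contra hn
    have h2 := D.sq_NS _ (h x (D.S_le_NS hx)) hn
    have h3 := orderOf_eq_two_iff_mul_self.2 ⟨h2, by rwa [Ne, conj_eq_one]⟩
    rw [orderOf_conj] at h3
    have h4 := D.orderOf_dvd_of_mem_S hx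
    rw [h3] at h4
    omega
  | 2, g, h => by
    have := D.finite
    have := D.cyclic_T
    -- T contains an involution, which could fuse to one outside T; a generator has order 4k + 2 > 2
    -- and cannot.
    obtain ⟨⟨x, hx⟩, hxo⟩ := IsCyclic.exists_ofOrder_eq_natCard (α := D.T)
    rw [Subgroup.orderOf_mk, D.card_T] at hxo
    have h3 := D.three_le
    have hx1 : x ≠ 1 := by rintro rfl; simp at hxo
    refine D.conj_T_iff x hx hx1 g ?_
    by_contra hn
    have h2 := D.sq_NT _ (h x (D.T_le hx)) hn
    have h3 := orderOf_eq_two_iff_mul_self.2 ⟨h2, by rwa [Ne, conj_eq_one]⟩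
    rw [orderOf_conj] at h3
    omega
  | 3, g, h => D.mem_A_of_forall fun x hx => by
    refine D.mem_V_of_mem_A (h x (D.V_le_A hx)) ?_
    rw [← pow_two, conj_pow, pow_two, D.mul_self_of_mem_V hx]
    simp

theorem nonempty_A_mulEquiv : Nonempty (D.A ≃* alternatingGroup (Fin 4)) := by
  have := D.finite
  let u' : D.A := ⟨D.u, D.u_mem_A⟩
  refine nonempty_mulEquiv_alternatingGroup_four D.card_A (P := Subgroup.zpowers u') ?_ ?_
  · rw [Nat.card_zpowers, Subgroup.orderOf_mk, D.orderOf_u]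
  · by_contra hne
    have hle := (Subgroup.zpowers u').normalCore_le
    have hc : Nat.card (Subgroup.zpowers u') = 3 := by
      rw [Nat.card_zpowers, Subgroup.orderOf_mk, D.orderOf_u]
    have heq : (Subgroup.zpowers u').normalCore = Subgroup.zpowers u' := by
      apply Subgroup.eq_of_le_of_card_ge hle
      have h1 := Subgroup.card_dvd_of_le hle
      rw [hc] at h1 ⊢
      rcases (Nat.dvd_prime Nat.prime_three).1 h1 with h | h
      · exact absurd (Subgroup.card_eq_one.1 h) hne
      · exact h.ge
    let i' : D.A := ⟨D.i, D.V_le_A D.i_mem_V⟩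
    have h1 : i' * u' * i'⁻¹ ∈ Subgroup.zpowers u' := by
      rw [← heq]
      refine (Subgroup.normalCore_normal _).conj_mem _ ?_ _
      rw [heq]
      exact Subgroup.mem_zpowers u'
    have h2 := Subgroup.mul_mem _ h1 (Subgroup.inv_mem _ (Subgroup.mem_zpowers u'))
    -- If ⟨u⟩ were normal, it would contain this commutator, which has order 2.
    have h3 : ((i' * u' * i'⁻¹ * u'⁻¹ : D.A) : G) = D.i * D.j := by
      change D.i * D.u * D.i⁻¹ * D.u⁻¹ = D.i * D.j
      rw [← D.conj_i, ← mul_eq_one_iff_eq_inv.1 D.i_sq]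
      group
    have h4 := Subgroup.orderOf_dvd_natCard _ h2
    rw [hc, ← Subgroup.orderOf_coe, h3, orderOf_eq_two_iff_mul_self.2
      ⟨D.mul_self_of_mem_V (D.V.mul_mem D.i_mem_V D.j_mem_V), D.ij_ne_one⟩] at h4
    omega

theorem nonempty_NS_mulEquiv : Nonempty (D.NS ≃* DihedralGroup (4 * k + 1)) := by
  have := D.finite
  have hc : Nat.card (D.S.subgroupOf D.NS) = 4 * k + 1 := by
    rw [Nat.card_congr (Subgroup.subgroupOfEquivOfLe D.S_le_NS).toEquiv, D.card_S]
  have := D.cyclic_S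
  refine nonempty_mulEquiv_dihedralGroup (by omega)
    ((Subgroup.subgroupOfEquivOfLe D.S_le_NS).isCyclic.2 D.cyclic_S) hc
    (by rw [D.card_NS]; ring) fun g hg => ?_
  ext
  exact D.sq_NS g g.2 hg

theorem nonempty_NT_mulEquiv : Nonempty (D.NT ≃* DihedralGroup (4 * k + 2)) := by
  have := D.finite
  have hc : Nat.card (D.T.subgroupOf D.NT) = 4 * k + 2 := by
    rw [Nat.card_congr (Subgroup.subgroupOfEquivOfLe D.T_le).toEquiv, D.card_T]
  refine nonempty_mulEquiv_dihedralGroup (by omega)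
    ((Subgroup.subgroupOfEquivOfLe D.T_le).isCyclic.2 D.cyclic_T) hc
    (by rw [D.card_NT]; ring) fun g hg => ?_
  ext
  exact D.sq_NT g g.2 hg

end PSLTwoData

end MaximalSubgroups

/-! ### Counting the maximal subgroups over an element. -/

section Counting

open Pointwise

theorem centralizer_eq_conj_smul {G : Type*} [Group G] {C : Subgroup G} {g x : G}
    (h : ∀ y, y * (g * x * g⁻¹) = g * x * g⁻¹ * y ↔ y ∈ C) :
    Subgroup.centralizer {x} = MulAut.conj g⁻¹ • C := by
  ext y
  rw [Subgroup.mem_centralizer_singleton_iff, Subgroup.mem_conj_smul, inv_inv, ← h, conj_commute]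

theorem card_centralizer_eq {G : Type*} [Group G] {C : Subgroup G} {g x : G}
    (h : ∀ y, y * (g * x * g⁻¹) = g * x * g⁻¹ * y ↔ y ∈ C) :
    Nat.card (Subgroup.centralizer {x}) = Nat.card C := by
  rw [centralizer_eq_conj_smul h, Subgroup.card_conj_smul]

/-- Elements conjugate to a torus element within the normalizer of that torus. -/
theorem ncard_isConj_of_torus {G : Type*} [Group G] {C N : Subgroup G} {g x n : G} (hx : g * x * g⁻¹ ∈ C)
    (hx2 : ¬ x * x = 1) (hCN : C ≤ N) (hinv : ∀ a ∈ N, a ∉ C → ∀ b ∈ C, a * b * a⁻¹ = b⁻¹)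
    (hcomm : ∀ a ∈ C, ∀ b ∈ C, a * b = b * a)
    (hsq : ∀ a ∈ N, a ∉ C → a * a = 1)
    (hnorm : ∀ a ∈ C, a ≠ 1 → ∀ h, h * a * h⁻¹ ∈ C → h ∈ N) (hn : n ∈ N) (hnC : n ∉ C) :
    {y | y ∈ N ∧ IsConj x y}.ncard = 2 := by
  set z := g * x * g⁻¹ with hz
  have hconj : ∀ y, IsConj x y ↔ IsConj z y := fun y => by
    have : IsConj x z := isConj_iff.2 ⟨g, rfl⟩
    exact ⟨fun h => this.symm.trans h, fun h => this.trans h⟩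
  have hz2 : z * z ≠ 1 := by
    rw [hz, ← pow_two, conj_pow, Ne, conj_eq_one, pow_two]; exact hx2
  have hz1 : z ≠ 1 := by intro h; rw [h] at hz2; simp at hz2
  rw [Set.ncard_eq_two]
  -- Conjugates of z in N stay in C, since those outside square to 1; fusion in C is controlled by
  -- N, which acts on C trivially or by inversion.
  refine ⟨z, z⁻¹, fun h => hz2 (mul_eq_one_iff_eq_inv.2 h), ?_⟩
  ext y
  simp only [Set.mem_ofPred_eq, Set.mem_insert_iff, Set.mem_singleton_iff, hconj]
  constructor
  · rintro ⟨hyN, hy⟩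
    obtain ⟨c, rfl⟩ := isConj_iff.1 hy
    have hyC : c * z * c⁻¹ ∈ C := by
      by_contra hyC
      have := hsq _ hyN hyC
      rw [← pow_two, conj_pow, conj_eq_one, pow_two] at this
      exact hz2 this
    have hc := hnorm z hx hz1 c hyC
    by_cases hcC : c ∈ C
    · left; rw [hcomm c hcC z hx, mul_inv_cancel_right]
    · right; exact hinv c hc hcC z hx
  · rintro (rfl | rfl)
    · exact ⟨hCN hx, IsConj.refl _⟩
    · exact ⟨hCN (C.inv_mem hx), isConj_iff.2 ⟨n, hinv n hn hnC z hx⟩⟩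

namespace PSLTwoData

variable {G : Type*} [Group G] {q k : ℕ} (D : PSLTwoData G q k)

/-- The maximal subgroups of the class number `a` that contain `x`. -/
def maxlOver (a : Fin 4) (x : G) : Set (Subgroup G) :=
  {M | x ∈ M ∧ ∃ g : G, M = MulAut.conj g • D.maxl a}

include D

theorem mem_maximalOver {x : G} {M : Subgroup G} : M ∈ maximalOver x ↔ ∃ a, M ∈ D.maxlOver a x := by
  rw [maximalOver, Set.mem_ofPred_eq, D.isCoatom_iff]
  exact ⟨fun ⟨⟨a, g, h⟩, hx⟩ => ⟨a, hx, g, h⟩, fun ⟨a, hx, g, h⟩ => ⟨⟨a, g, h⟩, hx⟩⟩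

theorem card_of_mem_over {a : Fin 4} {x : G} {M : Subgroup G} (h : M ∈ D.maxlOver a x) :
    Nat.card M = Nat.card (D.maxl a) := by
  obtain ⟨-, g, rfl⟩ := h
  exact Subgroup.card_conj_smul _ _

theorem eq_of_mem_over {a b : Fin 4} {x y : G} {M : Subgroup G} (h : M ∈ D.maxlOver a x)
    (h' : M ∈ D.maxlOver b y) : a = b :=
  D.eq_of_card_dvd (by rw [← D.card_of_mem_over h, D.card_of_mem_over h'])

theorem maximalCount_eq (a : Fin 4) {H : Type} [Group H] (e : Nonempty (D.maxl a ≃* H)) (x : G) :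
    maximalCount x H = (D.maxlOver a x).ncard := by
  rw [maximalCount]
  congr 1
  ext M
  rw [Set.mem_ofPred_eq, D.mem_maximalOver]
  obtain ⟨e⟩ := e
  constructor
  · rintro ⟨⟨b, hb⟩, ⟨f⟩⟩
    have : b = a := D.eq_of_card_dvd (by
      rw [← D.card_of_mem_over hb, Nat.card_congr (f.trans e.symm).toEquiv])
    exact this ▸ hb
  · intro h
    refine ⟨⟨a, h⟩, ?_⟩
    obtain ⟨-, g, rfl⟩ := h
    exact ⟨(Subgroup.equivSMul (MulAut.conj g) _).symm.trans e⟩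

theorem ncard_over_mul (a : Fin 4) (x : G) : (D.maxlOver a x).ncard * Nat.card (D.maxl a) =
    {y | y ∈ D.maxl a ∧ IsConj x y}.ncard * Nat.card (Subgroup.centralizer {x}) :=
  have := D.finite
  ncard_conjugates_over _ (D.mem_maxl_of_normalizes a) x

theorem over_eq_empty {a : Fin 4} {x : G} (h : ¬ orderOf x ∣ Nat.card (D.maxl a)) :
    D.maxlOver a x = ∅ := by
  refine Set.eq_empty_of_forall_notMem fun M hM => h ?_
  rw [← D.card_of_mem_over hM]
  simpa using orderOf_dvd_natCard (⟨x, hM.1⟩ : M)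

/-- `NT` acts on T by identity or inversion, both of which fix t. -/
theorem comm_involution {t : G} (ht : t ∈ D.T) (ht2 : orderOf t = 2) (y : G) :
    y * t = t * y ↔ y ∈ D.NT := by
  rw [orderOf_eq_two_iff_mul_self] at ht2
  constructor
  · intro h
    refine D.conj_T_iff t ht ht2.2 y ?_
    rw [h]
    simpa using ht
  · intro h
    by_cases hy : y ∈ D.T
    · exact D.mul_comm_T hy ht
    · have := D.conj_eq_inv_T h hy ht
      rw [← mul_eq_one_iff_eq_inv.1 ht2.1] at this
      rw [← mul_inv_eq_iff_eq_mul, this]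

/-- Every involution is conjugate into the cyclic group T, which has only one. -/
theorem isConj_iff_of_orderOf_two {x y : G} (hx : orderOf x = 2) : IsConj x y ↔ orderOf y = 2 := by
  have := D.finite
  constructor
  · rw [isConj_iff]
    rintro ⟨c, rfl⟩
    rw [orderOf_conj, hx]
  · intro hy
    obtain ⟨g, hg⟩ := D.exists_conj_mem_T hx
    obtain ⟨h, hh⟩ := D.exists_conj_mem_T hy
    rw [← orderOf_conj g, orderOf_eq_two_iff_mul_self] at hx
    rw [← orderOf_conj h, orderOf_eq_two_iff_mul_self] at hy
    have := D.cyclic_T.eq_of_mul_self_eq_one hg hh hx.1 hy.1 hx.2 hy.2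
    rw [isConj_iff]
    exact ⟨h⁻¹ * g, by
      calc h⁻¹ * g * x * (h⁻¹ * g)⁻¹ = h⁻¹ * (g * x * g⁻¹) * h := by group
        _ = y := by rw [this]; group⟩

theorem card_centralizer_of_orderOf_two {x : G} (hx : orderOf x = 2) :
    Nat.card (Subgroup.centralizer {x}) = 8 * k + 4 := by
  obtain ⟨g, hg⟩ := D.exists_conj_mem_T hx
  rw [card_centralizer_eq (D.comm_involution hg (by rwa [orderOf_conj])), D.card_NT]

theorem ncard_diff {C N : Subgroup G} (h : C ≤ N) :
    ((N : Set G) \ C).ncard = Nat.card N - Nat.card C := by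
  have := D.finite
  rw [Set.ncard_sdiff (SetLike.coe_subset_coe.2 h) (Set.toFinite _)]
  rfl

theorem involutions_NS : {y | y ∈ D.NS ∧ orderOf y = 2} = (D.NS : Set G) \ D.S := by
  ext y
  constructor
  · rintro ⟨h, h2⟩
    refine ⟨h, fun hS => ?_⟩
    have := D.orderOf_dvd_of_mem_S hS
    rw [h2] at this
    omega
  · rintro ⟨h, hS⟩
    exact ⟨h, orderOf_eq_two_iff_mul_self.2 ⟨D.sq_NS y h hS, fun h1 => hS (h1 ▸ D.S.one_mem)⟩⟩

theorem ncard_involutions_NS : {y | y ∈ D.NS ∧ orderOf y = 2}.ncard = 4 * k + 1 := by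
  rw [D.involutions_NS, D.ncard_diff D.S_le_NS, D.card_NS, D.card_S]
  omega

theorem exists_involution_T : ∃ t ∈ D.T, orderOf t = 2 := by
  obtain ⟨g, hg⟩ := D.exists_conj_mem_T D.orderOf_i
  exact ⟨_, hg, by rw [orderOf_conj, D.orderOf_i]⟩

theorem ncard_involutions_NT : {y | y ∈ D.NT ∧ orderOf y = 2}.ncard = 4 * k + 3 := by
  have := D.finite
  obtain ⟨t, ht, ht2⟩ := D.exists_involution_T
  have : {y | y ∈ D.NT ∧ orderOf y = 2} = insert t ((D.NT : Set G) \ D.T) := by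
    ext y
    constructor
    · rintro ⟨h, h2⟩
      by_cases hT : y ∈ D.T
      · rw [orderOf_eq_two_iff_mul_self] at h2 ht2
        exact .inl (D.cyclic_T.eq_of_mul_self_eq_one hT ht h2.1 ht2.1 h2.2 ht2.2)
      · exact .inr ⟨h, hT⟩
    · rintro (rfl | ⟨h, hT⟩)
      · exact ⟨D.T_le ht, ht2⟩
      · exact ⟨h, orderOf_eq_two_iff_mul_self.2 ⟨D.sq_NT y h hT, fun h1 => hT (h1 ▸ D.T.one_mem)⟩⟩
  rw [this, Set.ncard_insert_of_notMem (fun h => h.2 ht) (Set.toFinite _), D.ncard_diff D.T_le,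
    D.card_NT, D.card_T]
  omega

theorem involutions_A : {y | y ∈ D.A ∧ orderOf y = 2} = (D.V : Set G) \ {1} := by
  ext y
  simp only [orderOf_eq_two_iff_mul_self]
  exact ⟨fun ⟨h, h2, h1⟩ => ⟨D.mem_V_of_mem_A h h2, h1⟩,
    fun ⟨h, h1⟩ => ⟨D.V_le_A h, D.mul_self_of_mem_V h, h1⟩⟩

theorem ncard_involutions_A : {y | y ∈ D.A ∧ orderOf y = 2}.ncard = 3 := by
  rw [D.involutions_A, Set.ncard_sdiff_singleton_of_mem D.V.one_mem, Subgroup.ncard_coe, D.card_V]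

/-- Involutions form one class with centralizer of order 8k + 4, and the four representatives
contain 0, 4k + 1, 4k + 3 and 3 of them. In terms of q the counts are 0, (q+1)/2, (q+3)/2, (q+1)/4.
-/
theorem ncard_over_of_orderOf_two {x : G} (hx : orderOf x = 2) (a : Fin 4) :
    (D.maxlOver a x).ncard = (![0, 4 * k + 2, 4 * k + 3, 2 * k + 1] : Fin 4 → ℕ) a := by
  have h := D.ncard_over_mul a x
  simp only [D.isConj_iff_of_orderOf_two hx, D.card_centralizer_of_orderOf_two hx] at h
  match a with
  | 0 =>
    rw [D.over_eq_empty, Set.ncard_empty]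
    · rfl
    · rw [hx, D.card_maxl]
      exact (D.odd_q.mul (⟨2 * k, by ring⟩ : Odd (4 * k + 1))).not_two_dvd_nat
  | 1 =>
    rw [show D.maxl 1 = D.NS from rfl, D.ncard_involutions_NS, D.card_NS] at h
    refine Nat.eq_of_mul_eq_mul_right (show 0 < 8 * k + 2 by omega) (h.trans ?_)
    change _ = (4 * k + 2) * (8 * k + 2)
    ring
  | 2 =>
    rw [show D.maxl 2 = D.NT from rfl, D.ncard_involutions_NT, D.card_NT] at h
    exact Nat.eq_of_mul_eq_mul_right (show 0 < 8 * k + 4 by omega) h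
  | 3 =>
    rw [show D.maxl 3 = D.A from rfl, D.ncard_involutions_A, D.card_A] at h
    change _ = 2 * k + 1
    omega

theorem card_centralizer_of_orderOf_three {x : G} (hx : orderOf x = 3) :
    Nat.card (Subgroup.centralizer {x}) = q := by
  obtain ⟨g, hg⟩ := D.exists_conj_mem_U hx
  rw [card_centralizer_eq (D.comm_U _ hg _), D.card_U]
  rw [Ne, conj_eq_one]
  rintro rfl
  simp at hx

/-- The elements of order 3 form two classes exchanged by inversion. None is conjugate to its
inverse: a conjugator d would lie in a Borel subgroup of odd order, while d² centralizes the
element. -/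
theorem ncard_isConj_of_orderOf_three {x : G} (hx : orderOf x = 3) (X : Subgroup G) :
    {y | y ∈ X ∧ orderOf y = 3}.ncard = 2 * {y | y ∈ X ∧ IsConj x y}.ncard := by
  have := D.finite
  have hne {z : G} (hz : orderOf z = 3) : z ≠ 1 := by rintro rfl; simp at hz
  have hunion : {y | y ∈ X ∧ orderOf y = 3} =
      {y | y ∈ X ∧ IsConj x y} ∪ {y | y ∈ X ∧ IsConj x y⁻¹} := by
    ext y
    simp only [Set.mem_ofPred_eq, Set.mem_union]
    rw [← and_or_left, and_congr_right_iff]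
    intro _
    constructor
    · intro hy
      obtain ⟨g, hg⟩ := D.exists_conj_mem_U hx
      obtain ⟨h, hh⟩ := D.exists_conj_mem_U hy
      obtain ⟨b, hb⟩ := D.trans_U _ hg _ hh (by rw [Ne, conj_eq_one]; exact hne hx)
        (by rw [Ne, conj_eq_one]; exact hne hy)
      rw [isConj_iff, isConj_iff]
      refine hb.imp (fun hb => ⟨h⁻¹ * b * g, ?_⟩) fun hb => ⟨h⁻¹ * b * g, ?_⟩
      · calc h⁻¹ * b * g * x * (h⁻¹ * b * g)⁻¹ = h⁻¹ * (b * (g * x * g⁻¹) * b⁻¹) * h := by group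
          _ = y := by rw [hb]; group
      · calc h⁻¹ * b * g * x * (h⁻¹ * b * g)⁻¹ = h⁻¹ * (b * (g * x * g⁻¹) * b⁻¹) * h := by group
          _ = y⁻¹ := by rw [hb]; group
    · rw [isConj_iff, isConj_iff]
      rintro (⟨c, hc⟩ | ⟨c, hc⟩)
      · rw [← hc, orderOf_conj, hx]
      · rw [← orderOf_inv, ← hc, orderOf_conj, hx]
  have hdisj : Disjoint {y | y ∈ X ∧ IsConj x y} {y | y ∈ X ∧ IsConj x y⁻¹} := by
    rw [Set.disjoint_left]
    rintro y ⟨-, h1⟩ ⟨-, h2⟩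
    have hy : orderOf y = 3 := by
      obtain ⟨c, hc⟩ := isConj_iff.1 h1
      rw [← hc, orderOf_conj, hx]
    obtain ⟨c, hc⟩ := isConj_iff.1 (h1.symm.trans h2)
    obtain ⟨g, hg⟩ := D.exists_conj_mem_U hy
    set z := g * y * g⁻¹ with hz
    have hz1 : z ≠ 1 := by rw [hz, Ne, conj_eq_one]; exact hne hy
    have hd : (g * c * g⁻¹) * z * (g * c * g⁻¹)⁻¹ = z⁻¹ := by
      calc (g * c * g⁻¹) * z * (g * c * g⁻¹)⁻¹ = g * (c * y * c⁻¹) * g⁻¹ := by rw [hz]; group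
        _ = z⁻¹ := by rw [hc, hz]; group
    generalize g * c * g⁻¹ = d at hd
    have hdB : d ∈ D.B := D.conj_U_iff z hg hz1 d (by rw [hd]; exact D.U.inv_mem hg)
    have hd2 : d ^ 2 * z = z * d ^ 2 := by
      have e1 : d * z = z⁻¹ * d := by rw [← hd]; group
      have e2 : d * z⁻¹ = z * d := by
        have : d * z⁻¹ * d⁻¹ = z := by rw [← conj_inv, hd, inv_inv]
        rw [← mul_inv_eq_iff_eq_mul, this]
      rw [pow_two, mul_assoc, e1, ← mul_assoc, e2, mul_assoc]
    have hodd : Odd (orderOf d) := by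
      have h3 : orderOf d ∣ q * (4 * k + 1) := by
        rw [← D.card_B]
        simpa using orderOf_dvd_natCard (⟨d, hdB⟩ : D.B)
      exact (D.odd_q.mul (⟨2 * k, by ring⟩ : Odd (4 * k + 1))).of_dvd_nat h3
    obtain ⟨m, hm⟩ := hodd
    have hdz : d * z = z * d := by
      -- As d has odd order 2m + 1, it is a power of d².
      have : d = (d ^ 2) ^ (m + 1) := by
        rw [← pow_mul, show 2 * (m + 1) = orderOf d + 1 by omega, pow_succ, pow_orderOf_eq_one,
          one_mul]
      rw [this]
      exact (Commute.pow_left hd2 (m + 1)).eq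
    rw [hdz, mul_inv_cancel_right] at hd
    have h2 : z * z = 1 := mul_eq_one_iff_eq_inv.2 hd
    have h3 := orderOf_eq_two_iff_mul_self.2 ⟨h2, hz1⟩
    rw [hz, orderOf_conj] at h3
    omega
  rw [hunion, Set.ncard_union_eq hdisj (Set.toFinite _) (Set.toFinite _), two_mul]
  congr 1
  rw [← Set.ncard_image_of_injective {y | y ∈ X ∧ IsConj x y} inv_injective]
  congr 1
  ext y
  simp

theorem ncard_orderOf_three_B : {y | y ∈ D.B ∧ orderOf y = 3}.ncard = 2 * (4 * k + 1) := by
  have := D.finite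
  have : {y | y ∈ D.B ∧ orderOf y = 3} = (D.U : Set G) \ {1} := by
    ext y
    constructor
    · rintro ⟨h, h3⟩
      refine ⟨D.mem_U_of_mem_B h (h3 ▸ pow_orderOf_eq_one y), ?_⟩
      rintro rfl
      simp at h3
    · rintro ⟨h, h1⟩
      exact ⟨D.U_le h, D.orderOf_of_mem_U h h1⟩
  rw [this, Set.ncard_sdiff_singleton_of_mem D.U.one_mem, Subgroup.ncard_coe, D.card_U, D.q_eq]
  omega

theorem orderOf_three_A : {y | y ∈ D.A ∧ orderOf y = 3} = (D.A : Set G) \ D.V := by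
  ext y
  constructor
  · rintro ⟨h, h3⟩
    refine ⟨h, fun hV => ?_⟩
    have h2 : orderOf y ∣ 2 := orderOf_dvd_of_pow_eq_one (by
      rw [pow_two, D.mul_self_of_mem_V hV])
    rw [h3] at h2
    omega
  · rintro ⟨h, hV⟩
    exact ⟨h, D.orderOf_of_mem_A h hV⟩

/-- |C(x)| = q, and the class of x has (q - 1)/2 elements in B and 8/2 = 4 in A, which gives 1 and
4q/12. -/
theorem ncard_over_of_orderOf_three {x : G} (hx : orderOf x = 3) (a : Fin 4) :
    (D.maxlOver a x).ncard = (![1, 0, 0, q / 3] : Fin 4 → ℕ) a := by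
  have := D.finite
  have h := D.ncard_over_mul a x
  have h2 := D.ncard_isConj_of_orderOf_three hx (D.maxl a)
  rw [D.card_centralizer_of_orderOf_three hx] at h
  have hk := D.three_dvd
  have hq := D.q_eq
  match a with
  | 0 =>
    rw [show D.maxl 0 = D.B from rfl] at h h2
    rw [D.ncard_orderOf_three_B] at h2
    rw [← Nat.eq_of_mul_eq_mul_left (by norm_num) h2, D.card_B] at h
    refine Nat.eq_of_mul_eq_mul_right (show 0 < q * (4 * k + 1) by rw [hq]; positivity)
      (h.trans ?_)
    change _ = 1 * _
    ring
  | 1 =>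
    rw [D.over_eq_empty, Set.ncard_empty]
    · rfl
    · rw [hx]; exact D.not_three_dvd_NS
  | 2 =>
    rw [D.over_eq_empty, Set.ncard_empty]
    · rfl
    · rw [hx]; exact D.not_three_dvd_NT
  | 3 =>
    rw [show D.maxl 3 = D.A from rfl] at h h2
    rw [D.orderOf_three_A, D.ncard_diff D.V_le_A, D.card_A, D.card_V] at h2
    rw [D.card_A, show {y | y ∈ D.A ∧ IsConj x y}.ncard = 4 by omega] at h
    change _ = q / 3
    omega

theorem mul_self_ne_one_of_conj_mem_S {g x : G} (hx : g * x * g⁻¹ ∈ D.S) (hx1 : x ≠ 1) :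
    ¬ x * x = 1 := by
  intro h
  have h1 := D.orderOf_dvd_of_mem_S hx
  rw [orderOf_conj, orderOf_eq_two_iff_mul_self.2 ⟨h, hx1⟩] at h1
  omega

/-- In PSL, Borel subgroups are the stabilizers of points of the projective line, and a nontrivial
split element fixes exactly two points. The right-hand side depends on g only, so all nontrivial
elements of one split torus have the same Borels. -/
theorem over_zero_of_conj_mem_S {g x : G} (hx : g * x * g⁻¹ ∈ D.S) (hx1 : x ≠ 1) :
    D.maxlOver 0 x = {MulAut.conj g⁻¹ • D.B, MulAut.conj (g⁻¹ * D.w) • D.B} := by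
  have hw {y : G} (hy : y ∈ D.S) : D.w⁻¹ * y * D.w ∈ D.S := by
    have := D.conj_eq_inv_S (D.NS.inv_mem D.w_mem) (by simpa using D.w_notMem_S) hy
    rw [inv_inv] at this
    rw [this]
    exact D.S.inv_mem hy
  have hB {b : G} (hb : b ∈ D.B) : MulAut.conj b • D.B = D.B := by
    ext x
    rw [Subgroup.mem_conj_smul]
    rw [D.B.mul_mem_cancel_right hb, D.B.mul_mem_cancel_left (D.B.inv_mem hb)]
  ext M
  rw [Set.mem_insert_iff, Set.mem_singleton_iff]
  constructor
  · rintro ⟨hM, h, rfl⟩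
    change x ∈ MulAut.conj h • D.B at hM
    change MulAut.conj h • D.B = _ ∨ MulAut.conj h • D.B = _
    rw [Subgroup.mem_conj_smul] at hM
    have := D.conj_SB _ hx (by rwa [Ne, conj_eq_one]) (g * h) (by convert hM using 1; group)
    rcases this with h1 | h1
    · left
      rw [show h = g⁻¹ * (g * h) by group, map_mul, mul_smul, hB h1]
    · right
      rw [show h = (g⁻¹ * D.w) * (D.w⁻¹ * (g * h)) by group, map_mul, mul_smul, hB h1]
  · rintro (rfl | rfl)
    · exact ⟨Subgroup.mem_conj_smul.2 (by rw [inv_inv]; exact D.S_le hx), _, rfl⟩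
    · refine ⟨Subgroup.mem_conj_smul.2 ?_, _, rfl⟩
      have := D.S_le (hw hx)
      convert this using 1
      group

theorem ncard_over_of_conj_mem_S {g x : G} (hx : g * x * g⁻¹ ∈ D.S) (hx1 : x ≠ 1) (a : Fin 4) :
    (D.maxlOver a x).ncard = (![2, 1, 0, 0] : Fin 4 → ℕ) a := by
  have := D.finite
  have h := D.ncard_over_mul a x
  have hx2 := D.mul_self_ne_one_of_conj_mem_S hx hx1
  rw [card_centralizer_eq (D.comm_S _ hx (by rwa [Ne, conj_eq_one])), D.card_S] at h
  have ho := D.orderOf_dvd_of_mem_S hx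
  rw [orderOf_conj] at ho
  have ho1 : orderOf x ≠ 1 := by rwa [Ne, orderOf_eq_one_iff]
  match a with
  | 0 =>
    rw [D.over_zero_of_conj_mem_S hx hx1, Set.ncard_pair]
    · rfl
    · intro heq
      refine D.w_notMem (D.mem_maxl_of_normalizes 0 D.w fun y hy => ?_)
      change y ∈ D.B at hy
      change _ ∈ D.B
      have h1 : g⁻¹ * (D.w * y * D.w⁻¹) * g ∈ MulAut.conj (g⁻¹ * D.w) • D.B := by
        rw [Subgroup.mem_conj_smul]
        convert hy using 1
        group
      rw [← heq, Subgroup.mem_conj_smul] at h1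
      convert h1 using 1
      group
  | 1 =>
    rw [show D.maxl 1 = D.NS from rfl, D.card_NS, ncard_isConj_of_torus hx hx2 D.S_le_NS
      (fun a ha haS b hb => D.conj_eq_inv_S ha haS hb) (fun a ha b hb => D.mul_comm_S ha hb)
      D.sq_NS D.conj_S_iff D.w_mem D.w_notMem_S] at h
    change _ = 1
    exact Nat.eq_of_mul_eq_mul_right (show 0 < 8 * k + 2 by omega) (by omega)
  | 2 =>
    rw [D.over_eq_empty, Set.ncard_empty]
    · rfl
    · rw [D.card_maxl]
      intro h2
      change _ ∣ 8 * k + 4 at h2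
      have h3 : orderOf x ∣ 2 := (Nat.dvd_add_right (ho.mul_left 2)).1 (by
        convert h2 using 1; ring)
      rcases (Nat.dvd_prime Nat.prime_two).1 h3 with h4 | h4
      · exact ho1 h4
      · exact hx2 (orderOf_eq_two_iff_mul_self.1 h4).1
  | 3 =>
    rw [D.over_eq_empty, Set.ncard_empty]
    · rfl
    · rw [D.card_maxl]
      intro h2
      change _ ∣ 12 at h2
      obtain ⟨m, rfl⟩ := D.three_dvd
      rw [show 4 * (3 * m) + 1 = 12 * m + 1 by ring] at ho
      exact ho1 (Nat.dvd_one.1 ((Nat.dvd_add_right (h2.mul_right m)).1 ho))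

theorem exists_mem_NT_notMem_T : ∃ n ∈ D.NT, n ∉ D.T := by
  by_contra! h
  have := D.finite
  have := Subgroup.card_dvd_of_le h
  rw [D.card_NT, D.card_T] at this
  have := Nat.le_of_dvd (by omega) this
  omega

theorem ncard_over_of_conj_mem_T {g x : G} (hx : g * x * g⁻¹ ∈ D.T) (hx2 : ¬ x * x = 1)
    (a : Fin 4) : (D.maxlOver a x).ncard = (![0, 0, 1, 0] : Fin 4 → ℕ) a := by
  have := D.finite
  have h := D.ncard_over_mul a x
  rw [card_centralizer_eq (D.comm_T _ hx (by
    rwa [conj_pow, Ne, conj_eq_one, pow_two])), D.card_T] at h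
  have ho := D.orderOf_dvd_of_mem_T hx
  rw [orderOf_conj] at ho
  have ho1 : ¬ orderOf x ∣ 2 := by rwa [orderOf_dvd_iff_pow_eq_one, pow_two]
  match a with
  | 0 =>
    rw [D.over_eq_empty, Set.ncard_empty]
    · rfl
    · rw [D.card_maxl]
      intro h2
      change _ ∣ q * (4 * k + 1) at h2
      -- With n = 4k + 2, |B| = (2n - 1)(n - 1) = 2n² - 3n + 1, which is prime to n.
      have h3 : orderOf x ∣ (4 * k + 2) * (2 * (4 * k + 2)) + 1 := by
        have e : q * (4 * k + 1) + 3 * (4 * k + 2) = (4 * k + 2) * (2 * (4 * k + 2)) + 1 := by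
          rw [D.q_eq]; ring
        exact e ▸ dvd_add h2 (ho.mul_left 3)
      have h5 : orderOf x ∣ 1 := (Nat.dvd_add_right (ho.mul_right _)).1 h3
      exact ho1 (h5.trans (one_dvd 2))
  | 1 =>
    rw [D.over_eq_empty, Set.ncard_empty]
    · rfl
    · rw [D.card_maxl]
      intro h2
      change _ ∣ 8 * k + 2 at h2
      have h4 := ho.mul_left 2
      rw [show 2 * (4 * k + 2) = 8 * k + 2 + 2 by ring] at h4
      exact ho1 ((Nat.dvd_add_right h2).1 h4)
  | 2 =>
    obtain ⟨n, hn, hnT⟩ := D.exists_mem_NT_notMem_T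
    rw [show D.maxl 2 = D.NT from rfl, D.card_NT, ncard_isConj_of_torus hx hx2 D.T_le
      (fun a ha haS b hb => D.conj_eq_inv_T ha haS hb) (fun a ha b hb => D.mul_comm_T ha hb)
      D.sq_NT D.conj_T_iff hn hnT] at h
    change _ = 1
    exact Nat.eq_of_mul_eq_mul_right (show 0 < 8 * k + 4 by omega) (by omega)
  | 3 =>
    rw [D.over_eq_empty, Set.ncard_empty]
    · rfl
    · rw [D.card_maxl]
      intro h2
      change _ ∣ 12 at h2
      obtain ⟨m, rfl⟩ := D.three_dvd
      rw [show 4 * (3 * m) + 2 = 12 * m + 2 by ring] at ho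
      exact ho1 ((Nat.dvd_add_right (h2.mul_right m)).1 ho)

end PSLTwoData

end Counting

/-! ### Intersections of maximal subgroups and sizes of solubilizers. -/

section Intersections

open Pointwise

theorem Subgroup.isSolvable_of_prime_index {G : Type*} [Group G] {N : Subgroup G} [N.Normal]
    (hN : ∀ a ∈ N, ∀ b ∈ N, a * b = b * a) (hp : N.index.Prime) : Group.IsSolvable G := by
  have : Fact N.index.Prime := ⟨hp⟩
  have : IsCyclic (G ⧸ N) := isCyclic_of_prime_card (p := N.index) rfl
  have h1 : Group.IsSolvable (G ⧸ N) :=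
    Group.isSolvable_of_comm (IsCyclic.commGroup (α := G ⧸ N)).mul_comm
  have h2 : Group.IsSolvable N := Group.isSolvable_of_comm fun a b => Subtype.ext (hN a a.2 b b.2)
  exact Group.isSolvable_iff_subgroup_quotient N |>.2 ⟨h2, h1⟩

/-- Outside E distinct members are disjoint, so their sizes add up, class by class. -/
theorem Subgroup.ncard_iUnion_diff {G ι : Type*} [Group G] [Finite G] [Fintype ι]
    (𝓜 : ι → Set (Subgroup G)) (E : Set G) (c : ι → ℕ)
    (hdisj : ∀ a b, ∀ M ∈ 𝓜 a, M ∈ 𝓜 b → a = b)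
    (hE : ∀ a b, ∀ M ∈ 𝓜 a, ∀ N ∈ 𝓜 b, M ≠ N → (M : Set G) ∩ N ⊆ E)
    (hc : ∀ a, ∀ M ∈ 𝓜 a, ((M : Set G) \ E).ncard = c a) :
    ((⋃ a, ⋃ M ∈ 𝓜 a, (M : Set G)) \ E).ncard = ∑ a, (𝓜 a).ncard * c a := by
  classical
  have hfin (s : Set G) : s.Finite := s.toFinite
  have hfin' (s : Set (Subgroup G)) : s.Finite := s.toFinite
  let F : Finset (Subgroup G) := Finset.univ.biUnion fun a => (hfin' (𝓜 a)).toFinset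
  have hF (M) : M ∈ F ↔ ∃ a, M ∈ 𝓜 a := by simp [F]
  have h1 : ((⋃ a, ⋃ M ∈ 𝓜 a, (M : Set G)) \ E) =
      ((F.biUnion fun M => (hfin ((M : Set G) \ E)).toFinset : Finset G) : Set G) := by
    ext y
    simp only [Set.mem_sdiff, Set.mem_iUnion, Finset.coe_biUnion, SetLike.mem_coe, hF,
      Set.Finite.coe_toFinset, exists_prop]
    constructor
    · rintro ⟨⟨a, M, hM, hy⟩, hyE⟩
      exact ⟨M, ⟨a, hM⟩, hy, hyE⟩
    · rintro ⟨M, ⟨a, hM⟩, hy, hyE⟩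
      exact ⟨⟨a, M, hM, hy⟩, hyE⟩
  rw [h1, Set.ncard_coe_finset, Finset.card_biUnion, Finset.sum_biUnion]
  · refine Finset.sum_congr rfl fun a _ => ?_
    rw [Finset.sum_const_nat (m := c a), Set.ncard_eq_toFinset_card _ (hfin' _)]
    intro M hM
    rw [← hc a M (by simpa using hM), Set.ncard_eq_toFinset_card _ (hfin _)]
  · intro a _ b _ hab
    simp only [Function.onFun]
    rw [Finset.disjoint_left]
    intro M hM hM'
    exact hab (hdisj a b M (by simpa using hM) (by simpa using hM'))
  · intro M hM N hN hMN
    rw [SetLike.mem_coe, hF] at hM hN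
    obtain ⟨a, hM⟩ := hM
    obtain ⟨b, hN⟩ := hN
    simp only [Function.onFun]
    rw [Finset.disjoint_left]
    intro y hy hy'
    simp only [Set.Finite.mem_toFinset, Set.mem_sdiff] at hy hy'
    exact hy.2 (hE a b M hM N hN hMN ⟨hy.1, hy'.1⟩)

namespace PSLTwoData

variable {G : Type*} [Group G] {q k : ℕ} (D : PSLTwoData G q k)

include D

theorem orderOf_cases {x : G} (hx : x ≠ 1) : orderOf x = 3 ∨ (∃ g, g * x * g⁻¹ ∈ D.S) ∨
    orderOf x = 2 ∨ ∃ g, g * x * g⁻¹ ∈ D.T ∧ ¬ x * x = 1 := by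
  obtain ⟨g, h | h | h⟩ := D.cover x
  · exact .inl (by simpa [orderOf_conj] using D.orderOf_of_mem_U h (by rwa [Ne, conj_eq_one]))
  · exact .inr (.inl ⟨g, h⟩)
  · by_cases h2 : x * x = 1
    · exact .inr (.inr (.inl (orderOf_eq_two_iff_mul_self.2 ⟨h2, hx⟩)))
    · exact .inr (.inr (.inr ⟨g, h, h2⟩))

theorem exists_conj_mem_S {x : G} (hx : x ≠ 1) (h : orderOf x ∣ 8 * k + 2) (h2 : orderOf x ≠ 2) :
    ∃ g, g * x * g⁻¹ ∈ D.S := by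
  rcases D.orderOf_cases hx with h3 | h3 | h3 | ⟨g, hg, hx2⟩
  · have := D.three_dvd
    rw [h3] at h
    omega
  · exact h3
  · exact absurd h3 h2
  · have h1 := (D.orderOf_dvd_of_mem_T hg).mul_left 2
    rw [orderOf_conj, show 2 * (4 * k + 2) = 8 * k + 2 + 2 by ring] at h1
    have h4 := (Nat.dvd_add_right h).1 h1
    rw [orderOf_dvd_iff_pow_eq_one, pow_two] at h4
    exact absurd h4 hx2

theorem exists_conj_mem_T_of_dvd {x : G} (hx : x ≠ 1) (h : orderOf x ∣ 8 * k + 4)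
    (h2 : orderOf x ≠ 2) : ∃ g, g * x * g⁻¹ ∈ D.T ∧ ¬ x * x = 1 := by
  rcases D.orderOf_cases hx with h3 | ⟨g, hg⟩ | h3 | h3
  · have := D.three_dvd
    rw [h3] at h
    omega
  · have h1 := (D.orderOf_dvd_of_mem_S hg).mul_left 2
    rw [orderOf_conj] at h1
    rw [show 8 * k + 4 = 2 * (4 * k + 1) + 2 by ring] at h
    have h4 := (Nat.dvd_add_right h1).1 h
    rw [orderOf_dvd_iff_pow_eq_one, pow_two] at h4
    exact absurd h4 (D.mul_self_ne_one_of_conj_mem_S hg hx)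
  · exact absurd h3 h2
  · exact h3

theorem eq_of_ncard_eq_one {a : Fin 4} {x : G} (h : (D.maxlOver a x).ncard = 1) {M N : Subgroup G}
    (hM : M ∈ D.maxlOver a x) (hN : N ∈ D.maxlOver a x) : M = N := by
  obtain ⟨K, hK⟩ := Set.ncard_eq_one.1 h
  rw [hK, Set.mem_singleton_iff] at hM hN
  rw [hM, hN]

theorem ncard_ne_zero {a : Fin 4} {x : G} {M : Subgroup G} (hM : M ∈ D.maxlOver a x) :
    (D.maxlOver a x).ncard ≠ 0 := by
  have := D.finite
  rw [Ne, Set.ncard_eq_zero]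
  exact Set.Nonempty.ne_empty ⟨M, hM⟩

theorem mem_maxlOver_of_mem {a : Fin 4} {x y : G} {M : Subgroup G} (hM : M ∈ D.maxlOver a x)
    (hy : y ∈ M) : M ∈ D.maxlOver a y := ⟨hy, hM.2⟩

theorem maxlOver_of_conj_mem_T {g x : G} (hx : g * x * g⁻¹ ∈ D.T) (hx2 : ¬ x * x = 1)
    {M : Subgroup G} (hM : M ∈ maximalOver x) : M ∈ D.maxlOver 2 x := by
  obtain ⟨a, ha⟩ := D.mem_maximalOver.1 hM
  have h := D.ncard_ne_zero ha
  rw [D.ncard_over_of_conj_mem_T hx hx2] at h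
  have : a = 2 := by revert h; fin_cases a <;> simp
  exact this ▸ ha

theorem eq_of_conj_mem_T {g x : G} (hx : g * x * g⁻¹ ∈ D.T) (hx2 : ¬ x * x = 1)
    {M N : Subgroup G} (hM : M ∈ maximalOver x) (hN : N ∈ maximalOver x) : M = N :=
  D.eq_of_ncard_eq_one (D.ncard_over_of_conj_mem_T hx hx2 2) (D.maxlOver_of_conj_mem_T hx hx2 hM)
    (D.maxlOver_of_conj_mem_T hx hx2 hN)

theorem odd_card_B : Odd (q * (4 * k + 1)) := D.odd_q.mul ⟨2 * k, by ring⟩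

theorem card_centralizer_of_conj_mem_S {g x : G} (hx : g * x * g⁻¹ ∈ D.S) (hx1 : x ≠ 1) :
    Nat.card (Subgroup.centralizer {x}) = 4 * k + 1 := by
  rw [card_centralizer_eq (D.comm_S _ hx (by rwa [Ne, conj_eq_one])), D.card_S]

theorem maxlOver_of_conj_mem_S {g x : G} (hx : g * x * g⁻¹ ∈ D.S) (hx1 : x ≠ 1)
    {M : Subgroup G} (hM : M ∈ maximalOver x) : M ∈ D.maxlOver 0 x ∨ M ∈ D.maxlOver 1 x := by
  obtain ⟨a, ha⟩ := D.mem_maximalOver.1 hM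
  have h := D.ncard_ne_zero ha
  rw [D.ncard_over_of_conj_mem_S hx hx1] at h
  have : a = 0 ∨ a = 1 := by revert h; fin_cases a <;> simp
  rcases this with rfl | rfl
  · exact .inl ha
  · exact .inr ha

/-- C(x) is a split torus. A Borel containing x contains all of it, by `over_zero_of_conj_mem_S` for
its other elements; in a conjugate of `NS`, x lies in the torus of that conjugate since x² ≠ 1. -/
theorem centralizer_le_of_conj_mem_S {g x : G} (hx : g * x * g⁻¹ ∈ D.S) (hx1 : x ≠ 1)
    {M : Subgroup G} (hM : M ∈ maximalOver x) : Subgroup.centralizer {x} ≤ M := by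
  have hS := D.comm_S _ hx (by rwa [Ne, conj_eq_one])
  rcases D.maxlOver_of_conj_mem_S hx hx1 hM with h | h
  · intro y hy
    by_cases hy1 : y = 1
    · exact hy1 ▸ M.one_mem
    rw [centralizer_eq_conj_smul hS, Subgroup.mem_conj_smul, inv_inv] at hy
    have : M ∈ D.maxlOver 0 y := by
      rw [D.over_zero_of_conj_mem_S hy hy1, ← D.over_zero_of_conj_mem_S hx hx1]
      exact h
    exact this.1
  · obtain ⟨hxM, h, rfl⟩ := h
    change x ∈ MulAut.conj h • D.NS at hxM
    change _ ≤ MulAut.conj h • D.NS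
    rw [Subgroup.mem_conj_smul] at hxM
    have hxS : h⁻¹ * x * (h⁻¹)⁻¹ ∈ D.S := by
      by_contra hn
      rw [inv_inv] at hn
      have h1 := D.sq_NS _ hxM hn
      rw [← pow_two] at h1
      have h2 := conj_pow (i := 2) (a := h⁻¹) (b := x)
      rw [inv_inv, h1] at h2
      refine D.mul_self_ne_one_of_conj_mem_S hx hx1 ?_
      rw [← pow_two, ← conj_eq_one (g := h⁻¹), inv_inv]
      exact h2.symm
    rw [centralizer_eq_conj_smul (D.comm_S _ hxS (by rwa [Ne, conj_eq_one])), inv_inv]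
    exact Subgroup.pointwise_smul_le_pointwise_smul_iff.2 D.S_le_NS

/-- It suffices that |M ∩ N| divides 4k + 1. Two distinct Borels share no element of order 3, which
lies in only one; a Borel and a conjugate of `NS` meet in odd order dividing 2(4k + 1). -/
theorem inf_eq_centralizer {g x : G} (hx : g * x * g⁻¹ ∈ D.S) (hx1 : x ≠ 1) {M N : Subgroup G}
    (hM : M ∈ maximalOver x) (hN : N ∈ maximalOver x) (hMN : M ≠ N) :
    M ⊓ N = Subgroup.centralizer {x} := by
  have := D.finite
  have hle := le_inf (D.centralizer_le_of_conj_mem_S hx hx1 hM)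
    (D.centralizer_le_of_conj_mem_S hx hx1 hN)
  symm
  refine Subgroup.eq_of_le_of_card_ge hle ?_
  rw [D.card_centralizer_of_conj_mem_S hx hx1]
  refine Nat.le_of_dvd (by omega) ?_
  have key {M N : Subgroup G} (hM : M ∈ D.maxlOver 0 x) (hN : N ∈ D.maxlOver 1 x) :
      Nat.card ↥(M ⊓ N) ∣ 4 * k + 1 := by
    have h1 := Subgroup.card_dvd_of_le (inf_le_left : M ⊓ N ≤ M)
    have h2 := Subgroup.card_dvd_of_le (inf_le_right : M ⊓ N ≤ N)
    rw [D.card_of_mem_over hM, D.card_maxl] at h1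
    rw [D.card_of_mem_over hN, D.card_maxl] at h2
    have hodd : Odd (Nat.card ↥(M ⊓ N)) := D.odd_card_B.of_dvd_nat h1
    refine (Nat.Coprime.dvd_of_dvd_mul_left hodd.coprime_two_right (m := 2) ?_)
    convert h2 using 1
    change _ = 8 * k + 2
    ring
  rcases D.maxlOver_of_conj_mem_S hx hx1 hM with hM | hM <;>
    rcases D.maxlOver_of_conj_mem_S hx hx1 hN with hN | hN
  · have h1 := Subgroup.card_dvd_of_le (inf_le_left : M ⊓ N ≤ M)
    rw [D.card_of_mem_over hM, D.card_maxl] at h1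
    obtain ⟨n, hn⟩ := D.q_pow
    have h3 : ¬ 3 ∣ Nat.card ↥(M ⊓ N) := by
      intro h
      have : Fact (Nat.Prime 3) := ⟨Nat.prime_three⟩
      obtain ⟨⟨y, hy⟩, hyo⟩ := exists_prime_orderOf_dvd_card' (G := ↥(M ⊓ N)) 3 h
      rw [Subgroup.orderOf_mk] at hyo
      exact hMN (D.eq_of_ncard_eq_one (D.ncard_over_of_orderOf_three hyo 0)
        (D.mem_maxlOver_of_mem hM hy.1) (D.mem_maxlOver_of_mem hN hy.2))
    refine Nat.Coprime.dvd_of_dvd_mul_left (m := q) ?_ h1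
    rw [hn]
    exact Nat.Prime.coprime_pow_of_not_dvd Nat.prime_three h3
  · exact key hM hN
  · rw [inf_comm]; exact key hN hM
  · exact absurd (D.eq_of_ncard_eq_one (D.ncard_over_of_conj_mem_S hx hx1 1) hM hN) hMN

theorem maxlOver_of_orderOf_three {x : G} (hx : orderOf x = 3)
    {M : Subgroup G} (hM : M ∈ maximalOver x) : M ∈ D.maxlOver 0 x ∨ M ∈ D.maxlOver 3 x := by
  obtain ⟨a, ha⟩ := D.mem_maximalOver.1 hM
  have h := D.ncard_ne_zero ha
  rw [D.ncard_over_of_orderOf_three hx] at h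
  have : a = 0 ∨ a = 3 := by revert h; fin_cases a <;> simp
  rcases this with rfl | rfl
  · exact .inl ha
  · exact .inr ha

/-- Two conjugates of `A` sharing an involution and an element of order `3` coincide. -/
theorem eq_of_mem_maxlOver_three {x y : G} (hx : orderOf x = 3) (hy : orderOf y = 2)
    {M N : Subgroup G} (hM : M ∈ D.maxlOver 3 x) (hN : N ∈ D.maxlOver 3 x) (hyM : y ∈ M)
    (hyN : y ∈ N) : M = N := by
  have := D.finite
  have hcM := D.card_of_mem_over hM
  have hcN := D.card_of_mem_over hN
  have hle : M ⊓ N ≤ M := inf_le_left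
  have h3 : 3 ∣ Nat.card ↥(M ⊓ N) :=
    hx ▸ Subgroup.orderOf_dvd_natCard (M ⊓ N) (x := x) ⟨hM.1, hN.1⟩
  have hxM := hM.1
  -- A second involution of M ∩ N, different from y because C(x) contains no involution. Hence M ∩ N
  -- contains the whole four-group of M and has order divisible by 12.
  have hxy1 : x * y * x⁻¹ ∈ M ⊓ N := ⟨M.mul_mem (M.mul_mem hxM hyM) (M.inv_mem hxM),
    N.mul_mem (N.mul_mem hN.1 hyN) (N.inv_mem hN.1)⟩
  have hne : x * y * x⁻¹ ≠ y := by
    intro h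
    obtain ⟨g, hg⟩ := D.exists_conj_mem_U hx
    have hx1 : x ≠ 1 := by rintro rfl; simp at hx
    have h1 := (D.comm_U _ hg (by rwa [Ne, conj_eq_one]) (g * y * g⁻¹)).1 (by
      rw [conj_commute]
      nth_rw 1 [← h]; group)
    have := D.orderOf_of_mem_U h1 (by rw [Ne, conj_eq_one]; rintro rfl; simp at hy)
    rw [orderOf_conj] at this
    omega
  have h4 : 4 ∣ Nat.card ↥(M ⊓ N) := by
    obtain ⟨-, g, rfl⟩ := hM
    set W := MulAut.conj g • D.V ⊓ (MulAut.conj g • D.maxl 3 ⊓ N) with hW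
    have hW4 : Nat.card W ∣ 4 := by
      rw [← D.card_V, ← Subgroup.card_conj_smul g D.V]
      exact Subgroup.card_dvd_of_le inf_le_left
    have hmem {z : G} (hz : z ∈ MulAut.conj g • D.maxl 3 ⊓ N) (hz2 : orderOf z = 2) : z ∈ W := by
      refine ⟨?_, hz⟩
      have h1 : z ∈ MulAut.conj g • D.A := hz.1
      change z ∈ MulAut.conj g • D.V
      rw [Subgroup.mem_conj_smul] at h1 ⊢
      refine D.mem_V_of_mem_A h1 ?_
      rw [orderOf_eq_two_iff_mul_self] at hz2
      calc g⁻¹ * z * g * (g⁻¹ * z * g) = g⁻¹ * (z * z) * g := by group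
        _ = 1 := by rw [hz2.1]; group
    have hyW := hmem ⟨hyM, hyN⟩ hy
    have hxyW := hmem hxy1 (by rw [orderOf_conj, hy])
    have hge : 3 ≤ Nat.card W := by
      classical
      rw [← Subgroup.ncard_coe]
      have : ((({1, y, x * y * x⁻¹} : Finset G) : Set G)) ⊆ W := by
        intro z hz
        simp only [Finset.coe_insert, Finset.coe_singleton, Set.mem_insert_iff,
          Set.mem_singleton_iff] at hz
        rcases hz with rfl | rfl | rfl
        · exact W.one_mem
        · exact hyW
        · exact hxyW
      refine le_trans ?_ (Set.ncard_le_ncard this (Set.toFinite _))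
      have hy1 : y ≠ 1 := by rintro rfl; simp at hy
      rw [Set.ncard_coe_finset, Finset.card_insert_of_notMem, Finset.card_insert_of_notMem,
        Finset.card_singleton]
      · simpa using hne.symm
      · rw [Finset.mem_insert, Finset.mem_singleton, not_or]
        exact ⟨hy1.symm, fun h => hy1 (conj_eq_one.1 h.symm)⟩
    have hWK : Nat.card W ∣ Nat.card ↥(MulAut.conj g • D.maxl 3 ⊓ N) :=
      Subgroup.card_dvd_of_le inf_le_right
    have hle := Nat.le_of_dvd (by norm_num) hW4
    have : Nat.card W = 4 := by
      generalize Nat.card W = n at hW4 hge hle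
      interval_cases n <;> revert hW4 <;> decide
    rwa [this] at hWK
  have h12 : 12 ∣ Nat.card ↥(M ⊓ N) := by omega
  have hA : Nat.card (D.maxl 3) = 12 := D.card_A
  have hKM : M ⊓ N = M := Subgroup.eq_of_le_of_card_ge hle (by
    rw [hcM, hA]
    exact Nat.le_of_dvd Nat.card_pos h12)
  exact Subgroup.eq_of_le_of_card_ge (inf_eq_left.1 hKM) (by rw [hcM, hcN])

/-- One of M, N is a conjugate of A, so the order is a multiple of 3 dividing 12. It is odd: Borels
have odd order, and two conjugates of A sharing x and an involution coincide. -/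
theorem card_inf_of_orderOf_three {x : G} (hx : orderOf x = 3) {M N : Subgroup G}
    (hM : M ∈ maximalOver x) (hN : N ∈ maximalOver x) (hMN : M ≠ N) :
    Nat.card ↥(M ⊓ N) = 3 := by
  have := D.finite
  have h3 : 3 ∣ Nat.card ↥(M ⊓ N) :=
    hx ▸ Subgroup.orderOf_dvd_natCard (M ⊓ N) (x := x) ⟨hM.2, hN.2⟩
  have key {K : Subgroup G} (h3 : 3 ∣ Nat.card K) (h12 : Nat.card K ∣ 12) (h2 : ¬ 2 ∣ Nat.card K) :
      Nat.card K = 3 := by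
    have hle := Nat.le_of_dvd (by norm_num) h12
    generalize Nat.card K = n at h3 h12 h2 hle
    interval_cases n <;> revert h3 h12 h2 <;> decide
  have key2 {M N : Subgroup G} (hM : M ∈ D.maxlOver 0 x) (hN : N ∈ D.maxlOver 3 x)
      (h3 : 3 ∣ Nat.card ↥(M ⊓ N)) : Nat.card ↥(M ⊓ N) = 3 := by
    have h1 := Subgroup.card_dvd_of_le (inf_le_left : M ⊓ N ≤ M)
    have h2 := Subgroup.card_dvd_of_le (inf_le_right : M ⊓ N ≤ N)
    rw [D.card_of_mem_over hM, D.card_maxl] at h1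
    rw [D.card_of_mem_over hN, D.card_maxl] at h2
    exact key h3 h2 (D.odd_card_B.of_dvd_nat h1).not_two_dvd_nat
  rcases D.maxlOver_of_orderOf_three hx hM with hM | hM <;>
    rcases D.maxlOver_of_orderOf_three hx hN with hN | hN
  · exact absurd (D.eq_of_ncard_eq_one (D.ncard_over_of_orderOf_three hx 0) hM hN) hMN
  · exact key2 hM hN h3
  · rw [inf_comm] at h3 ⊢
    exact key2 hN hM h3
  · have h1 := Subgroup.card_dvd_of_le (inf_le_left : M ⊓ N ≤ M)
    rw [D.card_of_mem_over hM, D.card_maxl] at h1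
    refine key h3 h1 fun h => hMN ?_
    have : Fact (Nat.Prime 2) := ⟨Nat.prime_two⟩
    obtain ⟨⟨y, hy⟩, hyo⟩ := exists_prime_orderOf_dvd_card' (G := ↥(M ⊓ N)) 2 h
    rw [Subgroup.orderOf_mk] at hyo
    exact D.eq_of_mem_maxlOver_three hx hyo hM hN hy.1 hy.2

theorem notMem_maxlOver_zero {x : G} (hx : orderOf x = 2) {M : Subgroup G} :
    M ∉ D.maxlOver 0 x := fun h => D.ncard_ne_zero h (D.ncard_over_of_orderOf_two hx 0)

/-- M and N are not Borels, which have odd order. If y² ≠ 1, then y lies in only one non-Borel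
maximal subgroup when it is in a torus, and if |y| = 3, two conjugates of A through y and x
coincide. -/
theorem mul_self_of_mem_inf {x : G} (hx : orderOf x = 2) {M N : Subgroup G}
    (hM : M ∈ maximalOver x) (hN : N ∈ maximalOver x) (hMN : M ≠ N) {y : G} (hy : y ∈ M ⊓ N) :
    y * y = 1 := by
  have hM0 : M ∉ D.maxlOver 0 y := fun h =>
    D.notMem_maxlOver_zero hx (D.mem_maxlOver_of_mem h hM.2)
  have hN0 : N ∉ D.maxlOver 0 y := fun h =>
    D.notMem_maxlOver_zero hx (D.mem_maxlOver_of_mem h hN.2)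
  have hMy : M ∈ maximalOver y := ⟨hM.1, hy.1⟩
  have hNy : N ∈ maximalOver y := ⟨hN.1, hy.2⟩
  by_contra hy2
  have hy1 : y ≠ 1 := by rintro rfl; simp at hy2
  apply hMN
  rcases D.orderOf_cases hy1 with h | ⟨g, hg⟩ | h | ⟨g, hg, h⟩
  · exact D.eq_of_mem_maxlOver_three h hx ((D.maxlOver_of_orderOf_three h hMy).resolve_left hM0)
      ((D.maxlOver_of_orderOf_three h hNy).resolve_left hN0) hM.2 hN.2
  · exact D.eq_of_ncard_eq_one (D.ncard_over_of_conj_mem_S hg hy1 1)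
      ((D.maxlOver_of_conj_mem_S hg hy1 hMy).resolve_left hM0)
      ((D.maxlOver_of_conj_mem_S hg hy1 hNy).resolve_left hN0)
  · exact absurd (orderOf_eq_two_iff_mul_self.1 h).1 hy2
  · exact D.eq_of_conj_mem_T hg h hMy hNy

theorem card_inf_of_orderOf_two {x : G} (hx : orderOf x = 2) {M N : Subgroup G}
    (hM : M ∈ maximalOver x) (hN : N ∈ maximalOver x) (hMN : M ≠ N) :
    Nat.card ↥(M ⊓ N) = 2 ∨ Nat.card ↥(M ⊓ N) = 4 := by
  have := D.finite
  have h2 : 2 ∣ Nat.card ↥(M ⊓ N) :=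
    hx ▸ Subgroup.orderOf_dvd_natCard (M ⊓ N) (x := x) ⟨hM.2, hN.2⟩
  obtain ⟨g, hg⟩ := D.exists_conj_mem_V (Q := M ⊓ N) fun y => ⟨1, by
    ext; simpa [pow_two] using D.mul_self_of_mem_inf hx hM hN hMN y.2⟩
  have h4 : Nat.card ↥(M ⊓ N) ∣ 4 := by
    rw [← D.card_V, ← Subgroup.card_conj_smul g (M ⊓ N)]
    exact Subgroup.card_dvd_of_le (Subgroup.conj_smul_le.2 hg)
  have hle := Nat.le_of_dvd (by norm_num) h4
  generalize Nat.card ↥(M ⊓ N) = n at h2 h4 hle ⊢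
  interval_cases n <;> omega

/-- Take M conjugate to `NS`: its order 8k + 2 is not divisible by 4. -/
theorem exists_card_inf_eq_two {x : G} (hx : orderOf x = 2) :
    ∃ M ∈ maximalOver x, ∃ N ∈ maximalOver x, M ≠ N ∧ Nat.card ↥(M ⊓ N) = 2 := by
  have := D.finite
  obtain ⟨M, hM⟩ : (D.maxlOver 1 x).Nonempty := by
    rw [← Set.ncard_pos, D.ncard_over_of_orderOf_two hx]
    exact Nat.succ_pos _
  obtain ⟨N, hN⟩ : (D.maxlOver 2 x).Nonempty := by
    rw [← Set.ncard_pos, D.ncard_over_of_orderOf_two hx]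
    exact Nat.succ_pos _
  have hM' := D.mem_maximalOver.2 ⟨1, hM⟩
  have hN' := D.mem_maximalOver.2 ⟨2, hN⟩
  have hMN : M ≠ N := by
    rintro rfl
    exact absurd (D.eq_of_mem_over hM hN) (by decide)
  refine ⟨M, hM', N, hN', hMN, ?_⟩
  refine (D.card_inf_of_orderOf_two hx hM' hN' hMN).resolve_right fun h => ?_
  have h1 := Subgroup.card_dvd_of_le (inf_le_left : M ⊓ N ≤ M)
  rw [D.card_of_mem_over hM, D.card_maxl, h] at h1
  change 4 ∣ 8 * k + 2 at h1
  omega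

/-- Take N = C(x), a conjugate of `NT`, and M a conjugate of A through x; the four-group of M
contains x, is abelian, and so lies in C(x). -/
theorem exists_card_inf_eq_four {x : G} (hx : orderOf x = 2) :
    ∃ M ∈ maximalOver x, ∃ N ∈ maximalOver x, M ≠ N ∧ Nat.card ↥(M ⊓ N) = 4 := by
  have := D.finite
  obtain ⟨M, hM⟩ : (D.maxlOver 3 x).Nonempty := by
    rw [← Set.ncard_pos, D.ncard_over_of_orderOf_two hx]
    exact Nat.succ_pos _
  obtain ⟨t, ht⟩ := D.exists_conj_mem_T hx
  have hcomm := D.comm_involution ht (by rwa [orderOf_conj])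
  have hceq := centralizer_eq_conj_smul hcomm
  have hN : Subgroup.centralizer {x} ∈ D.maxlOver 2 x :=
    ⟨Subgroup.mem_centralizer_singleton_iff.2 rfl, _, hceq⟩
  have hM' := D.mem_maximalOver.2 ⟨3, hM⟩
  have hN' := D.mem_maximalOver.2 ⟨2, hN⟩
  have hMN : M ≠ Subgroup.centralizer {x} := by
    intro h
    exact absurd (D.eq_of_mem_over hM (h ▸ hN)) (by decide)
  refine ⟨M, hM', _, hN', hMN, ?_⟩
  refine (D.card_inf_of_orderOf_two hx hM' hN' hMN).resolve_left fun h => ?_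
  obtain ⟨hxM, g, rfl⟩ := hM
  have hxV : g⁻¹ * x * g ∈ D.V := by
    refine D.mem_V_of_mem_A (Subgroup.mem_conj_smul.1 hxM) ?_
    calc g⁻¹ * x * g * (g⁻¹ * x * g) = g⁻¹ * (x * x) * g := by group
      _ = 1 := by rw [(orderOf_eq_two_iff_mul_self.1 hx).1]; group
  have hle : MulAut.conj g • D.V ≤ MulAut.conj g • D.maxl 3 ⊓ Subgroup.centralizer {x} := by
    refine le_inf (Subgroup.pointwise_smul_le_pointwise_smul_iff.2 D.V_le_A) fun y hy => ?_
    rw [Subgroup.mem_conj_smul] at hy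
    rw [Subgroup.mem_centralizer_singleton_iff, ← conj_commute g⁻¹, inv_inv]
    exact D.commute_of_mem_V hy hxV
  have h1 := Subgroup.card_dvd_of_le hle
  rw [Subgroup.card_conj_smul, D.card_V, h] at h1
  omega

theorem isSolvable_maxl (hB : Group.IsSolvable D.B) : ∀ a, Group.IsSolvable (D.maxl a)
  | 0 => hB
  | 1 => by
    change Group.IsSolvable D.NS
    have hidx : (D.S.subgroupOf D.NS).index = 2 := by
      have := D.finite
      have h1 := (D.S.subgroupOf D.NS).card_mul_index
      rw [Nat.card_congr (Subgroup.subgroupOfEquivOfLe D.S_le_NS).toEquiv, D.card_NS,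
        D.card_S] at h1
      exact Nat.eq_of_mul_eq_mul_left (show 0 < 4 * k + 1 by omega) (by omega)
    have := Subgroup.normal_of_index_eq_two hidx
    exact Subgroup.isSolvable_of_prime_index (N := D.S.subgroupOf D.NS)
      (fun a ha b hb => Subtype.ext (D.mul_comm_S ha hb)) (hidx ▸ Nat.prime_two)
  | 2 => by
    change Group.IsSolvable D.NT
    have hidx : (D.T.subgroupOf D.NT).index = 2 := by
      have := D.finite
      have h1 := (D.T.subgroupOf D.NT).card_mul_index
      rw [Nat.card_congr (Subgroup.subgroupOfEquivOfLe D.T_le).toEquiv, D.card_NT,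
        D.card_T] at h1
      exact Nat.eq_of_mul_eq_mul_left (show 0 < 4 * k + 2 by omega) (by omega)
    have := Subgroup.normal_of_index_eq_two hidx
    exact Subgroup.isSolvable_of_prime_index (N := D.T.subgroupOf D.NT)
      (fun a ha b hb => Subtype.ext (D.mul_comm_T ha hb)) (hidx ▸ Nat.prime_two)
  | 3 => by
    change Group.IsSolvable D.A
    have hidx : (D.V.subgroupOf D.A).index = 3 := by
      have h1 := (D.V.subgroupOf D.A).card_mul_index
      rw [Nat.card_congr (Subgroup.subgroupOfEquivOfLe D.V_le_A).toEquiv, D.card_A,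
        D.card_V] at h1
      omega
    have : (D.V.subgroupOf D.A).Normal := Subgroup.normal_in_normalizer
    exact Subgroup.isSolvable_of_prime_index (N := D.V.subgroupOf D.A)
      (fun a ha b hb => Subtype.ext (D.commute_of_mem_V ha hb)) (hidx ▸ Nat.prime_three)

theorem solubilizer_eq (hB : Group.IsSolvable D.B) (hG : ¬ Group.IsSolvable G) (x : G) :
    solubilizer x = ⋃ M ∈ maximalOver x, (M : Set G) := by
  ext y
  simp only [solubilizer, Set.mem_ofPred_eq, Set.mem_iUnion, SetLike.mem_coe, exists_prop]
  constructor
  · intro h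
    have hne : Subgroup.closure ({x, y} : Set G) ≠ ⊤ := by
      intro htop
      rw [htop] at h
      exact hG (Group.isSolvable_of_surjective (f := (Subgroup.topEquiv (G := G)).toMonoidHom)
        Subgroup.topEquiv.surjective)
    obtain ⟨a, g, hle⟩ := D.exists_le_maxl hne
    refine ⟨_, D.mem_maximalOver.2 ⟨a, hle (Subgroup.subset_closure (by simp)), g, rfl⟩,
      hle (Subgroup.subset_closure (by simp))⟩
  · rintro ⟨M, hM, hy⟩
    obtain ⟨a, hx, g, rfl⟩ := D.mem_maximalOver.1 hM
    have hle : Subgroup.closure ({x, y} : Set G) ≤ MulAut.conj g • D.maxl a := by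
      rw [Subgroup.closure_le]
      rintro z (rfl | rfl)
      · exact hx
      · exact hy
    have h1 := D.isSolvable_maxl hB a
    have h2 : Group.IsSolvable ↥(MulAut.conj g • D.maxl a) :=
      Group.isSolvable_of_surjective (f := (Subgroup.equivSMul (MulAut.conj g) (D.maxl a)).toMonoidHom)
        (Subgroup.equivSMul (MulAut.conj g) (D.maxl a)).surjective
    exact Group.isSolvable_of_isSolvable_injective (Subgroup.inclusion_injective hle)

theorem ncard_union_diff {x : G} (E : Set G) (c : Fin 4 → ℕ)
    (hE : ∀ M ∈ maximalOver x, ∀ N ∈ maximalOver x, M ≠ N → (M : Set G) ∩ N ⊆ E)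
    (hc : ∀ a, ∀ M ∈ D.maxlOver a x, ((M : Set G) \ E).ncard = c a) :
    ((⋃ M ∈ maximalOver x, (M : Set G)) \ E).ncard = ∑ a, (D.maxlOver a x).ncard * c a := by
  have := D.finite
  rw [← Subgroup.ncard_iUnion_diff (fun a => D.maxlOver a x) E c
    (fun a b M hM hM' => D.eq_of_mem_over hM hM')
    (fun a b M hM N hN => hE M (D.mem_maximalOver.2 ⟨a, hM⟩) N (D.mem_maximalOver.2 ⟨b, hN⟩)) hc]
  congr 2
  ext y
  simp only [Set.mem_iUnion, D.mem_maximalOver, exists_prop]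
  exact ⟨fun ⟨M, ⟨a, h⟩, hy⟩ => ⟨a, M, h, hy⟩, fun ⟨a, M, h, hy⟩ => ⟨M, ⟨a, h⟩, hy⟩⟩

theorem ncard_union_of_subset {x : G} {E : Set G}
    (h : E ⊆ ⋃ M ∈ maximalOver x, (M : Set G)) : (⋃ M ∈ maximalOver x, (M : Set G)).ncard =
      ((⋃ M ∈ maximalOver x, (M : Set G)) \ E).ncard + E.ncard := by
  have := D.finite
  exact (Set.ncard_sdiff_add_ncard_of_subset h (Set.toFinite _)).symm

theorem ncard_union_of_conj_mem_T {g x : G} (hx : g * x * g⁻¹ ∈ D.T) (hx2 : ¬ x * x = 1) :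
    (⋃ M ∈ maximalOver x, (M : Set G)).ncard = q + 1 := by
  obtain ⟨M, hM⟩ := Set.ncard_eq_one.1 (D.ncard_over_of_conj_mem_T hx hx2 2)
  have hMem : M ∈ D.maxlOver 2 x := by rw [hM]; rfl
  have : maximalOver x = {M} := by
    ext N
    rw [← hM]
    exact ⟨D.maxlOver_of_conj_mem_T hx hx2, fun h => D.mem_maximalOver.2 ⟨2, h⟩⟩
  rw [this, Set.biUnion_singleton, Subgroup.ncard_coe, D.card_of_mem_over hMem, D.card_maxl, D.q_eq]
  rfl

/-- With E = C(x) of order s = (q - 1)/2: two Borels and one dihedral group give 2(qs - s) + (2s -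
s) + s = 2qs. -/
theorem ncard_union_of_conj_mem_S {g x : G} (hx : g * x * g⁻¹ ∈ D.S) (hx1 : x ≠ 1) :
    (⋃ M ∈ maximalOver x, (M : Set G)).ncard = q * (q - 1) := by
  have hcard := D.card_centralizer_of_conj_mem_S hx hx1
  obtain ⟨M, hM⟩ := Set.ncard_eq_one.1 (D.ncard_over_of_conj_mem_S hx hx1 1)
  have hMem : M ∈ D.maxlOver 1 x := by rw [hM]; rfl
  have hM' := D.mem_maximalOver.2 ⟨1, hMem⟩
  rw [D.ncard_union_of_subset (E := Subgroup.centralizer {x}) fun y hy =>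
    Set.mem_biUnion hM' (D.centralizer_le_of_conj_mem_S hx hx1 hM' hy)]
  rw [D.ncard_union_diff _ (fun a => Nat.card (D.maxl a) - (4 * k + 1))
    (fun M hM N hN h => by
      rw [← D.inf_eq_centralizer hx hx1 hM hN h]
      exact subset_rfl)
    (fun a M hM => by
      rw [D.ncard_diff (D.centralizer_le_of_conj_mem_S hx hx1 (D.mem_maximalOver.2 ⟨a, hM⟩)),
        hcard, D.card_of_mem_over hM])]
  simp only [D.ncard_over_of_conj_mem_S hx hx1, D.card_maxl, Fin.sum_univ_four]
  rw [Subgroup.ncard_coe, hcard]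
  simp only [Matrix.cons_val, zero_mul, add_zero, one_mul]
  have hq := D.q_eq
  have h1 : q * (4 * k + 1) - (4 * k + 1) = (8 * k + 2) * (4 * k + 1) := by
    rw [hq, show (8 * k + 3) * (4 * k + 1) = (8 * k + 2) * (4 * k + 1) + (4 * k + 1) by ring]
    omega
  rw [h1, show 8 * k + 2 - (4 * k + 1) = 4 * k + 1 by omega, show q - 1 = 8 * k + 2 by omega, hq]
  ring

/-- With E = ⟨x⟩: one Borel and q/3 copies of A₄ give (q(4k + 1) - 3) + 9 · q/3 + 3 = q(4k + 4). -/
theorem ncard_union_of_orderOf_three {x : G} (hx : orderOf x = 3) :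
    (⋃ M ∈ maximalOver x, (M : Set G)).ncard = q * (q + 5) / 2 := by
  have := D.finite
  have hcard : Nat.card (Subgroup.zpowers x) = 3 := by rw [Nat.card_zpowers, hx]
  have hle {M : Subgroup G} (hM : M ∈ maximalOver x) : Subgroup.zpowers x ≤ M := by
    rw [Subgroup.zpowers_le]; exact hM.2
  obtain ⟨M, hM⟩ := Set.ncard_eq_one.1 (D.ncard_over_of_orderOf_three hx 0)
  have hMem : M ∈ D.maxlOver 0 x := by rw [hM]; rfl
  have hM' := D.mem_maximalOver.2 ⟨0, hMem⟩
  rw [D.ncard_union_of_subset (E := Subgroup.zpowers x) fun y hy => Set.mem_biUnion hM' (hle hM' hy)]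
  rw [D.ncard_union_diff _ (fun a => Nat.card (D.maxl a) - 3)
    (fun M hM N hN h => by
      rw [Subgroup.eq_of_le_of_card_ge (le_inf (hle hM) (hle hN))
        (by rw [D.card_inf_of_orderOf_three hx hM hN h, hcard])]
      exact subset_rfl)
    (fun a M hM => by
      rw [D.ncard_diff (hle (D.mem_maximalOver.2 ⟨a, hM⟩)), hcard, D.card_of_mem_over hM])]
  simp only [D.ncard_over_of_orderOf_three hx, D.card_maxl, Fin.sum_univ_four]
  rw [Subgroup.ncard_coe, hcard]
  simp only [Matrix.cons_val, zero_mul, add_zero, one_mul]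
  have hq := D.q_eq
  have hk := D.three_dvd
  have h1 : 3 ≤ q * (4 * k + 1) := by rw [hq]; nlinarith
  have h2 : q * (q + 5) / 2 = q * (4 * k + 4) := by
    rw [show q * (q + 5) = 2 * (q * (4 * k + 4)) by rw [hq]; ring]
    omega
  have h3 : q / 3 * (12 - 3) = 3 * q := by omega
  rw [h2, h3, show q * (4 * k + 4) = q * (4 * k + 1) + 3 * q by ring]
  omega

theorem ncard_involutions : {y : G | orderOf y = 2}.ncard = q * (4 * k + 1) := by
  have := D.finite
  have h := ncard_conj_mem (Set.univ : Set G) D.i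
  simp only [Set.mem_univ, true_and, D.isConj_iff_of_orderOf_two D.orderOf_i,
    D.card_centralizer_of_orderOf_two D.orderOf_i] at h
  have h1 : {g : G | True} = Set.univ := by ext; simp
  rw [h1, Set.ncard_univ, D.card] at h
  exact (Nat.eq_of_mul_eq_mul_right (by omega) h).symm

/-- Both x and y invert x y. If x y ≠ 1 is in a torus, they normalize that torus; it is not
unipotent, as x would then lie in a Borel subgroup of odd order. So all involutions lie in the
solubilizer of x. -/
theorem exists_maximalOver_of_involutions {x y : G} (hx : orderOf x = 2) (hy : orderOf y = 2) :
    ∃ M ∈ maximalOver x, y ∈ M := by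
  have := D.finite
  have hx' := orderOf_eq_two_iff_mul_self.1 hx
  have hy' := orderOf_eq_two_iff_mul_self.1 hy
  have hxi := mul_eq_one_iff_eq_inv.1 hx'.1
  have hyi := mul_eq_one_iff_eq_inv.1 hy'.1
  by_cases h1 : x * y = 1
  · obtain ⟨M, hM, -⟩ := D.exists_card_inf_eq_two hx
    refine ⟨M, hM, ?_⟩
    rw [hyi, ← eq_inv_of_mul_eq_one_left h1]
    exact hM.2
  · have hxr : x * (x * y) * x⁻¹ = (x * y)⁻¹ := by
      rw [mul_inv_rev, ← hxi, ← hyi, ← mul_assoc, hx'.1, one_mul]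
    have hyr : y * (x * y) * y⁻¹ = (x * y)⁻¹ := by
      rw [mul_inv_rev, ← hxi, ← hyi, mul_assoc, mul_assoc, hy'.1, mul_one]
    have hconj (g z : G) (hz : z * (x * y) * z⁻¹ = (x * y)⁻¹) :
        (g * z * g⁻¹) * (g * (x * y) * g⁻¹) * (g * z * g⁻¹)⁻¹ = (g * (x * y) * g⁻¹)⁻¹ := by
      calc _ = g * (z * (x * y) * z⁻¹) * g⁻¹ := by group
        _ = _ := by rw [hz, conj_inv]
    have hmem {a : Fin 4} {g z : G} (hz : g * z * g⁻¹ ∈ D.maxl a) :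
        z ∈ MulAut.conj g⁻¹ • D.maxl a := by
      rwa [Subgroup.mem_conj_smul, inv_inv]
    obtain ⟨g, h | h | h⟩ := D.cover (x * y)
    · exfalso
      have h2 := D.conj_U_iff _ h (by rwa [Ne, conj_eq_one]) (g * x * g⁻¹)
        (by rw [hconj g x hxr]; exact D.U.inv_mem h)
      have h3 := Subgroup.orderOf_dvd_natCard _ h2
      rw [orderOf_conj, hx, D.card_B] at h3
      exact D.odd_card_B.not_two_dvd_nat h3
    · have h2 := D.conj_S_iff _ h (by rwa [Ne, conj_eq_one]) (g * x * g⁻¹)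
        (by rw [hconj g x hxr]; exact D.S.inv_mem h)
      have h3 := D.conj_S_iff _ h (by rwa [Ne, conj_eq_one]) (g * y * g⁻¹)
        (by rw [hconj g y hyr]; exact D.S.inv_mem h)
      exact ⟨_, D.mem_maximalOver.2 ⟨1, hmem h2, _, rfl⟩, hmem (a := 1) h3⟩
    · have h2 := D.conj_T_iff _ h (by rwa [Ne, conj_eq_one]) (g * x * g⁻¹)
        (by rw [hconj g x hxr]; exact D.T.inv_mem h)
      have h3 := D.conj_T_iff _ h (by rwa [Ne, conj_eq_one]) (g * y * g⁻¹)
        (by rw [hconj g y hyr]; exact D.T.inv_mem h)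
      exact ⟨_, D.mem_maximalOver.2 ⟨2, hmem h2, _, rfl⟩, hmem (a := 2) h3⟩

theorem ncard_conj_smul_diff_involutions (g : G) (X : Subgroup G) :
    (((MulAut.conj g • X : Subgroup G) : Set G) \ {y | y * y = 1}).ncard =
      Nat.card X - ({y | y ∈ X ∧ orderOf y = 2}.ncard + 1) := by
  have := D.finite
  have h1 : ((MulAut.conj g • X : Subgroup G) : Set G) \ {y | y * y = 1} =
      (fun y => g * y * g⁻¹) '' ((X : Set G) \ insert 1 {y | y ∈ X ∧ orderOf y = 2}) := by
    ext y
    simp only [Set.mem_sdiff, SetLike.mem_coe, Subgroup.mem_conj_smul, Set.mem_ofPred_eq,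
      Set.mem_insert_iff, Set.mem_image, orderOf_eq_two_iff_mul_self, not_or, not_and, not_not]
    constructor
    · rintro ⟨hy, hy2⟩
      refine ⟨g⁻¹ * y * g, ⟨hy, ?_, ?_⟩, by group⟩
      · intro h
        apply hy2
        have : y = g * (g⁻¹ * y * g) * g⁻¹ := by group
        rw [this, h]; group
      · intro _ h
        exfalso
        apply hy2
        have : y * y = g * (g⁻¹ * y * g * (g⁻¹ * y * g)) * g⁻¹ := by group
        rw [this, h]; group
    · rintro ⟨z, ⟨hz, hz1, hz2⟩, rfl⟩
      refine ⟨by simpa [mul_assoc] using hz, fun h => hz1 (hz2 hz ?_)⟩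
      rwa [← pow_two, conj_pow, conj_eq_one, pow_two] at h
  have hsub : insert 1 {y | y ∈ X ∧ orderOf y = 2} ⊆ (X : Set G) := by
    rintro y (rfl | hy)
    · exact X.one_mem
    · exact hy.1
  rw [h1, Set.ncard_image_of_injective _ (fun a b h => by simpa using h),
    Set.ncard_sdiff hsub (Set.toFinite _), Set.ncard_insert_of_notMem (by simp) (Set.toFinite _)]
  rfl

/-- Intersections have order 2 or 4, so E is taken to be all solutions of y² = 1, which the union
contains. Outside E, conjugates of `NS`, `NT` and A have 4k, 4k and 8 elements. -/
theorem ncard_union_of_orderOf_two {x : G} (hx : orderOf x = 2) :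
    (⋃ M ∈ maximalOver x, (M : Set G)).ncard = q * (q + 1) := by
  have := D.finite
  have hE : {y : G | y * y = 1} = insert 1 {y | orderOf y = 2} := by
    ext y
    simp only [Set.mem_ofPred_eq, Set.mem_insert_iff, orderOf_eq_two_iff_mul_self]
    by_cases h : y = 1 <;> simp [h]
  have hEc : {y : G | y * y = 1}.ncard = q * (4 * k + 1) + 1 := by
    rw [hE, Set.ncard_insert_of_notMem (by simp) (Set.toFinite _), D.ncard_involutions]
  rw [D.ncard_union_of_subset (E := {y | y * y = 1}) fun y hy => by
    have hex : ∃ M ∈ maximalOver x, y ∈ M := by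
      rw [hE] at hy
      rcases hy with rfl | hy
      · obtain ⟨M, hM, -⟩ := D.exists_card_inf_eq_two hx
        exact ⟨M, hM, M.one_mem⟩
      · exact D.exists_maximalOver_of_involutions hx hy
    obtain ⟨M, hM, hy⟩ := hex
    exact Set.mem_biUnion hM hy]
  rw [D.ncard_union_diff {y | y * y = 1} ![0, 4 * k, 4 * k, 8]
    (fun M hM N hN h y hy => D.mul_self_of_mem_inf hx hM hN h hy)]
  · simp only [D.ncard_over_of_orderOf_two hx, Fin.sum_univ_four]
    rw [hEc, D.q_eq]
    simp only [Matrix.cons_val, zero_mul, zero_add]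
    ring
  · intro a M hM
    match a with
    | 0 => exact absurd hM (D.notMem_maxlOver_zero hx)
    | 1 =>
      obtain ⟨-, g, rfl⟩ := hM
      rw [D.ncard_conj_smul_diff_involutions, show D.maxl 1 = D.NS from rfl, D.card_NS,
        D.ncard_involutions_NS]
      change _ = 4 * k
      omega
    | 2 =>
      obtain ⟨-, g, rfl⟩ := hM
      rw [D.ncard_conj_smul_diff_involutions, show D.maxl 2 = D.NT from rfl, D.card_NT,
        D.ncard_involutions_NT]
      change _ = 4 * k
      omega
    | 3 =>
      obtain ⟨-, g, rfl⟩ := hM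
      rw [D.ncard_conj_smul_diff_involutions, show D.maxl 3 = D.A from rfl, D.card_A,
        D.ncard_involutions_A]
      rfl

end PSLTwoData

end Intersections

/-! ### Subgroups of SL(2, F) and their images in PSL(2, F). -/

section Matrices

open Matrix

theorem Subgroup.card_eq_two_mul_card {G : Type*} [Group G] [Finite G] {H K : Subgroup G}
    (hHK : H ≤ K) {n : G} (hn : n ∈ K) (hnH : n ∉ H) (h : ∀ a ∈ K, a ∉ H → n⁻¹ * a ∈ H) :
    Nat.card K = 2 * Nat.card H := by
  have hK : (K : Set G) = (H : Set G) ∪ (n * ·) '' (H : Set G) := by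
    ext a
    constructor
    · intro ha
      by_cases haH : a ∈ H
      · exact .inl haH
      · exact .inr ⟨n⁻¹ * a, h a ha haH, by simp⟩
    · rintro (ha | ⟨b, hb, rfl⟩)
      · exact hHK ha
      · exact K.mul_mem hn (hHK hb)
  rw [← Subgroup.ncard_coe K, hK, Set.ncard_union_eq _ (Set.toFinite _) (Set.toFinite _),
    Set.ncard_mul_left, Subgroup.ncard_coe, two_mul]
  rw [Set.disjoint_left]
  rintro _ ha ⟨b, hb, rfl⟩
  exact hnH ((H.mul_mem_cancel_right hb).1 ha)

namespace PSLTwo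

variable {F : Type*} [Field F]

/-- The matrix with given entries as an element of `SL(2, F)`. -/
def sl (a b c d : F) (h : a * d - b * c = 1) : SpecialLinearGroup (Fin 2) F :=
  ⟨!![a, b; c, d], by rw [det_fin_two_of, h]⟩

theorem exists_sl (A : SpecialLinearGroup (Fin 2) F) : ∃ a b c d h, A = sl a b c d h := by
  refine ⟨A 0 0, A 0 1, A 1 0, A 1 1, ?_, ?_⟩
  · rw [← det_fin_two]; exact A.2
  · ext i j
    fin_cases i <;> fin_cases j <;> rfl

theorem sl_inj {a b c d a' b' c' d' : F} {h h'} :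
    sl a b c d h = sl a' b' c' d' h' ↔ a = a' ∧ b = b' ∧ c = c' ∧ d = d' := by
  constructor
  · intro e
    exact ⟨congrArg (fun A : SpecialLinearGroup (Fin 2) F => A 0 0) e,
      congrArg (fun A : SpecialLinearGroup (Fin 2) F => A 0 1) e,
      congrArg (fun A : SpecialLinearGroup (Fin 2) F => A 1 0) e,
      congrArg (fun A : SpecialLinearGroup (Fin 2) F => A 1 1) e⟩
  · rintro ⟨rfl, rfl, rfl, rfl⟩
    rfl

theorem coe_sl {a b c d : F} {h} : (sl a b c d h : Matrix (Fin 2) (Fin 2) F) = !![a, b; c, d] := rfl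

theorem sl_mul {a b c d a' b' c' d' : F} {h h'} : sl a b c d h * sl a' b' c' d' h' =
    sl (a * a' + b * c') (a * b' + b * d') (c * a' + d * c') (c * b' + d * d')
      (by linear_combination h * (a' * d' - b' * c') + h') := by
  apply Subtype.ext
  rw [Matrix.SpecialLinearGroup.coe_mul, coe_sl, coe_sl, coe_sl, mul_fin_two]

theorem sl_inv {a b c d : F} {h} :
    (sl a b c d h)⁻¹ = sl d (-b) (-c) a (by linear_combination h) := by
  apply Subtype.ext
  rw [Matrix.SpecialLinearGroup.coe_inv, coe_sl, coe_sl, adjugate_fin_two_of]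

theorem sl_neg {a b c d : F} {h} :
    -(sl a b c d h) = sl (-a) (-b) (-c) (-d) (by linear_combination h) := by
  apply Subtype.ext
  rw [Matrix.SpecialLinearGroup.coe_neg, coe_sl, coe_sl]
  simp

theorem sl_one : (1 : SpecialLinearGroup (Fin 2) F) = sl 1 0 0 1 (by ring) := by
  apply Subtype.ext
  rw [Matrix.SpecialLinearGroup.coe_one, coe_sl, one_fin_two]

/-- The projection from `SL(2, F)` to `PSL(2, F)`. -/
def proj : SpecialLinearGroup (Fin 2) F →* ProjectiveSpecialLinearGroup (Fin 2) F :=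
  QuotientGroup.mk' _

theorem proj_surjective : Function.Surjective (proj (F := F)) := QuotientGroup.mk'_surjective _

theorem mem_center {A : SpecialLinearGroup (Fin 2) F} :
    A ∈ Subgroup.center (SpecialLinearGroup (Fin 2) F) ↔ A = 1 ∨ A = -1 := by
  constructor
  · intro hA
    rw [Subgroup.mem_center_iff] at hA
    obtain ⟨a, b, c, d, h, rfl⟩ := exists_sl A
    -- Commuting with the two elementary transvections already forces a scalar matrix.
    have h1 := hA (sl 1 1 0 1 (by ring))
    have h2 := hA (sl 1 0 1 1 (by ring))
    rw [sl_mul, sl_mul, sl_inj] at h1 h2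
    have hc : c = 0 := by linear_combination h1.1
    have hb : b = 0 := by linear_combination -h2.1
    have had : a = d := by linear_combination -h1.2.1
    subst hc hb had
    have : (a - 1) * (a + 1) = 0 := by linear_combination h
    rw [sl_one, sl_neg, sl_inj, sl_inj]
    rcases mul_eq_zero.1 this with h | h
    · left; simp [sub_eq_zero.1 h]
    · right; simp [eq_neg_of_add_eq_zero_left h]
  · rintro (rfl | rfl)
    · exact Subgroup.one_mem _
    · rw [Subgroup.mem_center_iff]
      simp

theorem proj_eq_iff {A B : SpecialLinearGroup (Fin 2) F} : proj A = proj B ↔ A = B ∨ A = -B := by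
  have : proj A = proj B ↔ A⁻¹ * B ∈ Subgroup.center (SpecialLinearGroup (Fin 2) F) :=
    QuotientGroup.eq
  rw [this, mem_center, inv_mul_eq_one, inv_mul_eq_iff_eq_mul, mul_neg, mul_one]
  refine or_congr_right ⟨fun h => ?_, fun h => ?_⟩ <;> simp [h]

/-- A subgroup containing -1 is a full preimage, so membership in PSL can be read off matrix
entries. -/
theorem proj_mem_map {H : Subgroup (SpecialLinearGroup (Fin 2) F)} (hH : -1 ∈ H)
    {A : SpecialLinearGroup (Fin 2) F} : proj A ∈ H.map proj ↔ A ∈ H := by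
  constructor
  · rintro ⟨B, hB, h⟩
    rcases proj_eq_iff.1 h with rfl | rfl
    · exact hB
    · simpa using H.mul_mem hH hB
  · intro h
    exact ⟨A, h, rfl⟩

theorem neg_one_ne_one (h2 : (2 : F) ≠ 0) : (-1 : SpecialLinearGroup (Fin 2) F) ≠ 1 := by
  rw [sl_one, sl_neg, Ne, sl_inj]
  rintro ⟨h, -⟩
  apply h2
  linear_combination -h

theorem card_map_proj [Finite F] (h2 : (2 : F) ≠ 0) {H : Subgroup (SpecialLinearGroup (Fin 2) F)}
    (hH : -1 ∈ H) : 2 * Nat.card (H.map proj) = Nat.card H := by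
  have := Set.ncard_eq_mul_of_fibers (proj (F := F)) (s := (H : Set _))
    (t := ((H.map proj : Subgroup _) : Set _)) (n := 2) (fun A hA => Subgroup.mem_map_of_mem _ hA)
    (Set.Finite.image _ (Set.toFinite _)) ?_
  · rw [Subgroup.ncard_coe, Subgroup.ncard_coe] at this
    rw [this, mul_comm]
  · rintro _ ⟨A, hA, rfl⟩
    rw [Set.ncard_eq_two]
    refine ⟨A, -A, ?_, ?_⟩
    · intro h
      apply neg_one_ne_one h2
      have : A⁻¹ * A = A⁻¹ * -A := by rw [← h]
      simpa using this.symm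
    · ext B
      simp only [Set.mem_ofPred_eq, SetLike.mem_coe, proj_eq_iff, Set.mem_insert_iff,
        Set.mem_singleton_iff]
      constructor
      · exact fun h => h.2
      · rintro (rfl | rfl)
        · exact ⟨hA, .inl rfl⟩
        · exact ⟨by simpa using H.mul_mem hH hA, .inr rfl⟩

/-- Upper triangular matrices. -/
def bor (F : Type*) [Field F] : Subgroup (SpecialLinearGroup (Fin 2) F) where
  carrier := {A | A 1 0 = 0}
  one_mem' := by simp
  mul_mem' {A B} hA hB := by
    obtain ⟨a, b, c, d, h, rfl⟩ := exists_sl A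
    obtain ⟨a', b', c', d', h', rfl⟩ := exists_sl B
    rw [sl_mul]
    change c = 0 at hA
    change c' = 0 at hB
    change (c * a' + d * c') = 0
    simp [hA, hB]
  inv_mem' {A} hA := by
    obtain ⟨a, b, c, d, h, rfl⟩ := exists_sl A
    rw [sl_inv]
    change c = 0 at hA
    change (-c) = 0
    simp [hA]

theorem mem_bor {a b c d : F} {h} : sl a b c d h ∈ bor F ↔ c = 0 := Iff.rfl

/-- Upper triangular matrices with a double eigenvalue. -/
def uni (F : Type*) [Field F] : Subgroup (SpecialLinearGroup (Fin 2) F) where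
  carrier := {A | A 1 0 = 0 ∧ A 0 0 = A 1 1}
  one_mem' := by simp
  mul_mem' {A B} hA hB := by
    obtain ⟨a, b, c, d, h, rfl⟩ := exists_sl A
    obtain ⟨a', b', c', d', h', rfl⟩ := exists_sl B
    rw [sl_mul]
    change c = 0 ∧ a = d at hA
    change c' = 0 ∧ a' = d' at hB
    change (c * a' + d * c') = 0 ∧ a * a' + b * c' = (c * b' + d * d')
    simp [hA, hB]
  inv_mem' {A} hA := by
    obtain ⟨a, b, c, d, h, rfl⟩ := exists_sl A
    rw [sl_inv]
    change c = 0 ∧ a = d at hA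
    change (-c) = 0 ∧ d = a
    simp [hA]

theorem mem_uni {a b c d : F} {h} : sl a b c d h ∈ uni F ↔ c = 0 ∧ a = d := Iff.rfl

/-- Diagonal matrices. -/
def spl (F : Type*) [Field F] : Subgroup (SpecialLinearGroup (Fin 2) F) where
  carrier := {A | A 0 1 = 0 ∧ A 1 0 = 0}
  one_mem' := by simp
  mul_mem' {A B} hA hB := by
    obtain ⟨a, b, c, d, h, rfl⟩ := exists_sl A
    obtain ⟨a', b', c', d', h', rfl⟩ := exists_sl B
    rw [sl_mul]
    change b = 0 ∧ c = 0 at hA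
    change b' = 0 ∧ c' = 0 at hB
    change (a * b' + b * d') = 0 ∧ (c * a' + d * c') = 0
    simp [hA, hB]
  inv_mem' {A} hA := by
    obtain ⟨a, b, c, d, h, rfl⟩ := exists_sl A
    rw [sl_inv]
    change b = 0 ∧ c = 0 at hA
    change -b = 0 ∧ (-c) = 0
    simp [hA]

theorem mem_spl {a b c d : F} {h} : sl a b c d h ∈ spl F ↔ b = 0 ∧ c = 0 := Iff.rfl

/-- Monomial matrices. -/
def mono (F : Type*) [Field F] : Subgroup (SpecialLinearGroup (Fin 2) F) where
  carrier := {A | (A 0 1 = 0 ∧ A 1 0 = 0) ∨ (A 0 0 = 0 ∧ A 1 1 = 0)}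
  one_mem' := by simp
  mul_mem' {A B} hA hB := by
    obtain ⟨a, b, c, d, h, rfl⟩ := exists_sl A
    obtain ⟨a', b', c', d', h', rfl⟩ := exists_sl B
    rw [sl_mul]
    change (b = 0 ∧ c = 0) ∨ (a = 0 ∧ d = 0) at hA
    change (b' = 0 ∧ c' = 0) ∨ (a' = 0 ∧ d' = 0) at hB
    change ((a * b' + b * d') = 0 ∧ (c * a' + d * c') = 0) ∨ (a * a' + b * c' = 0 ∧ (c * b' + d * d') = 0)
    rcases hA with hA | hA <;> rcases hB with hB | hB <;> simp [hA, hB]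
  inv_mem' {A} hA := by
    obtain ⟨a, b, c, d, h, rfl⟩ := exists_sl A
    rw [sl_inv]
    change (b = 0 ∧ c = 0) ∨ (a = 0 ∧ d = 0) at hA
    change (-b = 0 ∧ (-c) = 0) ∨ (d = 0 ∧ a = 0)
    rcases hA with hA | hA <;> simp [hA]

theorem mem_mono {a b c d : F} {h} :
    sl a b c d h ∈ mono F ↔ (b = 0 ∧ c = 0) ∨ (a = 0 ∧ d = 0) := Iff.rfl

/-- Rotation matrices. -/
def rot (F : Type*) [Field F] : Subgroup (SpecialLinearGroup (Fin 2) F) where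
  carrier := {A | A 0 0 = A 1 1 ∧ A 0 1 = - A 1 0}
  one_mem' := by simp
  mul_mem' {A B} hA hB := by
    obtain ⟨a, b, c, d, h, rfl⟩ := exists_sl A
    obtain ⟨a', b', c', d', h', rfl⟩ := exists_sl B
    rw [sl_mul]
    change a = d ∧ b = -c at hA
    change a' = d' ∧ b' = -c' at hB
    change a * a' + b * c' = (c * b' + d * d') ∧ (a * b' + b * d') = -(c * a' + d * c')
    obtain ⟨rfl, rfl⟩ := hA
    obtain ⟨rfl, rfl⟩ := hB
    constructor <;> ring
  inv_mem' {A} hA := by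
    obtain ⟨a, b, c, d, h, rfl⟩ := exists_sl A
    rw [sl_inv]
    change a = d ∧ b = -c at hA
    change d = a ∧ -b = -(-c)
    simp [hA]

theorem mem_rot {a b c d : F} {h} : sl a b c d h ∈ rot F ↔ a = d ∧ b = -c := Iff.rfl

/-- The normalizer of the rotation matrices. -/
def nrot (F : Type*) [Field F] : Subgroup (SpecialLinearGroup (Fin 2) F) where
  carrier := {A | (A 0 0 = A 1 1 ∧ A 0 1 = - A 1 0) ∨ (A 0 0 = -A 1 1 ∧ A 0 1 = A 1 0)}
  one_mem' := by simp
  mul_mem' {A B} hA hB := by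
    obtain ⟨a, b, c, d, h, rfl⟩ := exists_sl A
    obtain ⟨a', b', c', d', h', rfl⟩ := exists_sl B
    rw [sl_mul]
    change (a = d ∧ b = -c) ∨ (a = -d ∧ b = c) at hA
    change (a' = d' ∧ b' = -c') ∨ (a' = -d' ∧ b' = c') at hB
    change (a * a' + b * c' = (c * b' + d * d') ∧ (a * b' + b * d') = -(c * a' + d * c')) ∨ (a * a' + b * c' = -(c * b' + d * d') ∧ (a * b' + b * d') = (c * a' + d * c'))
    rcases hA with ⟨rfl, rfl⟩ | ⟨rfl, rfl⟩ <;> rcases hB with ⟨rfl, rfl⟩ | ⟨rfl, rfl⟩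
    · left; constructor <;> ring
    · right; constructor <;> ring
    · right; constructor <;> ring
    · left; constructor <;> ring
  inv_mem' {A} hA := by
    obtain ⟨a, b, c, d, h, rfl⟩ := exists_sl A
    rw [sl_inv]
    change (a = d ∧ b = -c) ∨ (a = -d ∧ b = c) at hA
    change (d = a ∧ -b = -(-c)) ∨ (d = -a ∧ -b = (-c))
    rcases hA with hA | hA <;> simp [hA]

theorem mem_nrot {a b c d : F} {h} :
    sl a b c d h ∈ nrot F ↔ (a = d ∧ b = -c) ∨ (a = -d ∧ b = c) := Iff.rfl

theorem neg_one_eq : (-1 : SpecialLinearGroup (Fin 2) F) = sl (-1) 0 0 (-1) (by ring) := by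
  rw [sl_one, sl_neg, sl_inj]; simp

theorem neg_one_mem_bor : -1 ∈ bor F := by rw [neg_one_eq, mem_bor]
theorem neg_one_mem_uni : -1 ∈ uni F := by rw [neg_one_eq, mem_uni]; simp
theorem neg_one_mem_spl : -1 ∈ spl F := by rw [neg_one_eq, mem_spl]; simp
theorem neg_one_mem_mono : -1 ∈ mono F := by rw [neg_one_eq, mem_mono]; simp
theorem neg_one_mem_rot : -1 ∈ rot F := by rw [neg_one_eq, mem_rot]; simp
theorem neg_one_mem_nrot : -1 ∈ nrot F := by rw [neg_one_eq, mem_nrot]; simp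

theorem exists_proj_sl (x : ProjectiveSpecialLinearGroup (Fin 2) F) :
    ∃ a b c d h, x = proj (sl a b c d h) := by
  obtain ⟨A, rfl⟩ := proj_surjective x
  obtain ⟨a, b, c, d, h, rfl⟩ := exists_sl A
  exact ⟨a, b, c, d, h, rfl⟩

theorem proj_sl_eq_iff {a b c d a' b' c' d' : F} {h h'} :
    proj (sl a b c d h) = proj (sl a' b' c' d' h') ↔
      (a = a' ∧ b = b' ∧ c = c' ∧ d = d') ∨ (a = -a' ∧ b = -b' ∧ c = -c' ∧ d = -d') := by
  rw [proj_eq_iff, sl_neg, sl_inj, sl_inj]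

theorem proj_sl_mem_bor {a b c d : F} {h} : proj (sl a b c d h) ∈ (bor F).map proj ↔ c = 0 := by
  rw [proj_mem_map neg_one_mem_bor, mem_bor]

theorem proj_sl_mem_uni {a b c d : F} {h} :
    proj (sl a b c d h) ∈ (uni F).map proj ↔ c = 0 ∧ a = d := by
  rw [proj_mem_map neg_one_mem_uni, mem_uni]

theorem proj_sl_mem_spl {a b c d : F} {h} :
    proj (sl a b c d h) ∈ (spl F).map proj ↔ b = 0 ∧ c = 0 := by
  rw [proj_mem_map neg_one_mem_spl, mem_spl]

theorem proj_sl_mem_mono {a b c d : F} {h} :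
    proj (sl a b c d h) ∈ (mono F).map proj ↔ (b = 0 ∧ c = 0) ∨ (a = 0 ∧ d = 0) := by
  rw [proj_mem_map neg_one_mem_mono, mem_mono]

theorem proj_sl_mem_rot {a b c d : F} {h} :
    proj (sl a b c d h) ∈ (rot F).map proj ↔ a = d ∧ b = -c := by
  rw [proj_mem_map neg_one_mem_rot, mem_rot]

theorem proj_sl_mem_nrot {a b c d : F} {h} :
    proj (sl a b c d h) ∈ (nrot F).map proj ↔ (a = d ∧ b = -c) ∨ (a = -d ∧ b = c) := by
  rw [proj_mem_map neg_one_mem_nrot, mem_nrot]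

end PSLTwo

end Matrices

/-! ### Parametrizations and orders of the matrix subgroups. -/

section Matrices

open Matrix

namespace PSLTwo

variable {F : Type*} [Field F]

theorem mem_map_uni {x : ProjectiveSpecialLinearGroup (Fin 2) F} :
    x ∈ (uni F).map proj ↔ ∃ b, x = proj (sl 1 b 0 1 (by ring)) := by
  constructor
  · obtain ⟨a, b, c, d, h, rfl⟩ := exists_proj_sl x
    rw [proj_sl_mem_uni]
    rintro ⟨rfl, rfl⟩
    have : (a - 1) * (a + 1) = 0 := by linear_combination h
    rcases mul_eq_zero.1 this with h | h
    · exact ⟨b, proj_sl_eq_iff.2 (.inl (by simp [sub_eq_zero.1 h]))⟩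
    · exact ⟨-b, proj_sl_eq_iff.2 (.inr (by simp [eq_neg_of_add_eq_zero_left h]))⟩
  · rintro ⟨b, rfl⟩
    exact proj_sl_mem_uni.2 ⟨rfl, rfl⟩

theorem mem_map_spl {x : ProjectiveSpecialLinearGroup (Fin 2) F} :
    x ∈ (spl F).map proj ↔ ∃ a d h, x = proj (sl a 0 0 d h) := by
  constructor
  · obtain ⟨a, b, c, d, h, rfl⟩ := exists_proj_sl x
    rw [proj_sl_mem_spl]
    rintro ⟨rfl, rfl⟩
    exact ⟨a, d, h, rfl⟩
  · rintro ⟨a, d, h, rfl⟩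
    exact proj_sl_mem_spl.2 ⟨rfl, rfl⟩

theorem mem_map_rot {x : ProjectiveSpecialLinearGroup (Fin 2) F} :
    x ∈ (rot F).map proj ↔ ∃ a b h, x = proj (sl a b (-b) a h) := by
  constructor
  · obtain ⟨a, b, c, d, h, rfl⟩ := exists_proj_sl x
    rw [proj_sl_mem_rot]
    rintro ⟨rfl, rfl⟩
    exact ⟨a, -c, by linear_combination h, by simp⟩
  · rintro ⟨a, b, h, rfl⟩
    exact proj_sl_mem_rot.2 ⟨rfl, by simp⟩

/-- The diagonal embedding of the multiplicative group of `F`. -/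
def diag (F : Type*) [Field F] : Fˣ →* SpecialLinearGroup (Fin 2) F where
  toFun a := sl a 0 0 (a⁻¹ : Fˣ) (by simp)
  map_one' := by simp [sl_one]
  map_mul' a b := by rw [sl_mul, sl_inj]; simp [mul_comm]

theorem diag_apply (a : Fˣ) : diag F a = sl (a : F) 0 0 (a⁻¹ : Fˣ) (by simp) := rfl

theorem diag_injective : Function.Injective (diag F) := fun a b h => by
  rw [diag_apply, diag_apply, sl_inj] at h
  exact Units.ext h.1

theorem range_diag : (diag F).range = spl F := by
  ext A
  constructor
  · rintro ⟨a, rfl⟩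
    rw [diag_apply, mem_spl]
    simp
  · obtain ⟨a, b, c, d, h, rfl⟩ := exists_sl A
    rw [mem_spl]
    rintro ⟨rfl, rfl⟩
    have h' : a * d = 1 := by linear_combination h
    refine ⟨⟨a, d, h', by rw [mul_comm, h']⟩, ?_⟩
    rw [diag_apply, sl_inj]
    simp

theorem card_spl : Nat.card (spl F) = Nat.card F - 1 := by
  rw [← range_diag, ← Nat.card_units, Nat.card_congr (MonoidHom.ofInjective diag_injective).toEquiv]

theorem card_map_uni (h2 : (2 : F) ≠ 0) : Nat.card ((uni F).map proj) = Nat.card F := by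
  refine (Nat.card_eq_of_bijective (fun b : F => (⟨proj (sl 1 b 0 1 (by ring)),
    proj_sl_mem_uni.2 ⟨rfl, rfl⟩⟩ : (uni F).map proj)) ⟨fun b c h => ?_, ?_⟩).symm
  · rcases proj_sl_eq_iff.1 (congrArg Subtype.val h) with h | h
    · exact h.2.1
    · exact absurd (by linear_combination h.1) h2
  · rintro ⟨x, hx⟩
    obtain ⟨b, rfl⟩ := mem_map_uni.1 hx
    exact ⟨b, rfl⟩

theorem card_bor : Nat.card (bor F) = (Nat.card F - 1) * Nat.card F := by
  rw [← Nat.card_units, ← Nat.card_prod]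
  refine (Nat.card_eq_of_bijective (fun p : Fˣ × F => (⟨sl (p.1 : F) p.2 0 (p.1⁻¹ : Fˣ) (by simp),
    mem_bor.2 rfl⟩ : bor F)) ⟨?_, ?_⟩).symm
  · rintro ⟨a, b⟩ ⟨c, d⟩ h
    have h1 := Subtype.ext_iff.1 h
    dsimp only [Option.elim] at h1
    rw [sl_inj] at h1
    exact Prod.ext (Units.ext h1.1) h1.2.1
  · rintro ⟨A, hA⟩
    obtain ⟨a, b, c, d, h, rfl⟩ := exists_sl A
    obtain rfl : c = 0 := hA
    have h' : a * d = 1 := by linear_combination h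
    refine ⟨(⟨a, d, h', by rw [mul_comm, h']⟩, b), Subtype.ext ?_⟩
    simp

variable [Finite F]

/-- Off the Borel subgroup, a, d and c ≠ 0 are free and determine b. -/
theorem card_sl : Nat.card (SpecialLinearGroup (Fin 2) F) =
    (Nat.card F - 1) * Nat.card F * (Nat.card F + 1) := by
  have h : ((bor F : Set (SpecialLinearGroup (Fin 2) F))ᶜ).ncard =
      Nat.card F * Nat.card F * (Nat.card F - 1) := by
    rw [← Nat.card_units, ← Nat.card_prod, ← Nat.card_prod, ← Nat.card_coe_set_eq]
    refine (Nat.card_eq_of_bijective (fun p : (F × F) × Fˣ =>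
      (⟨sl p.1.1 ((p.1.1 * p.1.2 - 1) / p.2) p.2 p.1.2 (by field_simp; ring),
        fun h => p.2.ne_zero (mem_bor.1 h)⟩ :
          ((bor F : Set (SpecialLinearGroup (Fin 2) F))ᶜ : Set _))) ⟨?_, ?_⟩).symm
    · rintro ⟨⟨a, d⟩, c⟩ ⟨⟨a', d'⟩, c'⟩ h
      have h0 := Subtype.ext_iff.1 h
      dsimp only [Option.elim] at h0
      rw [sl_inj] at h0
      obtain ⟨h1, -, h2, h3⟩ := h0
      exact Prod.ext (Prod.ext h1 h3) (Units.ext h2)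
    · rintro ⟨A, hA⟩
      obtain ⟨a, b, c, d, h, rfl⟩ := exists_sl A
      have hc : c ≠ 0 := fun h => hA (mem_bor.2 h)
      refine ⟨((a, d), Units.mk0 c hc), Subtype.ext ?_⟩
      rw [sl_inj]
      refine ⟨rfl, ?_, rfl, rfl⟩
      simp only [Units.val_mk0]
      field_simp
      linear_combination h
  rw [← Set.ncard_add_ncard_compl (bor F : Set (SpecialLinearGroup (Fin 2) F)), h,
    Subgroup.ncard_coe, card_bor]
  ring

theorem card_psl (h2 : (2 : F) ≠ 0) : 2 * Nat.card (ProjectiveSpecialLinearGroup (Fin 2) F) =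
    (Nat.card F - 1) * Nat.card F * (Nat.card F + 1) := by
  rw [← card_sl, ← Subgroup.card_top (G := SpecialLinearGroup (Fin 2) F),
    ← card_map_proj h2 (Subgroup.mem_top _),
    Subgroup.map_top_of_surjective _ proj_surjective, Subgroup.card_top]

theorem card_mono : Nat.card (mono F) = 2 * (Nat.card F - 1) := by
  rw [← card_spl]
  refine Subgroup.card_eq_two_mul_card (n := sl 0 (-1) 1 0 (by ring)) ?_ ?_ ?_ ?_
  · intro A hA
    exact .inl hA
  · rw [mem_mono]; simp
  · rw [mem_spl]; simp
  · intro A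
    obtain ⟨a, b, c, d, h, rfl⟩ := exists_sl A
    rw [mem_mono, mem_spl, sl_inv, sl_mul, mem_spl]
    intro h h'
    rcases h with h | h
    · exact absurd h h'
    · simp [h]

theorem card_nrot (h2 : (2 : F) ≠ 0) (h3 : (3 : F) = 0) :
    Nat.card (nrot F) = 2 * Nat.card (rot F) := by
  -- The determinant is -2 = 1 in characteristic 3.
  refine Subgroup.card_eq_two_mul_card (n := sl 1 1 1 (-1) (by linear_combination -h3)) ?_ ?_ ?_ ?_
  · intro A hA
    exact .inl hA
  · rw [mem_nrot]; simp
  · rw [mem_rot]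
    intro h
    exact h2 (by linear_combination h.1)
  · intro A
    obtain ⟨a, b, c, d, h, rfl⟩ := exists_sl A
    rw [mem_nrot, mem_rot, sl_inv, sl_mul, mem_rot]
    intro h h'
    rcases h with h | ⟨rfl, rfl⟩
    · exact absurd h h'
    · constructor <;> ring

/-- Rational parametrization of the circle a² + b² = 1 from the point (-1, 0), which is the value at
`none`; 1 + t² never vanishes since -1 is not a square. -/
theorem card_rot (hs : ∀ x y : F, x ^ 2 + y ^ 2 = 0 → x = 0) (h2 : (2 : F) ≠ 0) :
    Nat.card (rot F) = Nat.card F + 1 := by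
  have h1 (t : F) : 1 + t ^ 2 ≠ 0 := fun h => one_ne_zero (hs 1 t (by rw [one_pow, h]))
  rw [← Finite.card_option]
  refine (Nat.card_eq_of_bijective (fun p : Option F => p.elim
    (⟨sl (-1) 0 0 (-1) (by ring), mem_rot.2 (by simp)⟩ : rot F) (fun t =>
      ⟨sl ((1 - t ^ 2) / (1 + t ^ 2)) (2 * t / (1 + t ^ 2)) (-(2 * t / (1 + t ^ 2)))
        ((1 - t ^ 2) / (1 + t ^ 2)) (by have := h1 t; field_simp; ring), mem_rot.2 (by simp)⟩))
    ⟨?_, ?_⟩).symm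
  · have h3 (t : F) : 1 + (1 - t ^ 2) / (1 + t ^ 2) = 2 / (1 + t ^ 2) := by
      have := h1 t
      field_simp
      ring
    rintro (_ | s) (_ | t) h
    · rfl
    · have h0 := Subtype.ext_iff.1 h
      dsimp only [Option.elim] at h0
      rw [sl_inj] at h0
      replace h0 := h0.1
      have h4 := h3 t
      rw [← h0, add_neg_cancel, eq_comm, div_eq_zero_iff] at h4
      exact absurd h4 (by simp [h1 t, h2])
    · have h0 := Subtype.ext_iff.1 h
      dsimp only [Option.elim] at h0
      rw [sl_inj] at h0
      replace h0 := h0.1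
      have h4 := h3 s
      rw [h0, add_neg_cancel, eq_comm, div_eq_zero_iff] at h4
      exact absurd h4 (by simp [h1 s, h2])
    · have h0 := Subtype.ext_iff.1 h
      dsimp only [Option.elim] at h0
      rw [sl_inj] at h0
      obtain ⟨h4, h5, -, -⟩ := h0
      have h6 : 2 / (1 + s ^ 2) = 2 / (1 + t ^ 2) := by rw [← h3, ← h3, h4]
      have h7 : s * (2 / (1 + t ^ 2)) = t * (2 / (1 + t ^ 2)) := by
        rw [← h6]
        conv_rhs => rw [h6]
        linear_combination h5
      rw [mul_left_inj' (div_ne_zero h2 (h1 t))] at h7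
      rw [h7]
  · rintro ⟨A, hA⟩
    obtain ⟨a, b, c, d, h, rfl⟩ := exists_sl A
    obtain ⟨rfl, rfl⟩ := mem_rot.1 hA
    by_cases ha : 1 + a = 0
    · obtain rfl : a = -1 := by linear_combination ha
      have hc : c = 0 := by
        have : c ^ 2 = 0 := by linear_combination h
        exact pow_eq_zero_iff two_ne_zero |>.1 this
      refine ⟨none, Subtype.ext ?_⟩
      simp [hc]
    · refine ⟨some (-c / (1 + a)), Subtype.ext ?_⟩
      have h3 : 1 + (-c / (1 + a)) ^ 2 = 2 / (1 + a) := by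
        field_simp
        linear_combination h
      have h4 : 1 - (-c / (1 + a)) ^ 2 = 2 * a / (1 + a) := by
        field_simp
        linear_combination -h
      simp only [Option.elim, sl_inj, h3, h4]
      refine ⟨?_, ?_, ?_, ?_⟩ <;> field_simp

end PSLTwo

end Matrices

/-! ### Conjugacy, centralizers and generation in PSL(2, F). -/

section Matrices

open Matrix

namespace PSLTwo

variable {F : Type*} [Field F]

theorem proj_sl_eq_one_iff {a b c d : F} {h} : proj (sl a b c d h) = 1 ↔
    (a = 1 ∧ b = 0 ∧ c = 0 ∧ d = 1) ∨ (a = -1 ∧ b = 0 ∧ c = 0 ∧ d = -1) := by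
  rw [← map_one proj, sl_one, proj_sl_eq_iff, neg_zero]

theorem proj_sl_mul {a b c d a' b' c' d' : F} {h h'} :
    proj (sl a b c d h) * proj (sl a' b' c' d' h') =
      proj (sl (a * a' + b * c') (a * b' + b * d') (c * a' + d * c') (c * b' + d * d')
        (by linear_combination h * (a' * d' - b' * c') + h')) := by
  rw [← map_mul, sl_mul]

theorem proj_sl_inv {a b c d : F} {h} :
    (proj (sl a b c d h))⁻¹ = proj (sl d (-b) (-c) a (by linear_combination h)) := by
  rw [← map_inv, sl_inv]

theorem exists_conj_mem_of_mem_bor {x : ProjectiveSpecialLinearGroup (Fin 2) F}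
    (hx : x ∈ (bor F).map proj) :
    ∃ g, g * x * g⁻¹ ∈ (uni F).map proj ∨ g * x * g⁻¹ ∈ (spl F).map proj := by
  obtain ⟨a, b, c, d, h, rfl⟩ := exists_proj_sl x
  obtain rfl := proj_sl_mem_bor.1 hx
  by_cases had : a = d
  · refine ⟨1, .inl ?_⟩
    rw [one_mul, inv_one, mul_one, proj_sl_mem_uni]
    exact ⟨rfl, had⟩
  · refine ⟨proj (sl 1 (b / (a - d)) 0 1 (by ring)), .inr ?_⟩
    rw [proj_sl_inv, proj_sl_mul, proj_sl_mul, proj_sl_mem_spl]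
    have := sub_ne_zero.2 had
    constructor
    · field_simp
      ring
    · ring

/-- In characteristic 3 the discriminant (a + d)² - 4 is (a + d)² - 1. If it is a square, there is
an eigenvalue in F and the matrix is conjugate to a triangular one; otherwise it is minus a square
and the matrix is conjugate to a rotation. -/
theorem exists_conj_mem (h3 : (3 : F) = 0) (hq : ∀ a : F, ∃ r, a = r ^ 2 ∨ a = -r ^ 2)
    (x : ProjectiveSpecialLinearGroup (Fin 2) F) :
    ∃ g, g * x * g⁻¹ ∈ (uni F).map proj ∨ g * x * g⁻¹ ∈ (spl F).map proj ∨
      g * x * g⁻¹ ∈ (rot F).map proj := by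
  obtain ⟨a, b, c, d, h, rfl⟩ := exists_proj_sl x
  by_cases hc : c = 0
  · subst hc
    obtain ⟨g, hg⟩ := exists_conj_mem_of_mem_bor
      (proj_sl_mem_bor.2 rfl : proj (sl a b 0 d h) ∈ _)
    exact ⟨g, hg.imp_right .inl⟩
  obtain ⟨s, hs⟩ := hq ((a + d) ^ 2 - 1)
  by_cases hs' : (a + d) ^ 2 - 1 = s ^ 2
  -- As 1/2 = -1, the scalar λ = -(a + d + s) is an eigenvalue, and the bottom row (c, λ - a) is a
  -- left eigenvector for it.
  · let y := proj (sl 0 (-1 / c) c (-(a + d + s) - a) (by field_simp; ring))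
    have hy : y * proj (sl a b c d h) * y⁻¹ ∈ (bor F).map proj := by
      rw [proj_sl_inv, proj_sl_mul, proj_sl_mul, proj_sl_mem_bor]
      linear_combination c * h - c * hs' + c * ((a + d + s) * (a + d)) * h3
    obtain ⟨g, hg⟩ := exists_conj_mem_of_mem_bor hy
    have e : g * (y * proj (sl a b c d h) * y⁻¹) * g⁻¹ =
        g * y * proj (sl a b c d h) * (g * y)⁻¹ := by group
    rw [e] at hg
    exact ⟨g * y, hg.imp_right .inl⟩
  · replace hs := hs.resolve_left hs'
    have hs0 : s ≠ 0 := by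
      rintro rfl
      exact hs' (by rw [hs]; ring)
    obtain ⟨x, hx⟩ := hq (s / c)
    have hx2 : (x ^ 2 * c) ^ 2 = s ^ 2 := by
      have : (x ^ 2) ^ 2 = (s / c) ^ 2 := by
        rcases hx with hx | hx
        · rw [hx]
        · rw [hx]; ring
      rw [mul_pow, this]
      field_simp
    have hx0 : x ≠ 0 := by
      rintro rfl
      apply pow_ne_zero 2 hs0
      rw [← hx2]
      ring
    -- The unipotent factor makes the diagonal entries equal; the scaling by x, with (x² c)² = s²,
    -- makes the off-diagonal entries opposite.
    refine ⟨proj (sl x⁻¹ ((a - d) / (x * c)) 0 x (by field_simp; ring)), .inr (.inr ?_)⟩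
    rw [proj_sl_inv, proj_sl_mul, proj_sl_mul, proj_sl_mem_rot]
    constructor
    · field_simp
      linear_combination x * c * (a - d) * h3
    · field_simp
      linear_combination hx2 + hs - h + (a * d - a ^ 2 - d ^ 2) * h3

theorem commute_uni_iff (h2 : (2 : F) ≠ 0) {x : ProjectiveSpecialLinearGroup (Fin 2) F}
    (hx : x ∈ (uni F).map proj) (hx1 : x ≠ 1) (y) : y * x = x * y ↔ y ∈ (uni F).map proj := by
  obtain ⟨u, rfl⟩ := mem_map_uni.1 hx
  have hu : u ≠ 0 := by
    rintro rfl
    exact hx1 (proj_sl_eq_one_iff.2 (by simp))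
  obtain ⟨a, b, c, d, h, rfl⟩ := exists_proj_sl y
  rw [proj_sl_mul, proj_sl_mul, proj_sl_eq_iff, proj_sl_mem_uni]
  constructor
  · rintro (⟨e1, e2, -, -⟩ | ⟨e1, e2, e3, -⟩)
    · have hc : u * c = 0 := by linear_combination -e1
      have had : u * (a - d) = 0 := by linear_combination e2
      exact ⟨(mul_eq_zero.1 hc).resolve_left hu,
        sub_eq_zero.1 ((mul_eq_zero.1 had).resolve_left hu)⟩
    · have hc : 2 * c = 0 := by linear_combination e3
      obtain rfl := (mul_eq_zero.1 hc).resolve_left h2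
      have ha : 2 * a = 0 := by linear_combination e1
      obtain rfl := (mul_eq_zero.1 ha).resolve_left h2
      simp at h
  · rintro ⟨rfl, rfl⟩
    left
    refine ⟨?_, ?_, ?_, ?_⟩ <;> ring

theorem ne_of_proj_diag_ne_one {a d : F} {h} (hx : proj (sl a 0 0 d h) ≠ 1) : a - d ≠ 0 := by
  intro e
  obtain rfl := sub_eq_zero.1 e
  have : (a - 1) * (a + 1) = 0 := by linear_combination h
  apply hx
  rw [proj_sl_eq_one_iff]
  exact (mul_eq_zero.1 this).imp (fun h => by simp [sub_eq_zero.1 h])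
    (fun h => by simp [eq_neg_of_add_eq_zero_left h])

/-- Commuting in PSL means commuting up to sign in SL. The minus sign would force d = -a, so a² =
-1, which is not a square. -/
theorem commute_spl_iff (h2 : (2 : F) ≠ 0) (hs : ∀ x y : F, x ^ 2 + y ^ 2 = 0 → x = 0)
    {x : ProjectiveSpecialLinearGroup (Fin 2) F}
    (hx : x ∈ (spl F).map proj) (hx1 : x ≠ 1) (y) : y * x = x * y ↔ y ∈ (spl F).map proj := by
  obtain ⟨a, d, had, rfl⟩ := mem_map_spl.1 hx
  have had' := ne_of_proj_diag_ne_one hx1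
  obtain ⟨e, f, g, i, h, rfl⟩ := exists_proj_sl y
  rw [proj_sl_mul, proj_sl_mul, proj_sl_eq_iff, proj_sl_mem_spl]
  constructor
  · rintro (⟨-, e1, e2, -⟩ | ⟨e1, e2, -, -⟩)
    · have hc : (a - d) * f = 0 := by linear_combination -e1
      have hb : (a - d) * g = 0 := by linear_combination e2
      exact ⟨(mul_eq_zero.1 hc).resolve_left had', (mul_eq_zero.1 hb).resolve_left had'⟩
    · exfalso
      have ha : a ≠ 0 := by
        rintro rfl
        simp at had
      have he : 2 * a * e = 0 := by linear_combination e1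
      obtain rfl := (mul_eq_zero.1 he).resolve_left (mul_ne_zero h2 ha)
      have hf : f ≠ 0 := by
        rintro rfl
        simp at h
      have hd : f * (a + d) = 0 := by linear_combination e2
      have hd' := (mul_eq_zero.1 hd).resolve_left hf
      exact ha (hs a 1 (by linear_combination a * hd' - had))
  · rintro ⟨rfl, rfl⟩
    left
    refine ⟨?_, ?_, ?_, ?_⟩ <;> ring

/-- The condition x² ≠ 1 makes both a and b nonzero; then either sign forces y to be a rotation. -/
theorem commute_rot_iff (h2 : (2 : F) ≠ 0) {x : ProjectiveSpecialLinearGroup (Fin 2) F}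
    (hx : x ∈ (rot F).map proj) (hx2 : x ^ 2 ≠ 1) (y) :
    y * x = x * y ↔ y ∈ (rot F).map proj := by
  obtain ⟨a, b, hab, rfl⟩ := mem_map_rot.1 hx
  have ha : a ≠ 0 := by
    rintro rfl
    apply hx2
    rw [pow_two, proj_sl_mul, proj_sl_eq_one_iff]
    right
    exact ⟨by linear_combination -hab, by ring, by ring, by linear_combination -hab⟩
  have hb : b ≠ 0 := by
    rintro rfl
    apply hx2
    rw [pow_two, proj_sl_mul, proj_sl_eq_one_iff]
    left
    exact ⟨by linear_combination hab, by ring, by ring, by linear_combination hab⟩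
  obtain ⟨e, f, g, i, h, rfl⟩ := exists_proj_sl y
  rw [proj_sl_mul, proj_sl_mul, proj_sl_eq_iff, proj_sl_mem_rot]
  constructor
  · rintro (⟨e1, e2, -, -⟩ | ⟨e1, e2, e3, e4⟩)
    · have h4 : b * (f + g) = 0 := by linear_combination -e1
      have h5 : b * (e - i) = 0 := by linear_combination e2
      exact ⟨sub_eq_zero.1 ((mul_eq_zero.1 h5).resolve_left hb),
        eq_neg_of_add_eq_zero_left ((mul_eq_zero.1 h4).resolve_left hb)⟩
    · have h4 : 2 * a * (f + g) = 0 := by linear_combination e2 + e3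
      have h5 : 2 * a * (e - i) = 0 := by linear_combination e1 - e4
      have h2a := mul_ne_zero h2 ha
      exact ⟨sub_eq_zero.1 ((mul_eq_zero.1 h5).resolve_left h2a),
        eq_neg_of_add_eq_zero_left ((mul_eq_zero.1 h4).resolve_left h2a)⟩
  · rintro ⟨rfl, rfl⟩
    left
    refine ⟨?_, ?_, ?_, ?_⟩ <;> ring

theorem conj_mem_uni {b x : ProjectiveSpecialLinearGroup (Fin 2) F} (hb : b ∈ (bor F).map proj)
    (hx : x ∈ (uni F).map proj) : b * x * b⁻¹ ∈ (uni F).map proj := by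
  obtain ⟨u, rfl⟩ := mem_map_uni.1 hx
  obtain ⟨a, b, c, d, h, rfl⟩ := exists_proj_sl b
  rw [proj_sl_mem_bor] at hb
  subst hb
  rw [proj_sl_inv, proj_sl_mul, proj_sl_mul, proj_sl_mem_uni]
  constructor <;> ring

theorem mem_bor_of_conj_mem_uni {x : ProjectiveSpecialLinearGroup (Fin 2) F}
    (hx : x ∈ (uni F).map proj) (hx1 : x ≠ 1) {g} (hg : g * x * g⁻¹ ∈ (uni F).map proj) :
    g ∈ (bor F).map proj := by
  obtain ⟨u, rfl⟩ := mem_map_uni.1 hx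
  have hu : u ≠ 0 := by
    rintro rfl
    exact hx1 (proj_sl_eq_one_iff.2 (by simp))
  obtain ⟨a, b, c, d, h, rfl⟩ := exists_proj_sl g
  rw [proj_sl_inv, proj_sl_mul, proj_sl_mul, proj_sl_mem_uni] at hg
  rw [proj_sl_mem_bor]
  have : u * c ^ 2 = 0 := by linear_combination -hg.1
  exact pow_eq_zero_iff two_ne_zero |>.1 ((mul_eq_zero.1 this).resolve_left hu)

theorem mem_mono_of_conj_mem_spl {x : ProjectiveSpecialLinearGroup (Fin 2) F}
    (hx : x ∈ (spl F).map proj) (hx1 : x ≠ 1) {g} (hg : g * x * g⁻¹ ∈ (spl F).map proj) :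
    g ∈ (mono F).map proj := by
  obtain ⟨a, d, had, rfl⟩ := mem_map_spl.1 hx
  have had' := ne_of_proj_diag_ne_one hx1
  obtain ⟨e, f, g, i, h, rfl⟩ := exists_proj_sl g
  rw [proj_sl_inv, proj_sl_mul, proj_sl_mul, proj_sl_mem_spl] at hg
  rw [proj_sl_mem_mono]
  have h1 : (a - d) * (e * f) = 0 := by linear_combination -hg.1
  have h2 : (a - d) * (g * i) = 0 := by linear_combination hg.2
  replace h1 := mul_eq_zero.1 ((mul_eq_zero.1 h1).resolve_left had')
  replace h2 := mul_eq_zero.1 ((mul_eq_zero.1 h2).resolve_left had')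
  rcases h1 with rfl | rfl <;> rcases h2 with rfl | rfl <;> simp_all

/-- The rows of g are orthogonal (`e1`) and have the same norm N = e² + f² (`e2`); determinant 1
gives N² = 1, and N = 1, -1 are the two cosets of rotations. -/
theorem mem_nrot_of_conj_mem_rot (h2 : (2 : F) ≠ 0) {x : ProjectiveSpecialLinearGroup (Fin 2) F}
    (hx : x ∈ (rot F).map proj) (hx1 : x ≠ 1) {g} (hg : g * x * g⁻¹ ∈ (rot F).map proj) :
    g ∈ (nrot F).map proj := by
  obtain ⟨a, b, hab, rfl⟩ := mem_map_rot.1 hx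
  have hb : b ≠ 0 := by
    rintro rfl
    have : (a - 1) * (a + 1) = 0 := by linear_combination hab
    apply hx1
    rw [proj_sl_eq_one_iff]
    exact (mul_eq_zero.1 this).imp (fun h => by simp [sub_eq_zero.1 h])
      (fun h => by simp [eq_neg_of_add_eq_zero_left h])
  obtain ⟨e, f, g, i, h, rfl⟩ := exists_proj_sl g
  rw [proj_sl_inv, proj_sl_mul, proj_sl_mul, proj_sl_mem_rot] at hg
  rw [proj_sl_mem_nrot]
  have e1 : 2 * b * (f * i + e * g) = 0 := by linear_combination -hg.1
  replace e1 := (mul_eq_zero.1 e1).resolve_left (mul_ne_zero h2 hb)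
  have e2 : b * ((e ^ 2 + f ^ 2) - (g ^ 2 + i ^ 2)) = 0 := by linear_combination hg.2
  replace e2 := (mul_eq_zero.1 e2).resolve_left hb
  have hi : (e ^ 2 + f ^ 2) * i = e := by linear_combination f * e1 + e * h
  have hg : (e ^ 2 + f ^ 2) * g = -f := by linear_combination e * e1 - f * h
  have hN : (e ^ 2 + f ^ 2 - 1) * (e ^ 2 + f ^ 2 + 1) = 0 := by
    linear_combination (e ^ 2 + f ^ 2) * e2 + (e * i - f * g + 1) * h + (f * i + e * g) * e1
  rcases mul_eq_zero.1 hN with hN | hN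
  · left
    constructor
    · linear_combination -hi + i * hN
    · linear_combination hg - g * hN
  · right
    constructor
    · linear_combination -hi + i * hN
    · linear_combination hg - g * hN

theorem mul_self_of_mem_mono {g : ProjectiveSpecialLinearGroup (Fin 2) F}
    (hg : g ∈ (mono F).map proj) (hg' : g ∉ (spl F).map proj) : g * g = 1 := by
  obtain ⟨a, b, c, d, h, rfl⟩ := exists_proj_sl g
  rw [proj_sl_mem_mono] at hg
  rw [proj_sl_mem_spl] at hg'
  obtain ⟨rfl, rfl⟩ := hg.resolve_left hg'
  rw [proj_sl_mul, proj_sl_eq_one_iff]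
  right
  refine ⟨?_, ?_, ?_, ?_⟩
  · linear_combination -h
  · ring
  · ring
  · linear_combination -h

theorem mul_self_of_mem_nrot {g : ProjectiveSpecialLinearGroup (Fin 2) F}
    (hg : g ∈ (nrot F).map proj) (hg' : g ∉ (rot F).map proj) : g * g = 1 := by
  obtain ⟨a, b, c, d, h, rfl⟩ := exists_proj_sl g
  rw [proj_sl_mem_nrot] at hg
  rw [proj_sl_mem_rot] at hg'
  obtain ⟨rfl, rfl⟩ := hg.resolve_left hg'
  rw [proj_sl_mul, proj_sl_eq_one_iff]
  right
  refine ⟨?_, ?_, ?_, ?_⟩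
  · linear_combination -h
  · ring
  · ring
  · linear_combination -h

/-- Conjugation by diag(r, r⁻¹) multiplies the unipotent parameter by r². -/
theorem exists_conj_eq_or_eq_inv (hq : ∀ a : F, ∃ r, a = r ^ 2 ∨ a = -r ^ 2)
    {x y : ProjectiveSpecialLinearGroup (Fin 2) F}
    (hx : x ∈ (uni F).map proj) (hy : y ∈ (uni F).map proj) (hx1 : x ≠ 1) (hy1 : y ≠ 1) :
    ∃ b, b * x * b⁻¹ = y ∨ b * x * b⁻¹ = y⁻¹ := by
  obtain ⟨u, rfl⟩ := mem_map_uni.1 hx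
  obtain ⟨v, rfl⟩ := mem_map_uni.1 hy
  have hu : u ≠ 0 := by
    rintro rfl
    exact hx1 (proj_sl_eq_one_iff.2 (by simp))
  have hv : v ≠ 0 := by
    rintro rfl
    exact hy1 (proj_sl_eq_one_iff.2 (by simp))
  obtain ⟨r, hr⟩ := hq (v / u)
  have hr0 : r ≠ 0 := by
    rintro rfl
    simp [hu, hv] at hr
  refine ⟨proj (sl r 0 0 r⁻¹ (by field_simp; ring)), hr.imp (fun hr => ?_) (fun hr => ?_)⟩ <;>
    rw [div_eq_iff hu] at hr <;> subst hr <;> rw [proj_sl_inv, proj_sl_mul, proj_sl_mul]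
  · rw [proj_sl_eq_iff]
    left
    refine ⟨?_, ?_, ?_, ?_⟩ <;> field_simp <;> ring
  · rw [proj_sl_inv, proj_sl_eq_iff]
    left
    refine ⟨?_, ?_, ?_, ?_⟩ <;> field_simp <;> ring

theorem mem_bor_or_of_conj_mem_bor {x : ProjectiveSpecialLinearGroup (Fin 2) F}
    (hx : x ∈ (spl F).map proj) (hx1 : x ≠ 1) {g} (hg : g⁻¹ * x * g ∈ (bor F).map proj) :
    g ∈ (bor F).map proj ∨ (proj (sl 0 (-1) 1 0 (by ring)))⁻¹ * g ∈ (bor F).map proj := by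
  obtain ⟨a, d, had, rfl⟩ := mem_map_spl.1 hx
  have had' := ne_of_proj_diag_ne_one hx1
  obtain ⟨e, f, g, i, h, rfl⟩ := exists_proj_sl g
  rw [proj_sl_inv, proj_sl_mul, proj_sl_mul, proj_sl_mem_bor] at hg
  rw [proj_sl_inv, proj_sl_mul, proj_sl_mem_bor, proj_sl_mem_bor]
  have h1 : (a - d) * (g * e) = 0 := by linear_combination -hg
  replace h1 := mul_eq_zero.1 ((mul_eq_zero.1 h1).resolve_left had')
  refine h1.imp_right fun h1 => by simp [h1]

/-- Clearing the diagonal of h by unipotents gives an antidiagonal element, which carries upper to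
lower unipotents; every matrix with c ≠ 0 is an upper-lower-upper product. -/
theorem eq_top_of_uni_le {H : Subgroup (ProjectiveSpecialLinearGroup (Fin 2) F)}
    (hU : (uni F).map proj ≤ H) {h} (hh : h ∈ H) (hhB : h ∉ (bor F).map proj) : H = ⊤ := by
  have hu (t : F) : proj (sl 1 t 0 1 (by ring)) ∈ H := hU (mem_map_uni.2 ⟨t, rfl⟩)
  obtain ⟨a, b, c, d, hd, rfl⟩ := exists_proj_sl h
  have hc : c ≠ 0 := fun hc => hhB (proj_sl_mem_bor.2 hc)
  have hw : proj (sl 0 (-1 / c) c 0 (by field_simp; ring)) ∈ H := by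
    have := H.mul_mem (H.mul_mem (hu (-a / c)) hh) (hu (-d / c))
    rw [proj_sl_mul, proj_sl_mul] at this
    convert this using 3
    · field_simp; ring
    · field_simp; linear_combination hd
    · ring
    · field_simp; ring
  have hl (s : F) : proj (sl 1 0 s 1 (by ring)) ∈ H := by
    have := H.mul_mem (H.mul_mem hw (hu (-s / c ^ 2))) hw
    rw [proj_sl_mul, proj_sl_mul] at this
    convert this using 1
    rw [proj_sl_eq_iff]
    right
    refine ⟨?_, ?_, ?_, ?_⟩ <;> field_simp <;> ring
  have key (a b c d : F) (h) (hc : c ≠ 0) : proj (sl a b c d h) ∈ H := by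
    have := H.mul_mem (H.mul_mem (hu ((a - 1) / c)) (hl c)) (hu ((d - 1) / c))
    rw [proj_sl_mul, proj_sl_mul] at this
    convert this using 3
    · field_simp; ring
    · field_simp; linear_combination -h
    · ring
    · field_simp; ring
  rw [eq_top_iff]
  rintro x -
  obtain ⟨a, b, c, d, h, rfl⟩ := exists_proj_sl x
  by_cases hc : c = 0
  · subst hc
    have hd : d ≠ 0 := by
      rintro rfl
      simp at h
    rw [← H.mul_mem_cancel_right (hl 1), proj_sl_mul]
    exact key _ _ _ _ _ (by simpa using hd)
  · exact key _ _ _ _ _ hc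

/-- The scalars preserving the parameters of P form a subalgebra of F over F_3. It contains a²,
which is not in F_3, so by primality of the degree it is all of F. -/
theorem uni_le_of_invariant [Algebra (ZMod 3) F] (hp : (Module.finrank (ZMod 3) F).Prime)
    (hs : ∀ x y : F, x ^ 2 + y ^ 2 = 0 → x = 0)
    {P : Subgroup (ProjectiveSpecialLinearGroup (Fin 2) F)} (hP : P ≤ (uni F).map proj)
    (hP1 : P ≠ ⊥) {b} (hb : b ∈ (bor F).map proj) (hbU : b ∉ (uni F).map proj)
    (h : ∀ x ∈ P, b * x * b⁻¹ ∈ P) : (uni F).map proj ≤ P := by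
  let R : Subring F :=
    { carrier := {c | ∀ v : F, proj (sl 1 v 0 1 (by ring)) ∈ P →
        proj (sl 1 (c * v) 0 1 (by ring)) ∈ P}
      one_mem' := fun v hv => by simpa using hv
      zero_mem' := fun v _ => by
        convert P.one_mem
        rw [proj_sl_eq_one_iff]
        simp
      mul_mem' := fun {c d} hc hd v hv => by
        simpa [mul_assoc] using hc _ (hd v hv)
      add_mem' := fun {c d} hc hd v hv => by
        have := P.mul_mem (hc v hv) (hd v hv)
        rw [proj_sl_mul] at this
        convert this using 3 <;> ring
      neg_mem' := fun {c} hc v hv => by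
        have := P.inv_mem (hc v hv)
        rw [proj_sl_inv] at this
        convert this using 3 <;> ring }
  let A : Subalgebra (ZMod 3) F :=
    { R with
      algebraMap_mem' := fun z => by
        have := natCast_mem R z.val
        rwa [← map_natCast (algebraMap (ZMod 3) F), ZMod.natCast_zmod_val] at this }
  obtain ⟨a, β, c, d, had, rfl⟩ := exists_proj_sl b
  obtain rfl := proj_sl_mem_bor.1 hb
  rw [proj_sl_mem_uni] at hbU
  have haA : a ^ 2 ∈ A := fun v hv => by
    have := h _ hv
    rw [proj_sl_inv, proj_sl_mul, proj_sl_mul] at this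
    convert this using 3
    · linear_combination -had
    · ring
    · ring
    · linear_combination -had
  have hA : A = ⊤ := by
    have := Subalgebra.isSimpleOrder_of_finrank_prime (ZMod 3) F hp
    refine (IsSimpleOrder.eq_bot_or_eq_top A).resolve_left fun hA => ?_
    rw [hA, Algebra.mem_bot] at haA
    obtain ⟨z, hz⟩ := haA
    have ha : a ≠ 0 := by
      rintro rfl
      simp at had
    have hz' : ∀ z : ZMod 3, z = 0 ∨ z = 1 ∨ z = -1 := by decide
    -- a² = 1 would give a = d and put b in U; a² = -1 is excluded since -1 is not a square.
    rcases hz' z with rfl | rfl | rfl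
    · rw [map_zero] at hz
      exact pow_ne_zero 2 ha hz.symm
    · rw [map_one] at hz
      refine hbU ⟨rfl, mul_left_cancel₀ ha ?_⟩
      linear_combination -hz - had
    · rw [map_neg, map_one] at hz
      refine ha (hs a 1 ?_)
      linear_combination -hz
  obtain ⟨⟨x, hx⟩, hx1⟩ := P.ne_bot_iff_exists_ne_one.1 hP1
  obtain ⟨v, rfl⟩ := mem_map_uni.1 (hP hx)
  have hv : v ≠ 0 := by
    rintro rfl
    exact hx1 (Subtype.ext (proj_sl_eq_one_iff.2 (by simp)))
  intro y hy
  obtain ⟨t, rfl⟩ := mem_map_uni.1 hy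
  have : t / v ∈ A := hA ▸ Algebra.mem_top
  have := this v hx
  simpa only [div_mul_cancel₀ t hv] using this

theorem isCyclic_map_spl [Finite F] : IsCyclic ((spl F).map proj) := by
  rw [← range_diag, MonoidHom.map_range]
  exact isCyclic_of_surjective _ (MonoidHom.rangeRestrict_surjective _)

/-- With i² = -1 in the algebraic closure, rotations embed by a + b i, and a finite group embedded
in a field is cyclic. -/
theorem isCyclic_map_rot [Finite F]
    (hs : ∀ x y : F, x ^ 2 + y ^ 2 = 0 → x = 0) : IsCyclic ((rot F).map proj) := by
  obtain ⟨i, hi⟩ := IsAlgClosed.exists_pow_nat_eq (-1 : AlgebraicClosure F) two_pos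
  have hiF (x y : F) (h : algebraMap F (AlgebraicClosure F) x + algebraMap F _ y * i = 0) :
      x = 0 := by
    apply hs x y
    apply (algebraMap F (AlgebraicClosure F)).injective
    rw [map_add, map_pow, map_pow, map_zero]
    linear_combination (algebraMap F (AlgebraicClosure F) x - algebraMap F _ y * i) * h +
      (algebraMap F (AlgebraicClosure F) y) ^ 2 * hi
  let f : rot F →* AlgebraicClosure F :=
    { toFun := fun A => algebraMap F _ (A.1 0 0) + algebraMap F _ (A.1 0 1) * i
      map_one' := by simp
      map_mul' := by
        rintro ⟨A, hA⟩ ⟨B, hB⟩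
        obtain ⟨a, b, c, d, h, rfl⟩ := exists_sl A
        obtain ⟨a', b', c', d', h', rfl⟩ := exists_sl B
        obtain ⟨rfl, rfl⟩ := mem_rot.1 hA
        obtain ⟨rfl, rfl⟩ := mem_rot.1 hB
        simp only [MulMemClass.mk_mul_mk, sl_mul]
        change algebraMap F _ (a * a' + -c * c') + algebraMap F _ (a * -c' + -c * a') * i =
          (algebraMap F _ a + algebraMap F _ (-c) * i) *
            (algebraMap F _ a' + algebraMap F _ (-c') * i)
        simp only [map_add, map_mul, map_neg]
        linear_combination -(algebraMap F (AlgebraicClosure F) c) * algebraMap F _ c' * hi }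
  have hf : Function.Injective f := by
    rintro ⟨A, hA⟩ ⟨B, hB⟩ hAB
    obtain ⟨a, b, c, d, h, rfl⟩ := exists_sl A
    obtain ⟨a', b', c', d', h', rfl⟩ := exists_sl B
    obtain ⟨rfl, rfl⟩ := mem_rot.1 hA
    obtain ⟨rfl, rfl⟩ := mem_rot.1 hB
    change algebraMap F _ a + algebraMap F _ (-c) * i =
      algebraMap F _ a' + algebraMap F _ (-c') * i at hAB
    have h1 := sub_eq_zero.1 (hiF (a - a') (-c - -c') (by
      simp only [map_sub]; linear_combination hAB))
    have h2 := sub_eq_zero.1 (hiF (c - c') (a - a') (by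
      simp only [map_sub, map_neg] at hAB ⊢
      linear_combination i * hAB + (algebraMap F _ c - algebraMap F _ c') * hi))
    subst h1 h2
    rfl
  have := isCyclic_of_injective_ringHom f hf
  exact isCyclic_of_surjective _ (proj.subgroupMap_surjective (rot F))

end PSLTwo

end Matrices

/-! ### Squares in F and the verification of the local data. -/

section Matrices

open Matrix

namespace PSLTwo

variable {F : Type*} [Field F]

theorem not_isSquare_neg_one [Finite F] (hF : Nat.card F % 4 = 3) : ¬ IsSquare (-1 : F) := by
  have := Fintype.ofFinite F
  rw [FiniteField.isSquare_neg_one_iff, ← Nat.card_eq_fintype_card, not_not, hF]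

theorem eq_zero_of_sq_add_sq_eq_zero (h : ¬ IsSquare (-1 : F)) (x y : F)
    (hxy : x ^ 2 + y ^ 2 = 0) : x = 0 := by
  by_contra hx
  refine h ⟨y / x, ?_⟩
  field_simp
  linear_combination -hxy

theorem exists_eq_sq_or_eq_neg_sq [Finite F] (h2 : (2 : F) ≠ 0) (h : ¬ IsSquare (-1 : F)) (a : F) :
    ∃ r, a = r ^ 2 ∨ a = -r ^ 2 := by
  classical
  have := Fintype.ofFinite F
  by_cases ha : IsSquare a
  · obtain ⟨r, rfl⟩ := ha
    exact ⟨r, .inl (by ring)⟩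
  · have hF : ringChar F ≠ 2 := fun e => h2 (by
      have := ringChar.Nat.cast_ringChar (R := F)
      rwa [e, Nat.cast_ofNat] at this)
    have ha0 : a ≠ 0 := by
      rintro rfl
      exact ha (.zero)
    have h1 := (quadraticChar_neg_one_iff_not_isSquare (F := F)).2 h
    have h3 := (quadraticChar_neg_one_iff_not_isSquare (F := F)).2 ha
    have h4 : quadraticChar F (-1 * a) = 1 := by rw [map_mul, h1, h3]; rfl
    rw [quadraticChar_one_iff_isSquare (by simpa using ha0)] at h4
    obtain ⟨r, hr⟩ := h4
    exact ⟨r, .inr (by linear_combination -hr)⟩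

/-- The subgroup structure of `PSL(2, F)` for a field `F` with `8 k + 3` elements whose degree over
`ZMod 3` is prime. -/
def pslTwoData [Algebra (ZMod 3) F] (hp : (Module.finrank (ZMod 3) F).Prime) {k : ℕ} (hk : 3 ≤ k)
    (hF : Nat.card F = 8 * k + 3) (hF' : ∃ n, 8 * k + 3 = 3 ^ n) :
    PSLTwoData (ProjectiveSpecialLinearGroup (Fin 2) F) (8 * k + 3) k :=
  have hfin : Finite F := Nat.finite_of_card_ne_zero (by omega)
  have h3 : (3 : F) = 0 := by
    have : ((3 : ZMod 3) : ZMod 3) = 0 := by decide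
    have := congrArg (algebraMap (ZMod 3) F) this
    rwa [map_ofNat, map_zero] at this
  have h2 : (2 : F) ≠ 0 := fun h => one_ne_zero (α := F) (by linear_combination h3 - h)
  have hn : ¬ IsSquare (-1 : F) := not_isSquare_neg_one (by omega)
  have hs := eq_zero_of_sq_add_sq_eq_zero hn
  have hq := exists_eq_sq_or_eq_neg_sq h2 hn
  { B := (bor F).map proj
    U := (uni F).map proj
    S := (spl F).map proj
    NS := (mono F).map proj
    T := (rot F).map proj
    NT := (nrot F).map proj
    w := proj (sl 0 (-1) 1 0 (by ring))
    -- The chosen lifts of i and j are anticommuting matrices of square -1 in characteristic 3, so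
    -- their images generate a four-group.
    i := proj (sl 0 1 (-1) 0 (by ring))
    j := proj (sl 1 1 1 (-1) (by linear_combination -h3))
    u := proj (sl 1 1 0 1 (by ring))
    three_le := hk
    q_eq := rfl
    q_pow := hF'
    card := by
      have := card_psl h2
      rw [hF] at this
      refine Nat.eq_of_mul_eq_mul_left two_pos (this.trans ?_)
      rw [show 8 * k + 3 - 1 = 8 * k + 2 by omega]
      ring
    card_B := by
      have := card_map_proj h2 (neg_one_mem_bor (F := F))
      rw [card_bor, hF, show 8 * k + 3 - 1 = 8 * k + 2 by omega] at this
      refine Nat.eq_of_mul_eq_mul_left two_pos (this.trans ?_)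
      ring
    card_U := by rw [card_map_uni h2, hF]
    card_S := by
      have := card_map_proj h2 (neg_one_mem_spl (F := F))
      rw [card_spl, hF] at this
      omega
    card_NS := by
      have := card_map_proj h2 (neg_one_mem_mono (F := F))
      rw [card_mono, hF] at this
      omega
    card_T := by
      have := card_map_proj h2 (neg_one_mem_rot (F := F))
      rw [card_rot hs h2, hF] at this
      omega
    card_NT := by
      have := card_map_proj h2 (neg_one_mem_nrot (F := F))
      rw [card_nrot h2 h3, card_rot hs h2, hF] at this
      omega
    cyclic_S := isCyclic_map_spl
    cyclic_T := isCyclic_map_rot hs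
    pow_three := fun x hx => by
      obtain ⟨t, rfl⟩ := mem_map_uni.1 hx
      rw [pow_three, proj_sl_mul, proj_sl_mul, proj_sl_eq_one_iff]
      left
      exact ⟨by ring, by linear_combination t * h3, by ring, by ring⟩
    U_le := Subgroup.map_mono fun A hA => hA.1
    S_le := Subgroup.map_mono fun A hA => hA.2
    S_le_NS := Subgroup.map_mono fun A hA => .inl hA
    T_le := Subgroup.map_mono fun A hA => .inl hA
    cover := exists_conj_mem h3 hq
    comm_U := fun x hx hx1 => commute_uni_iff h2 hx hx1
    comm_S := fun x hx hx1 => commute_spl_iff h2 hs hx hx1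
    comm_T := fun x hx hx2 => commute_rot_iff h2 hx hx2
    conj_U := fun b hb x hx => conj_mem_uni hb hx
    conj_U_iff := fun x hx hx1 g hg => mem_bor_of_conj_mem_uni hx hx1 hg
    conj_S_iff := fun x hx hx1 g hg => mem_mono_of_conj_mem_spl hx hx1 hg
    conj_T_iff := fun x hx hx1 g hg => mem_nrot_of_conj_mem_rot h2 hx hx1 hg
    sq_NS := fun g hg hg' => mul_self_of_mem_mono hg hg'
    sq_NT := fun g hg hg' => mul_self_of_mem_nrot hg hg'
    trans_U := fun x hx y hy hx1 hy1 => exists_conj_eq_or_eq_inv hq hx hy hx1 hy1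
    w_mem := proj_sl_mem_mono.2 (.inr ⟨rfl, rfl⟩)
    w_notMem := fun h => one_ne_zero (proj_sl_mem_bor.1 h)
    conj_SB := fun x hx hx1 g hg => mem_bor_or_of_conj_mem_bor hx hx1 hg
    gen := fun H hU h hh hhB => eq_top_of_uni_le hU hh hhB
    irred := fun P hP hP1 b hb hbU h => uni_le_of_invariant hp hs hP hP1 hb hbU h
    i_sq := by
      rw [proj_sl_mul, proj_sl_eq_one_iff]
      simp
    j_sq := by
      rw [proj_sl_mul, proj_sl_eq_one_iff]
      right
      exact ⟨by linear_combination h3, by ring, by ring, by linear_combination h3⟩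
    i_ne := by
      rw [Ne, proj_sl_eq_one_iff]
      simp
    j_ne := by
      rw [Ne, proj_sl_eq_one_iff]
      simp
    i_ne_j := by
      rw [Ne, proj_sl_eq_iff]
      simp
    ij_comm := by
      rw [proj_sl_mul, proj_sl_mul, proj_sl_eq_iff]
      right
      refine ⟨?_, ?_, ?_, ?_⟩ <;> ring
    u_cube := by
      rw [pow_three, proj_sl_mul, proj_sl_mul, proj_sl_eq_one_iff]
      left
      exact ⟨by ring, by linear_combination h3, by ring, by ring⟩
    conj_i := by
      rw [proj_sl_inv, proj_sl_mul, proj_sl_mul, proj_sl_eq_iff]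
      right
      exact ⟨by ring, by linear_combination h3, by ring, by ring⟩
    conj_j := by
      rw [proj_sl_inv, proj_sl_mul, proj_sl_mul, proj_sl_mul, proj_sl_eq_iff]
      right
      exact ⟨by linear_combination h3, by linear_combination -h3, by ring,
        by linear_combination -h3⟩ }

end PSLTwo

end Matrices

/-! ### The Borel subgroup, small isomorphism types, and the theorem. -/

section Assembly

open Matrix Pointwise

namespace PSLTwoData

variable {G : Type*} [Group G] {q k : ℕ} (D : PSLTwoData G q k)

theorem exists_ne_one_mem_U : ∃ x ∈ D.U, x ≠ 1 := by
  by_contra! h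
  have : D.U = ⊥ := (Subgroup.eq_bot_iff_forall _).2 h
  have h1 := D.card_U
  rw [this, Subgroup.card_bot, D.q_eq] at h1
  omega

theorem eq_one_of_mem_U_of_mem_S {x : G} (hU : x ∈ D.U) (hS : x ∈ D.S) : x = 1 := by
  by_contra h
  have h1 := D.orderOf_dvd_of_mem_S hS
  rw [D.orderOf_of_mem_U hU h] at h1
  have := D.three_dvd
  omega

/-- The Borel subgroup is the semidirect product of its unipotent radical and the split torus, and
the torus acts faithfully. -/
theorem exists_nonempty_B_mulEquiv {N C : Type*} [Group N] [Group C] (e : D.U ≃* N) (f : D.S ≃* C) :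
    ∃ φ : C →* MulAut N, Function.Injective φ ∧ Nonempty (D.B ≃* N ⋊[φ] C) := by
  have := D.finite
  have hSU : D.S ≤ Subgroup.normalizer (D.U : Set G) := fun s hs =>
    Subgroup.mem_normalizer_iff.2 fun x => ⟨D.conj_U s (D.S_le hs) x, fun h => by
      simpa [mul_assoc] using D.conj_U s⁻¹ (D.B.inv_mem (D.S_le hs)) _ h⟩
  -- An element of S fixing some nontrivial x ∈ U lies in C(x) = U, and U ∩ S = 1.
  have hφ : Function.Injective (D.U.normalizerMonoidHom.comp (Subgroup.inclusion hSU)) := by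
    rw [injective_iff_map_eq_one]
    rintro ⟨s, hs⟩ h
    obtain ⟨x, hx, hx1⟩ := D.exists_ne_one_mem_U
    have h1 : s * x * s⁻¹ = x := congrArg (fun a : MulAut D.U => (a ⟨x, hx⟩ : G)) h
    have h2 : s ∈ D.U := (D.comm_U x hx hx1 s).1 (mul_inv_eq_iff_eq_mul.1 h1)
    exact Subtype.ext (D.eq_one_of_mem_U_of_mem_S h2 hs)
  have hψ : Function.Injective (SemidirectProduct.monoidHomSubgroup hSU) := by
    rw [injective_iff_map_eq_one]
    rintro ⟨⟨x, hx⟩, ⟨s, hs⟩⟩ h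
    replace h : x * s = 1 := h
    have h1 : x = 1 := D.eq_one_of_mem_U_of_mem_S hx (by
      rw [eq_inv_of_mul_eq_one_left h]
      exact D.S.inv_mem hs)
    subst h1
    rw [one_mul] at h
    subst h
    rfl
  have hB : (SemidirectProduct.monoidHomSubgroup hSU).range = D.B := by
    apply Subgroup.eq_of_le_of_card_ge
    · rintro _ ⟨⟨⟨x, hx⟩, ⟨s, hs⟩⟩, rfl⟩
      exact D.B.mul_mem (D.U_le hx) (D.S_le hs)
    · rw [← Nat.card_congr (MonoidHom.ofInjective hψ).toEquiv, SemidirectProduct.card, D.card_U,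
        D.card_S, D.card_B]
  refine ⟨_, ?_, ⟨(MulEquiv.subgroupCongr hB.symm).trans ((MonoidHom.ofInjective hψ).symm.trans
    (SemidirectProduct.congr' e f))⟩⟩
  exact (MulAut.congr e).injective.comp (hφ.comp f.symm.injective)

theorem isSolvable_B : Group.IsSolvable D.B := by
  obtain ⟨φ, -, ⟨e⟩⟩ := D.exists_nonempty_B_mulEquiv (.refl _) (.refl _)
  obtain ⟨x, hx, hx1⟩ := D.exists_ne_one_mem_U
  have hU : Group.IsSolvable D.U := Group.isSolvable_of_comm fun a b => Subtype.ext <| by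
    by_cases hb : (b : G) = 1
    · simp [hb]
    · exact (D.comm_U b b.2 hb a).2 a.2
  have hS : Group.IsSolvable D.S := Group.isSolvable_of_comm fun a b =>
    Subtype.ext (D.mul_comm_S a.2 b.2)
  have : Group.IsSolvable (D.U ⋊[φ] D.S) :=
    Group.isSolvable_of_ker_le_range SemidirectProduct.inl SemidirectProduct.rightHom
      SemidirectProduct.range_inl_eq_ker_rightHom.ge
  exact Group.isSolvable_of_isSolvable_injective (f := e.toMonoidHom) e.injective

theorem nonempty_centralizer_mulEquiv {g x : G} (hx : g * x * g⁻¹ ∈ D.S) (hx1 : x ≠ 1) :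
    Nonempty (Subgroup.centralizer {x} ≃* Cyc (4 * k + 1)) := by
  have h := centralizer_eq_conj_smul (D.comm_S _ hx (mt conj_eq_one.1 hx1))
  have := D.cyclic_S
  have : IsCyclic (Subgroup.centralizer {x}) := by
    rw [h]
    exact isCyclic_of_surjective _ (Subgroup.equivSMul (MulAut.conj g⁻¹) D.S).surjective
  exact ⟨mulEquivOfCyclicCardEq (by
    rw [D.card_centralizer_of_conj_mem_S hx hx1, Nat.card_congr Multiplicative.toAdd,
      Nat.card_zmod])⟩

end PSLTwoData

theorem nonempty_mulEquiv_cyc_of_prime {H : Type*} [Group H] {n : ℕ} (hn : n.Prime)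
    (h : Nat.card H = n) : Nonempty (H ≃* Cyc n) := by
  have : Fact n.Prime := ⟨hn⟩
  exact ⟨mulEquivOfPrimeCardEq (p := n) h (by
    rw [Nat.card_congr Multiplicative.toAdd, Nat.card_zmod])⟩

theorem isKleinFour_of_mul_self {H : Type*} [Group H] (hc : Nat.card H = 4)
    (h : ∀ x : H, x * x = 1) : IsKleinFour H where
  card_four := hc
  exponent_two := by
    have := (Nat.dvd_prime Nat.prime_two).1
      (Monoid.exponent_dvd_of_forall_pow_eq_one fun x : H => by rw [pow_two, h])
    refine this.resolve_left fun h1 => ?_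
    have := Monoid.exp_eq_one_iff.1 h1
    have := Nat.card_of_subsingleton (1 : H)
    omega

theorem nonempty_mulEquiv_elemAb_two_two {H : Type*} [Group H] (hc : Nat.card H = 4)
    (h : ∀ x : H, x * x = 1) : Nonempty (H ≃* ElemAb 2 2) := by
  have := isKleinFour_of_mul_self hc h
  have : IsKleinFour (ElemAb 2 2) := isKleinFour_of_mul_self (by
    rw [Nat.card_congr Multiplicative.toAdd]; simp) (by decide)
  exact IsKleinFour.nonempty_mulEquiv

namespace PSLTwo

variable {F : Type*} [Field F]

theorem nonempty_map_uni_mulEquiv (h2 : (2 : F) ≠ 0) [Algebra (ZMod 3) F] [Finite F] :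
    Nonempty ((uni F).map proj ≃* ElemAb 3 (Module.finrank (ZMod 3) F)) := by
  let f : Multiplicative F →* (uni F).map proj :=
    { toFun := fun b => ⟨proj (sl 1 b.toAdd 0 1 (by ring)), proj_sl_mem_uni.2 ⟨rfl, rfl⟩⟩
      map_one' := Subtype.ext (proj_sl_eq_one_iff.2 (by simp))
      map_mul' := fun a b => Subtype.ext <| by
        rw [Subgroup.coe_mul, proj_sl_mul, proj_sl_eq_iff]
        left
        simp [add_comm] }
  have hf : Function.Bijective f := by
    constructor
    · intro a b h
      rcases proj_sl_eq_iff.1 (Subtype.ext_iff.1 h) with h | h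
      · exact h.2.1
      · exact absurd (by linear_combination h.1) h2
    · rintro ⟨x, hx⟩
      obtain ⟨b, rfl⟩ := mem_map_uni.1 hx
      exact ⟨.ofAdd b, rfl⟩
  exact ⟨(MulEquiv.ofBijective f hf).symm.trans
    (AddEquiv.toMultiplicative (Module.finBasis (ZMod 3) F).equivFun.toAddEquiv)⟩

theorem not_isSolvable (hF : 4 ≤ Nat.card F) :
    ¬ Group.IsSolvable (ProjectiveSpecialLinearGroup (Fin 2) F) := by
  have := ProjectiveSpecialLinearGroup.rank_two_simple hF
  rw [← IsSimpleGroup.comm_iff_isSolvable]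
  intro h
  have := h (proj (sl 1 1 0 1 (by ring))) (proj (sl 1 0 1 1 (by ring)))
  rw [proj_sl_mul, proj_sl_mul, proj_sl_eq_iff] at this
  rcases this with ⟨h, -⟩ | ⟨h, h', -⟩
  · exact one_ne_zero (α := F) (by linear_combination h)
  · exact one_ne_zero (α := F) (by linear_combination h - h')

end PSLTwo

theorem exists_three_pow_eq {p : ℕ} (hp : p.Prime) (hp2 : p ≠ 2) :
    ∃ k, 3 ≤ k ∧ 3 ^ p = 8 * k + 3 := by
  obtain ⟨m, rfl⟩ := hp.odd_of_ne_two hp2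
  have hm : 1 ≤ m := by
    by_contra! h
    obtain rfl : m = 0 := by omega
    exact hp.ne_one rfl
  have h1 : (9 : ℕ) ^ m % 8 = 1 := by rw [Nat.pow_mod]; simp
  have h2 : 9 ^ 1 ≤ 9 ^ m := Nat.pow_le_pow_right (by norm_num) hm
  have h3 : 3 ^ (2 * m + 1) = 9 ^ m * 3 := by rw [pow_succ, pow_mul]; norm_num
  rw [h3]
  -- As 9^m ≡ 1 mod 8, the number 3 · 9^m is 3 mod 8, so the floor is the required k.
  exact ⟨9 ^ m * 3 / 8, by omega, by omega⟩

end Assembly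

theorem theorem3p2 (p q : ℕ) (hp : p.Prime) (hp2 : p ≠ 2) (hq : q = 3 ^ p)
    (F : Type*) [Field F] (hF : Nat.card F = q) :
    ∃ φ : Cyc ((q - 1) / 2) →* MulAut (ElemAb 3 p), Function.Injective φ ∧
    -- every maximal subgroup is of one of the four isomorphism types
    (∀ M : Subgroup (Matrix.ProjectiveSpecialLinearGroup (Fin 2) F), IsCoatom M →
      Nonempty (M ≃* ElemAb 3 p ⋊[φ] Cyc ((q - 1) / 2)) ∨
      Nonempty (M ≃* DihedralGroup ((q - 1) / 2)) ∨
      Nonempty (M ≃* DihedralGroup ((q + 1) / 2)) ∨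
      Nonempty (M ≃* alternatingGroup (Fin 4))) ∧
    ∀ x : Matrix.ProjectiveSpecialLinearGroup (Fin 2) F, x ≠ 1 →
      -- the four columns cover all nontrivial elements
      (orderOf x = 2 ∨ orderOf x = 3 ∨
        (orderOf x ∣ q - 1 ∧ orderOf x ≠ 2) ∨ (orderOf x ∣ q + 1 ∧ orderOf x ≠ 2)) ∧
      -- the solubilizer is the union of the maximal subgroups containing `x`
      solubilizer x = (⋃ M ∈ maximalOver x,
        (M : Set (Matrix.ProjectiveSpecialLinearGroup (Fin 2) F))) ∧
      (orderOf x = 2 →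
        maximalCount x (ElemAb 3 p ⋊[φ] Cyc ((q - 1) / 2)) = 0 ∧
        maximalCount x (DihedralGroup ((q - 1) / 2)) = (q + 1) / 2 ∧
        maximalCount x (DihedralGroup ((q + 1) / 2)) = (q + 3) / 2 ∧
        maximalCount x (alternatingGroup (Fin 4)) = (q + 1) / 4 ∧
        (∀ M ∈ maximalOver x, ∀ N ∈ maximalOver x, M ≠ N →
          Nonempty (↥(M ⊓ N) ≃* Cyc 2) ∨ Nonempty (↥(M ⊓ N) ≃* ElemAb 2 2)) ∧
        (∃ M ∈ maximalOver x, ∃ N ∈ maximalOver x, M ≠ N ∧ Nonempty (↥(M ⊓ N) ≃* Cyc 2)) ∧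
        (∃ M ∈ maximalOver x, ∃ N ∈ maximalOver x, M ≠ N ∧
          Nonempty (↥(M ⊓ N) ≃* ElemAb 2 2)) ∧
        (solubilizer x).ncard = q * (q + 1)) ∧
      (orderOf x = 3 →
        maximalCount x (ElemAb 3 p ⋊[φ] Cyc ((q - 1) / 2)) = 1 ∧
        maximalCount x (DihedralGroup ((q - 1) / 2)) = 0 ∧
        maximalCount x (DihedralGroup ((q + 1) / 2)) = 0 ∧
        maximalCount x (alternatingGroup (Fin 4)) = q / 3 ∧
        (∀ M ∈ maximalOver x, ∀ N ∈ maximalOver x, M ≠ N →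
          Nonempty (↥(M ⊓ N) ≃* Cyc 3)) ∧
        (solubilizer x).ncard = q * (q + 5) / 2) ∧
      (orderOf x ∣ q - 1 → orderOf x ≠ 2 →
        maximalCount x (ElemAb 3 p ⋊[φ] Cyc ((q - 1) / 2)) = 2 ∧
        maximalCount x (DihedralGroup ((q - 1) / 2)) = 1 ∧
        maximalCount x (DihedralGroup ((q + 1) / 2)) = 0 ∧
        maximalCount x (alternatingGroup (Fin 4)) = 0 ∧
        (∀ M ∈ maximalOver x, ∀ N ∈ maximalOver x, M ≠ N →
          Nonempty (↥(M ⊓ N) ≃* Cyc ((q - 1) / 2))) ∧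
        (solubilizer x).ncard = q * (q - 1)) ∧
      (orderOf x ∣ q + 1 → orderOf x ≠ 2 →
        maximalCount x (ElemAb 3 p ⋊[φ] Cyc ((q - 1) / 2)) = 0 ∧
        maximalCount x (DihedralGroup ((q - 1) / 2)) = 0 ∧
        maximalCount x (DihedralGroup ((q + 1) / 2)) = 1 ∧
        maximalCount x (alternatingGroup (Fin 4)) = 0 ∧
        (∀ M ∈ maximalOver x, ∀ N ∈ maximalOver x, M = N) ∧
        (solubilizer x).ncard = q + 1) := by
  obtain ⟨k, hk, hqk⟩ := exists_three_pow_eq hp hp2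
  rw [← hq] at hqk
  have : Finite F := Nat.finite_of_card_ne_zero (by omega)
  have : Fact (Nat.Prime 3) := ⟨Nat.prime_three⟩
  have : CharP F 3 := by
    have := Fintype.ofFinite F
    exact charP_of_card_eq_prime_pow (by rw [← Nat.card_eq_fintype_card, hF, hq])
  let _ : Algebra (ZMod 3) F := ZMod.algebra F 3
  have hrank : Module.finrank (ZMod 3) F = p := by
    have := Module.natCard_eq_pow_finrank (K := ZMod 3) (V := F)
    rw [hF, hq, Nat.card_zmod] at this
    exact (Nat.pow_right_injective (a := 3) (by norm_num) this).symm
  let D : PSLTwoData (Matrix.ProjectiveSpecialLinearGroup (Fin 2) F) (8 * k + 3) k :=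
    PSLTwo.pslTwoData (hrank ▸ hp) hk (hF.trans hqk) ⟨p, by rw [← hqk, hq]⟩
  have h2 : (2 : F) ≠ 0 := fun h => one_ne_zero (α := F) (by
    linear_combination (CharP.ofNat_eq_zero F 3) - h)
  obtain ⟨e⟩ : Nonempty (D.U ≃* ElemAb 3 p) := hrank ▸ PSLTwo.nonempty_map_uni_mulEquiv h2
  have := D.cyclic_S
  have f : D.S ≃* Cyc (4 * k + 1) := mulEquivOfCyclicCardEq (by
    rw [D.card_S, Nat.card_congr Multiplicative.toAdd, Nat.card_zmod])
  subst hqk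
  -- `DihedralGroup n` has order 2n, so n = 4k + 1 and n = 4k + 2 give the dihedral groups of orders
  -- q - 1 and q + 1.
  rw [show (8 * k + 3 - 1) / 2 = 4 * k + 1 by omega, show (8 * k + 3 + 1) / 2 = 4 * k + 2 by omega,
    show (8 * k + 3 + 3) / 2 = 4 * k + 3 by omega, show (8 * k + 3 + 1) / 4 = 2 * k + 1 by omega,
    show 8 * k + 3 - 1 = 8 * k + 2 by omega, show 8 * k + 3 + 1 = 8 * k + 4 by omega]
  have hG := PSLTwo.not_isSolvable (F := F) (by omega)
  obtain ⟨φ, hφ, hB⟩ := D.exists_nonempty_B_mulEquiv e f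
  have c0 := D.maximalCount_eq 0 hB
  have c1 := D.maximalCount_eq 1 D.nonempty_NS_mulEquiv
  have c2 := D.maximalCount_eq 2 D.nonempty_NT_mulEquiv
  have c3 := D.maximalCount_eq 3 D.nonempty_A_mulEquiv
  refine ⟨φ, hφ, fun M hM => ?_, fun x hx => ⟨?_, D.solubilizer_eq D.isSolvable_B hG x,
    fun h => ?_, fun h => ?_, fun h h' => ?_, fun h h' => ?_⟩⟩
  · obtain ⟨a, g, rfl⟩ := D.isCoatom_iff.1 hM
    have s := (Subgroup.equivSMul (MulAut.conj g) (D.maxl a)).symm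
    fin_cases a
    · exact .inl (hB.map s.trans)
    · exact .inr (.inl (D.nonempty_NS_mulEquiv.map s.trans))
    · exact .inr (.inr (.inl (D.nonempty_NT_mulEquiv.map s.trans)))
    · exact .inr (.inr (.inr (D.nonempty_A_mulEquiv.map s.trans)))
  · rcases D.orderOf_cases hx with h | ⟨g, hg⟩ | h | ⟨g, hg, hx2⟩
    · exact .inr (.inl h)
    · refine .inr (.inr (.inl ⟨?_, fun h => ?_⟩))
      · rw [← orderOf_conj g]
        exact (D.orderOf_dvd_of_mem_S hg).trans ⟨2, by ring⟩
      · exact D.mul_self_ne_one_of_conj_mem_S hg hx (orderOf_eq_two_iff_mul_self.1 h).1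
    · exact .inl h
    · refine .inr (.inr (.inr ⟨?_, fun h => hx2 (orderOf_eq_two_iff_mul_self.1 h).1⟩))
      rw [← orderOf_conj g]
      exact (D.orderOf_dvd_of_mem_T hg).trans ⟨2, by ring⟩
  · rw [c0, c1, c2, c3, D.solubilizer_eq D.isSolvable_B hG x]
    refine ⟨D.ncard_over_of_orderOf_two h 0, D.ncard_over_of_orderOf_two h 1,
      D.ncard_over_of_orderOf_two h 2, D.ncard_over_of_orderOf_two h 3, ?_, ?_, ?_,
      D.ncard_union_of_orderOf_two h⟩
    · intro M hM N hN hMN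
      exact (D.card_inf_of_orderOf_two h hM hN hMN).imp
        (nonempty_mulEquiv_cyc_of_prime Nat.prime_two)
        fun hc => nonempty_mulEquiv_elemAb_two_two hc fun y =>
          Subtype.ext (D.mul_self_of_mem_inf h hM hN hMN y.2)
    · obtain ⟨M, hM, N, hN, hMN, hc⟩ := D.exists_card_inf_eq_two h
      exact ⟨M, hM, N, hN, hMN, nonempty_mulEquiv_cyc_of_prime Nat.prime_two hc⟩
    · obtain ⟨M, hM, N, hN, hMN, hc⟩ := D.exists_card_inf_eq_four h
      exact ⟨M, hM, N, hN, hMN, nonempty_mulEquiv_elemAb_two_two hc fun y =>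
        Subtype.ext (D.mul_self_of_mem_inf h hM hN hMN y.2)⟩
  · rw [c0, c1, c2, c3, D.solubilizer_eq D.isSolvable_B hG x]
    exact ⟨D.ncard_over_of_orderOf_three h 0, D.ncard_over_of_orderOf_three h 1,
      D.ncard_over_of_orderOf_three h 2, D.ncard_over_of_orderOf_three h 3,
      fun M hM N hN hMN => nonempty_mulEquiv_cyc_of_prime Nat.prime_three
        (D.card_inf_of_orderOf_three h hM hN hMN), D.ncard_union_of_orderOf_three h⟩
  · obtain ⟨g, hg⟩ := D.exists_conj_mem_S hx h h'
    rw [c0, c1, c2, c3, D.solubilizer_eq D.isSolvable_B hG x]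
    refine ⟨D.ncard_over_of_conj_mem_S hg hx 0, D.ncard_over_of_conj_mem_S hg hx 1,
      D.ncard_over_of_conj_mem_S hg hx 2, D.ncard_over_of_conj_mem_S hg hx 3,
      fun M hM N hN hMN => ?_, D.ncard_union_of_conj_mem_S hg hx⟩
    rw [D.inf_eq_centralizer hg hx hM hN hMN]
    exact D.nonempty_centralizer_mulEquiv hg hx
  · obtain ⟨g, hg, hx2⟩ := D.exists_conj_mem_T_of_dvd hx h h'
    rw [c0, c1, c2, c3, D.solubilizer_eq D.isSolvable_B hG x]
    exact ⟨D.ncard_over_of_conj_mem_T hg hx2 0, D.ncard_over_of_conj_mem_T hg hx2 1,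
      D.ncard_over_of_conj_mem_T hg hx2 2, D.ncard_over_of_conj_mem_T hg hx2 3,
      fun M hM N hN => D.eq_of_conj_mem_T hg hx2 hM hN, D.ncard_union_of_conj_mem_T hg hx2⟩
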